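/- Let $(M,\varphi)$ be a tracial von Neumann algebra ($\varphi$ a faithful normal tracial state), let $X=(x_1,\dots,x_n)$ be an $n$-tuple of elements of $M$, and let $F=(f_1,\dots,f_p)$ be a $p$-tuple in $\mathfrak A_n$, the universal unital complex $*$-algebra on generators $X_1,\dots,X_n$. Write $F(X)=(f_1(X),\dots,f_p(X))$. Then $$\delta_0(X)\;\le\;\mathrm{Nullity}(D^sF(X))+\delta_0(F(X):X)\;=\;2n-\mathrm{Rank}(D^sF(X))+\delta_0(F(X):X),$$ and $\mathrm{Nullity}(D^sF(X))=2n-\mathrm{Rank}(D^sF(X))$. The notions are as follows. *Free entropy dimension.* For a tuple $Y=(y_1,\dots,y_q)$ in $M$, $m,k\in\mathbb N$ and $\gamma>0$, $\Gamma(Y;m,k,\gamma)$ is the set of $\xi\in M_k(\mathbb C)^q$ with $|\varphi(y_{i_1}^{s_1}\cdots y_{i_l}^{s_l})-tr_k(\xi_{i_1}^{s_1}\cdots\xi_{i_l}^{s_l})|<\gamma$ for all $1\le l\le m$, all indices $i_1,\dots,i_l$ and all $s_1,\dots,s_l\in\{1,*\}$, where $tr_k$ is the normalized trace. For a second tuple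 $Z$, $\Gamma(Y:Z;m,k,\gamma)$ is the projection of $\Gamma(Y\cup Z;m,k,\gamma)$ onto the coordinates of $Y$. Let $K_\epsilon$ be the minimal number of open $\epsilon$-balls needed to cover a set, for the norm $\|\xi\|_2=(\sum_i tr_k(\xi_i^*\xi_i))^{1/2}$. Put $$\mathbb K_\epsilon(Y)=\inf_{m\in\mathbb N,\,\gamma>0}\ \limsup_{k\to\infty}k^{-2}\log K_\epsilon(\Gamma(Y;m,k,\gamma)),\qquad \delta_0(Y)=\limsup_{\epsilon\to0^+}\frac{\mathbb K_\epsilon(Y)}{|\log\epsilon|},$$ with values in $[-\infty,\infty]$ and $\log 0=-\infty$. Define $\delta_0(Y:Z)$ in the same way from $\Gamma(Y:Z;m,k,\gamma)$. *S-derivative.* For $1\le j\le n$ let $\partial_{sa},\partial_{sk}:\mathfrak A_n\to\mathfrak A_n\odot\mathfrak A_n^{op}$ be the complex linear derivations that vanish on $X_i,X_i^*$ for $i\ne j$ and satisfy $\partial_{sa}(X_j)=\partial_{sa}(X_j^*)=\partial_{sk}(X_j)=1\odot1$, $\partial_{sk}(X_j^*)=-1\odot1$. For $f\in\mathfrak A_n$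 put $f_1=(f+f^*)/2$, $f_2=(f-f^*)/2$, and let $(\partial_j^sf)(X)$ be the image of $\begin{bmatrix}\partial_{sa}f_1&\partial_{sk}f_1\\ \partial_{sa}f_2&\partial_{sk}f_2\end{bmatrix}$ in $M_2(M\otimes M^{op})$ (von Neumann algebra tensor product) under evaluation at $X$ in both tensor factors. $D^sF(X)$ is the $p\times n$ block matrix with blocks $(\partial_j^sf_i)(X)$, regarded as a $2p\times2n$ matrix over $M\otimes M^{op}$. *Nullity and rank.* With $T=D^sF(X)$ and $\psi=tr_{2n}\otimes(\varphi\otimes\varphi^{op})$ on $M_{2n}(M\otimes M^{op})$, $\mathrm{Nullity}(T)=2n\,\psi(1_{\{0\}}(T^*T))$ and $\mathrm{Rank}(T)=2n\,\psi(1_{(0,\infty)}(T^*T))$. -/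

import Mathlib

open scoped ComplexOrder TensorProduct InnerProductSpace Topology
open Filter UniformSpace

noncomputable section

namespace FreeEntropy

/-! ### Noncommutative `*`-polynomials -/

/-- A letter `(i, false)` stands for the indeterminate `X_i`, a letter `(i, true)` for `X_i^*`. -/
abbrev Letter (ι : Type*) := ι × Bool

/-- The value at the tuple `x` of a letter. -/
def evalLetter {ι A : Type*} [Star A] (x : ι → A) (l : Letter ι) : A :=
  if l.2 then star (x l.1) else x l.1

/-- The value `x_{i_1}^{j_1} ⋯ x_{i_p}^{j_p}` at the tuple `x` of a `*`-monomial. -/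
def evalWord {ι A : Type*} [Monoid A] [Star A] (x : ι → A) (w : List (Letter ι)) : A :=
  (w.map (evalLetter x)).prod

/-- The universal unital complex `*`-algebra on generators indexed by `ι`: finite complex linear
combinations of `*`-monomials. Its involution is `StarPoly.adj` below. -/
abbrev StarPoly (ι : Type*) := MonoidAlgebra ℂ (FreeMonoid (Letter ι))

/-- The `*`-monomial given by a list of letters. -/
def StarPoly.mono {ι : Type*} (w : List (Letter ι)) : StarPoly ι :=
  MonoidAlgebra.single (FreeMonoid.ofList w) 1

/-- The adjoint of a list of letters: reverse it and exchange `X_i` with `X_i^*`. -/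
def adjWord {ι : Type*} (w : List (Letter ι)) : List (Letter ι) :=
  (w.map fun l => (l.1, !l.2)).reverse

/-- The involution `f ↦ f^*` (conjugate linear, antimultiplicative, `X_i ↦ X_i^*`). -/
def StarPoly.adj {ι : Type*} (f : StarPoly ι) : StarPoly ι :=
  f.coeff.sum fun w c => starRingEnd ℂ c • StarPoly.mono (adjWord w.toList)

/-- The canonical unital homomorphism `π_x` with `X_i ↦ x_i` and `X_i^* ↦ x_i^*`. -/
def StarPoly.eval {ι A : Type*} [Ring A] [Algebra ℂ A] [Star A] (x : ι → A) :
    StarPoly ι →ₐ[ℂ] A :=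
  MonoidAlgebra.lift ℂ A (FreeMonoid (Letter ι)) (FreeMonoid.lift (evalLetter x))

/-! ### Microstates, covering numbers and the free entropy dimension -/

/-- `k × k` complex matrices. -/
abbrev Mat (k : ℕ) := Matrix (Fin k) (Fin k) ℂ

/-- The normalized trace on `k × k` matrices. -/
def ntr {k : ℕ} (a : Mat k) : ℂ := a.trace / k

/-- The distance on tuples of matrices given by the norm `(∑ tr_k (ξ_i^* ξ_i))^{1/2}`. -/
def dist2 {ι : Type*} [Fintype ι] {k : ℕ} (ξ η : ι → Mat k) : ℝ :=
  √(∑ i, (ntr (star (ξ i - η i) * (ξ i - η i))).re)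

/-- The minimal number of open balls of radius `ε` (with centres anywhere) covering `A`. -/
def coveringNumber {ι : Type*} [Fintype ι] {k : ℕ} (ε : ℝ) (A : Set (ι → Mat k)) : ℕ∞ :=
  ⨅ (Λ : Set (ι → Mat k)) (_ : A ⊆ ⋃ c ∈ Λ, {ξ | dist2 ξ c < ε}), Λ.encard

/-- The `(m, k, γ)` `*`-microstates of a tuple `x` with respect to the functional `φ`. -/
def microstates {M ι : Type*} [Monoid M] [Star M] (φ : M → ℂ) (x : ι → M)
    (m k : ℕ) (γ : ℝ) : Set (ι → Mat k) :=
  {ξ | ∀ w : List (Letter ι), 1 ≤ w.length → w.length ≤ m →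
    ‖φ (evalWord x w) - ntr (evalWord ξ w)‖ < γ}

/-- The `(m, k, γ)` `*`-microstates of `x` in the presence of `y`: the projection of the
microstates of the concatenated tuple `x ∪ y` onto the coordinates of `x`. -/
def relMicrostates {M ι κ : Type*} [Monoid M] [Star M] (φ : M → ℂ) (x : ι → M) (y : κ → M)
    (m k : ℕ) (γ : ℝ) : Set (ι → Mat k) :=
  {ξ | ∃ η : κ → Mat k, Sum.elim ξ η ∈ microstates φ (Sum.elim x y) m k γ}

/-- `𝕂_ε`: the infimum over `m ∈ ℕ` and `γ > 0` of
`limsup_{k → ∞} k⁻² log K_ε(Γ(m, k, γ))`, in the extended reals (with `log 0 = -∞`). -/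
def entropyRate {ι : Type*} [Fintype ι] (Γ : ℕ → (k : ℕ) → ℝ → Set (ι → Mat k)) (ε : ℝ) : EReal :=
  ⨅ (m : ℕ) (γ : ℝ) (_ : 0 < γ),
    limsup (fun k : ℕ =>
      ENNReal.log (coveringNumber ε (Γ m k γ) : ENNReal) / (((k : ℝ) ^ 2 : ℝ) : EReal)) atTop

/-- `limsup_{ε → 0+} 𝕂_ε / |log ε|`. -/
def entropyDim {ι : Type*} [Fintype ι] (Γ : ℕ → (k : ℕ) → ℝ → Set (ι → Mat k)) : EReal :=
  limsup (fun ε : ℝ => entropyRate Γ ε / ((|Real.log ε| : ℝ) : EReal)) (𝓝[>] 0)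

/-- The modified microstates free entropy dimension `δ₀(x)`. -/
def delta0 {M ι : Type*} [Monoid M] [Star M] [Fintype ι] (φ : M → ℂ) (x : ι → M) : EReal :=
  entropyDim (microstates φ x)

/-- The relative version `δ₀(x : y)`. -/
def relDelta0 {M ι κ : Type*} [Monoid M] [Star M] [Fintype ι]
    (φ : M → ℂ) (x : ι → M) (y : κ → M) : EReal :=
  entropyDim (relMicrostates φ x y)

/-! ### Tracial von Neumann algebras and the tensor product `M ⊗ M^op` -/

/-- A faithful normal tracial state on `M`. Normality is preservation of suprema of bounded
increasing nets of self-adjoint elements. -/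
structure TracialState (M : Type*) [CStarAlgebra M] [PartialOrder M] [StarOrderedRing M] where
  /-- The underlying positive linear functional. -/
  toFun : M →ₚ[ℂ] ℂ
  map_one : toFun 1 = 1
  tracial : ∀ a b, toFun (a * b) = toFun (b * a)
  faithful : ∀ a, toFun (star a * a) = 0 → a = 0
  normal : ∀ (S : Set M) (a : M), S.Nonempty → DirectedOn (· ≤ ·) S →
    (∀ s ∈ S, IsSelfAdjoint s) → IsLUB S a → IsLUB (toFun '' S) (toFun a)

variable {M : Type*} [CStarAlgebra M] [PartialOrder M] [StarOrderedRing M]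

/-- `L²(M)`: the completion of `M` for `⟨a, b⟩ = φ(a^* b)` (the Hilbert space of the GNS
construction). -/
abbrev L2 (φ : TracialState M) := φ.toFun.GNS

/-- Right multiplication `x ↦ x b`, bounded for the norm of `L²(M)` because `φ` is a trace. -/
def rightMulPre (φ : TracialState M) (b : M) : φ.toFun.PreGNS →L[ℂ] φ.toFun.PreGNS :=
  (φ.toFun.toPreGNS.toLinearMap ∘ₗ (LinearMap.mulRight ℂ b) ∘ₗ
    φ.toFun.ofPreGNS.toLinearMap).mkContinuous ‖star b‖ fun x => by
    have h1 := (φ.toFun.leftMulMapPreGNS (star b)).le_of_opNorm_le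
      (LinearMap.mkContinuous_norm_le _ (norm_nonneg _) _)
      (φ.toFun.toPreGNS (star (φ.toFun.ofPreGNS x)))
    have h2 : ∀ a : M, ‖φ.toFun.toPreGNS (star a)‖ = ‖φ.toFun.toPreGNS a‖ := fun a => by
      simp [PositiveLinearMap.preGNS_norm_def, φ.tracial a (star a)]
    have h3 : φ.toFun.leftMulMapPreGNS (star b) (φ.toFun.toPreGNS (star (φ.toFun.ofPreGNS x)))
        = φ.toFun.toPreGNS (star (φ.toFun.ofPreGNS x * b)) := by
      simp
    rw [h3, h2, h2] at h1
    simpa using h1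

/-- The algebra `M` acting on `L²(M)` by left multiplication. -/
def leftRep (φ : TracialState M) (a : M) : L2 φ →L[ℂ] L2 φ := φ.toFun.gnsStarAlgHom a

/-- The algebra `M^op` acting on `L²(M^op) = L²(M)`: `b^op` acts by right multiplication
by `b`. -/
def rightRep (φ : TracialState M) (b : Mᵐᵒᵖ) : L2 φ →L[ℂ] L2 φ :=
  (rightMulPre φ b.unop).completion

/-- The Hilbert space tensor product `L²(M) ⊗ L²(M^op)`. -/
abbrev L2Tensor (φ : TracialState M) := Completion (L2 φ ⊗[ℂ] L2 φ)

lemma coe_L2_ext (φ : TracialState M) {S T : L2 φ →L[ℂ] L2 φ}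
    (h : ∀ x : φ.toFun.PreGNS, S (x : L2 φ) = T (x : L2 φ)) : S = T := by
  ext z
  induction z using Completion.induction_on with
  | hp => exact isClosed_eq S.continuous T.continuous
  | ih a => exact h a

lemma rightRep_coe (φ : TracialState M) (b : Mᵐᵒᵖ) (x : φ.toFun.PreGNS) :
    rightRep φ b (x : L2 φ)
      = ((φ.toFun.toPreGNS (φ.toFun.ofPreGNS x * b.unop) : φ.toFun.PreGNS) : L2 φ) :=
  ContinuousLinearMap.completion_apply_coe _ _

lemma completion_mapL_ext (φ : TracialState M) {S T : L2Tensor φ →L[ℂ] L2Tensor φ}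
    (h : ∀ z : L2 φ ⊗[ℂ] L2 φ, S (z : L2Tensor φ) = T (z : L2Tensor φ)) : S = T := by
  ext z
  induction z using Completion.induction_on with
  | hp => exact isClosed_eq S.continuous T.continuous
  | ih a => exact h a

/-- The representation of the algebraic tensor product `M ⊙ M^op` on `L²(M) ⊗ L²(M^op)`:
`a ⊙ b^op` acts as (left multiplication by `a`) `⊗` (right multiplication by `b`). -/
def tensorRep (φ : TracialState M) : M ⊗[ℂ] Mᵐᵒᵖ →ₗ[ℂ] (L2Tensor φ →L[ℂ] L2Tensor φ) :=
  TensorProduct.lift <| LinearMap.mk₂ ℂ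
    (fun a b => (TensorProduct.mapL (leftRep φ a) (rightRep φ b)).completion)
    (fun a a' b => completion_mapL_ext φ fun z => by
      simp [leftRep, TensorProduct.map_add_left, Completion.coe_add])
    (fun c a b => completion_mapL_ext φ fun z => by
      simp [leftRep, TensorProduct.map_smul_left, Completion.coe_smul])
    (fun a b b' => by
      have h : rightRep φ (b + b') = rightRep φ b + rightRep φ b' := coe_L2_ext φ fun x => by
        simp [rightRep_coe, mul_add, Completion.coe_add]
      refine completion_mapL_ext φ fun z => ?_
      simp [h, TensorProduct.map_add_right, Completion.coe_add])
    (fun c a b => by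
      have h : rightRep φ (c • b) = c • rightRep φ b := coe_L2_ext φ fun x => by
        simp [rightRep_coe, Completion.coe_smul]
      refine completion_mapL_ext φ fun z => ?_
      simp [h, TensorProduct.map_smul_right, Completion.coe_smul])

/-- The double commutant of (the image of) `M ⊙ M^op`, as a `*`-subalgebra. -/
def tensorBicommutant (φ : TracialState M) :
    StarSubalgebra ℂ (L2Tensor φ →L[ℂ] L2Tensor φ) :=
  StarSubalgebra.centralizer ℂ
    (StarSubalgebra.centralizer ℂ (Set.range (tensorRep φ)) : Set (L2Tensor φ →L[ℂ] L2Tensor φ))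

lemma coe_tensorBicommutant (φ : TracialState M) :
    (tensorBicommutant φ : Set (L2Tensor φ →L[ℂ] L2Tensor φ))
      = (Set.range (tensorRep φ) ∪ star (Set.range (tensorRep φ))).centralizer.centralizer :=
  StarSubalgebra.coe_centralizer_centralizer ℂ _

/-- The von Neumann algebra tensor product `M ⊗ M^op`: the von Neumann algebra on
`L²(M) ⊗ L²(M^op)` generated by the algebraic tensor product. -/
def vnTensor (φ : TracialState M) : VonNeumannAlgebra (L2Tensor φ) where
  toStarSubalgebra := tensorBicommutant φ
  centralizer_centralizer' := by
    change Set.centralizer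
      (Set.centralizer (tensorBicommutant φ : Set (L2Tensor φ →L[ℂ] L2Tensor φ))) = (tensorBicommutant φ : Set (L2Tensor φ →L[ℂ] L2Tensor φ))
    rw [coe_tensorBicommutant, Set.centralizer_centralizer_centralizer]

lemma tensorRep_mem (φ : TracialState M) (t : M ⊗[ℂ] Mᵐᵒᵖ) : tensorRep φ t ∈ vnTensor φ := by
  change tensorRep φ t ∈ (tensorBicommutant φ : Set (L2Tensor φ →L[ℂ] L2Tensor φ))
  rw [coe_tensorBicommutant]
  exact Set.subset_centralizer_centralizer (Or.inl ⟨t, rfl⟩)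

/-- The embedding `ι : M ⊙ M^op → M ⊗ M^op`. -/
def toVN (φ : TracialState M) (t : M ⊗[ℂ] Mᵐᵒᵖ) : vnTensor φ := ⟨tensorRep φ t, tensorRep_mem φ t⟩

/-- The unit vector `1 ⊗ 1`, whose vector state is the trace `φ ⊗ φ^op` on `M ⊗ M^op`. -/
def unitVec (φ : TracialState M) : L2Tensor φ :=
  (((φ.toFun.toPreGNS 1 : φ.toFun.PreGNS) : L2 φ) ⊗ₜ[ℂ]
    ((φ.toFun.toPreGNS 1 : φ.toFun.PreGNS) : L2 φ) : L2 φ ⊗[ℂ] L2 φ)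

/-! ### Matrices over `M ⊗ M^op`, nullity and rank -/

/-- A matrix over `M ⊗ M^op` as a bounded operator between direct sums of copies of
`L²(M) ⊗ L²(M^op)`. -/
def matOp (φ : TracialState M) {κ ι : Type*} [Fintype κ] [Fintype ι]
    (T : Matrix κ ι (vnTensor φ)) :
    PiLp 2 (fun _ : ι => L2Tensor φ) →L[ℂ] PiLp 2 (fun _ : κ => L2Tensor φ) :=
  (PiLp.continuousLinearEquiv 2 ℂ (fun _ : κ => L2Tensor φ)).symm.toContinuousLinearMap ∘L
    ContinuousLinearMap.pi fun k =>
      ∑ i, (T k i : L2Tensor φ →L[ℂ] L2Tensor φ) ∘L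
        PiLp.proj (𝕜 := ℂ) 2 (fun _ : ι => L2Tensor φ) i

/-- The operator `T^* T`. -/
def absSq (φ : TracialState M) {κ ι : Type*} [Fintype κ] [Fintype ι]
    (T : Matrix κ ι (vnTensor φ)) :
    PiLp 2 (fun _ : ι => L2Tensor φ) →L[ℂ] PiLp 2 (fun _ : ι => L2Tensor φ) :=
  (matOp φ T).adjoint ∘L matOp φ T

/-- The unnormalized trace `d · (tr_d ⊗ (φ ⊗ φ^op))`, `d = #ι`, on `d × d` matrices over
`M ⊗ M^op`: the sum of `(φ ⊗ φ^op)` over the diagonal entries. -/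
def matTrace (φ : TracialState M) {ι : Type*} [Fintype ι] [DecidableEq ι]
    (S : PiLp 2 (fun _ : ι => L2Tensor φ) →L[ℂ] PiLp 2 (fun _ : ι => L2Tensor φ)) : ℝ :=
  ∑ i, (⟪unitVec φ, S (PiLp.single 2 i (unitVec φ)) i⟫_ℂ).re

/-- The nullity: the trace of the spectral projection `1_{{0}}(T^* T)`, which is the orthogonal
projection onto the kernel of `T^* T`. -/
def nullity (φ : TracialState M) {κ ι : Type*} [Fintype κ] [Fintype ι] [DecidableEq ι]
    (T : Matrix κ ι (vnTensor φ)) : ℝ :=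
  matTrace φ (absSq φ T).ker.starProjection

/-- The rank: the trace of the spectral projection `1_{(0,∞)}(T^* T)`, which is the orthogonal
projection onto the closure of the range of `T^* T`. -/
def rank (φ : TracialState M) {κ ι : Type*} [Fintype κ] [Fintype ι] [DecidableEq ι]
    (T : Matrix κ ι (vnTensor φ)) : ℝ :=
  matTrace φ (absSq φ T).range.topologicalClosure.starProjection

/-! ### Derivations and the S-derivative -/

open MulOpposite in
/-- The value on a `*`-monomial of the derivation into `𝔄 ⊙ 𝔄^op` that sends each letter `l` to
`c l • (1 ⊙ 1)`, by the Leibniz rule `∂(l w) = ∂(l) · w + l · ∂(w)`. -/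
def wordDeriv {ι : Type*} (c : Letter ι → ℂ) :
    List (Letter ι) → StarPoly ι ⊗[ℂ] (StarPoly ι)ᵐᵒᵖ
  | [] => 0
  | l :: w => c l • (1 ⊗ₜ[ℂ] op (StarPoly.mono w))
      + (StarPoly.mono [l] ⊗ₜ[ℂ] 1) * wordDeriv c w

/-- The complex linear derivation with `l ↦ c l • (1 ⊙ 1)` for every letter `l`. -/
def freeDeriv {ι : Type*} (c : Letter ι → ℂ) (f : StarPoly ι) :
    StarPoly ι ⊗[ℂ] (StarPoly ι)ᵐᵒᵖ :=
  f.coeff.sum fun w a => a • wordDeriv c w.toList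

/-- `∂_sa` in the `j`-th indeterminate: `X_j, X_j^* ↦ 1 ⊙ 1` and the other letters `↦ 0`. -/
def derivSa {ι : Type*} [DecidableEq ι] (j : ι) (f : StarPoly ι) :
    StarPoly ι ⊗[ℂ] (StarPoly ι)ᵐᵒᵖ :=
  freeDeriv (fun l => if l.1 = j then 1 else 0) f

/-- `∂_sk` in the `j`-th indeterminate: `X_j ↦ 1 ⊙ 1`, `X_j^* ↦ -1 ⊙ 1` and the other
letters `↦ 0`. -/
def derivSk {ι : Type*} [DecidableEq ι] (j : ι) (f : StarPoly ι) :
    StarPoly ι ⊗[ℂ] (StarPoly ι)ᵐᵒᵖ :=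
  freeDeriv (fun l => if l.1 = j then (if l.2 then -1 else 1) else 0) f

/-- `π_x ⊙ π_x^op : 𝔄 ⊙ 𝔄^op → M ⊙ M^op`. -/
def evalTensor {ι A : Type*} [Ring A] [Algebra ℂ A] [Star A] (x : ι → A) :
    StarPoly ι ⊗[ℂ] (StarPoly ι)ᵐᵒᵖ →ₐ[ℂ] A ⊗[ℂ] Aᵐᵒᵖ :=
  Algebra.TensorProduct.map (StarPoly.eval x) (AlgHom.op (StarPoly.eval x))

/-- The `2 × 2` matrix with rows `(∂_sa f₁, ∂_sk f₁)` and `(∂_sa f₂, ∂_sk f₂)` for the derivations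
in the `j`-th indeterminate, where `f₁ = (f + f^*)/2` and `f₂ = (f - f^*)/2`. -/
def derivMatrix {ι : Type*} [DecidableEq ι] (j : ι) (f : StarPoly ι) :
    Matrix (Fin 2) (Fin 2) (StarPoly ι ⊗[ℂ] (StarPoly ι)ᵐᵒᵖ) :=
  let f₁ : StarPoly ι := (1 / 2 : ℂ) • (f + f.adj)
  let f₂ : StarPoly ι := (1 / 2 : ℂ) • (f - f.adj)
  !![derivSa j f₁, derivSk j f₁; derivSa j f₂, derivSk j f₂]

/-- The S-derivative `D^s F(x)` as a `2m × 2n` matrix over `M ⊗ M^op` in `m × n` blocks of size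
`2 × 2`, the block `(i, j)` being the `j`-th partial S-derivative of `F i` at `x`. -/
def sDeriv (φ : TracialState M) {κ ι : Type*} [DecidableEq ι] (F : κ → StarPoly ι) (x : ι → M) :
    Matrix (κ × Fin 2) (ι × Fin 2) (vnTensor φ) :=
  Matrix.of fun a b => toVN φ (evalTensor x (derivMatrix b.1 (F a.1) a.2 b.2))

end FreeEntropy

end

noncomputable section

namespace FreeEntropy

/-! ### Covering numbers in normed spaces -/

section Covering

/-! Microstates `ξ` of `X` are counted through `F(ξ)`, which is a microstate of `F(X)` in the
presence of `X`. Covering those values by `ε`-balls splits the microstates of `X` into pieces on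
which `F` is constant up to `2ε`. It remains to cover each piece at scale `ε` by `exp((Nullity +
β)|log ε| k² + O(k²))` balls, for every `β > 0`.

Three facts carry this. (a) Free difference quotients are exact: `F(ξ) - F(η)`, split into
self-adjoint and skew-adjoint parts, is the S-derivative with left legs evaluated at `ξ` and right
legs at `η`, applied to `ξ - η` (`matAct_symDeriv`). If `ξ` and `η` are close in operator norm, this
is nearly the derivative at `η`, so `ξ - η` is almost annihilated by that derivative. (b) At
microstates of operator norm at most `R`, at most `(Nullity + β) k²` singular values of the
derivative lie below some fixed `t` (`exists_eventually_card_le`). This follows from convergence of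
the traces of powers of `1 - T^*T/C²` and the mean ergodic theorem. Near-kernel vectors then have
few covering balls (`exists_spectral_cover`). (c) Closeness in 2-norm does not give closeness in
operator norm, but a matrix small in 2-norm is a low-rank matrix plus one of small operator norm.
Such matrices therefore have cheap operator norm nets (`exists_opNorm_cover`).

Together (a)-(c) refine a cover at radius `r` to one at radius `ρ r`, at a cost of at most `(Nullity
+ β) log(1/ρ) k²` in the exponent (`hasCover_step`). About `|log ε| / log(1/ρ)` iterations reach
scale `ε`. Unbounded microstates are first moved slightly to bounded ones by a spectral cutoff
(`eventually_exists_bounded`). The rank form holds because `T^*T` is self-adjoint: its kernel is the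
orthogonal complement of its range, and the trace of the identity is `2n`. -/

open MeasureTheory Metric in
lemma card_le_of_separated {E : Type*} [NormedAddCommGroup E] [NormedSpace ℝ E]
    [FiniteDimensional ℝ E] {r σ : ℝ} (hr : 0 ≤ r) (hσ : 0 < σ) (s : Finset E)
    (hs : ∀ v ∈ s, ‖v‖ ≤ r) (hsep : ∀ v ∈ s, ∀ w ∈ s, v ≠ w → σ < ‖v - w‖) :
    (s.card : ℝ) ≤ (1 + 2 * r / σ) ^ Module.finrank ℝ E := by
  borelize E
  let μ : Measure E := Measure.addHaar
  -- Volume comparison: disjoint balls of radius `σ/2` around the points all lie in the ball of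
  -- radius `r + σ/2`.
  have hdisj : Set.PairwiseDisjoint (s : Set E) fun v => Metric.ball v (σ / 2) := by
    intro v hv w hw hvw
    refine ball_disjoint_ball ?_
    rw [dist_eq_norm]
    linarith [hsep v hv w hw hvw]
  have hsub : (⋃ v ∈ s, Metric.ball v (σ / 2)) ⊆ Metric.ball (0 : E) (r + σ / 2) := by
    intro x hx
    simp only [Set.mem_iUnion, mem_ball, dist_eq_norm, exists_prop] at hx
    obtain ⟨v, hv, hxv⟩ := hx
    rw [mem_ball_zero_iff]
    have := norm_add_le (x - v) v
    rw [sub_add_cancel] at this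
    linarith [hs v hv]
  have h1 : μ.real (⋃ v ∈ s, Metric.ball v (σ / 2)) ≤ μ.real (Metric.ball (0 : E) (r + σ / 2)) :=
    measureReal_mono hsub measure_ball_lt_top.ne
  rw [measureReal_biUnion_finset hdisj fun _ _ => measurableSet_ball] at h1
  have hb : ∀ (v : E) (ρ : ℝ), 0 < ρ →
      μ.real (ball v ρ) = ρ ^ Module.finrank ℝ E * μ.real (Metric.ball (0 : E) 1) := fun v ρ hρ => by
    simp only [measureReal_def, Measure.addHaar_ball_of_pos μ v hρ, ENNReal.toReal_mul]
    rw [ENNReal.toReal_ofReal (by positivity)]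
  have hpos : 0 < μ.real (Metric.ball (0 : E) 1) :=
    ENNReal.toReal_pos (measure_ball_pos μ 0 one_pos).ne' measure_ball_lt_top.ne
  simp only [hb _ _ (half_pos hσ), hb 0 (r + σ / 2) (by positivity), Finset.sum_const,
    nsmul_eq_mul, ← mul_assoc] at h1
  have h2 := le_of_mul_le_mul_right h1 hpos
  have h3 : (1 + 2 * r / σ) = (r + σ / 2) / (σ / 2) := by field_simp; ring
  rw [h3, div_pow, le_div_iff₀ (by positivity)]
  exact h2

/-- A ball of radius `r` in a `d`-dimensional real normed space is covered by `(1 + 2r/σ)^d` balls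
of radius `σ`. -/
lemma exists_finset_cover {E : Type*} [NormedAddCommGroup E] [NormedSpace ℝ E]
    [FiniteDimensional ℝ E] {r σ : ℝ} (hr : 0 ≤ r) (hσ : 0 < σ) :
    ∃ s : Finset E, (s.card : ℝ) ≤ (1 + 2 * r / σ) ^ Module.finrank ℝ E ∧
      ∀ v, ‖v‖ ≤ r → ∃ c ∈ s, ‖v - c‖ ≤ σ := by
  classical
  -- A `σ`-separated subset of the `r`-ball of largest cardinality is a `σ`-net, since an uncovered
  -- point could be added to it. The volume bound makes a largest one exist.
  let p : ℕ → Prop := fun m => ∃ s : Finset E, s.card = m ∧ (∀ v ∈ s, ‖v‖ ≤ r) ∧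
    ∀ v ∈ s, ∀ w ∈ s, v ≠ w → σ < ‖v - w‖
  obtain ⟨B, hB⟩ := exists_nat_ge ((1 + 2 * r / σ) ^ Module.finrank ℝ E)
  have hp : ∀ m, p m → m ≤ B := by
    rintro m ⟨s, rfl, h1, h2⟩
    exact_mod_cast (card_le_of_separated hr hσ s h1 h2).trans hB
  have h0 : p 0 := ⟨∅, by simp⟩
  obtain ⟨s, hcard, h1, h2⟩ : p (Nat.findGreatest p B) := Nat.findGreatest_spec (Nat.zero_le _) h0
  refine ⟨s, card_le_of_separated hr hσ s h1 h2, fun v hv => ?_⟩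
  by_contra! hcon
  have hvs : v ∉ s := fun h => by simpa [hσ.not_gt] using hcon v h
  have hq : p (Nat.findGreatest p B + 1) := by
    refine ⟨insert v s, by rw [Finset.card_insert_of_notMem hvs, hcard], ?_, ?_⟩
    · intro w hw
      rcases Finset.mem_insert.1 hw with rfl | hw
      exacts [hv, h1 w hw]
    · intro a ha b hb hab
      rcases Finset.mem_insert.1 ha with rfl | ha <;> rcases Finset.mem_insert.1 hb with rfl | hb
      · exact absurd rfl hab
      · exact hcon b hb
      · rw [norm_sub_rev]; exact hcon a (by assumption)
      · exact h2 a ha b hb hab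
  have := Nat.le_findGreatest (hp _ hq) hq
  omega

/-- The vectors of norm at most `r` which `D` almost annihilates are covered by few balls: the
exponent is the number of singular values of `D` that are at most `t`. -/
lemma exists_spectral_cover {E H : Type*} [NormedAddCommGroup E] [InnerProductSpace ℝ E]
    [FiniteDimensional ℝ E] [NormedAddCommGroup H] [InnerProductSpace ℝ H]
    [FiniteDimensional ℝ H] (D : E →ₗ[ℝ] H) {t : ℝ} (ht : 0 < t) :
    ∃ (b : OrthonormalBasis (Fin (Module.finrank ℝ E)) ℝ E) (S : Finset (Fin (Module.finrank ℝ E))),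
      (∀ i ∈ S, ‖D (b i)‖ ≤ t) ∧ ∀ r σ : ℝ, 0 ≤ r → 0 < σ → ∃ s : Finset E,
        (s.card : ℝ) ≤ (1 + 2 * r / σ) ^ S.card ∧
        ∀ v, ‖v‖ ≤ r → ‖D v‖ ≤ t * σ → ∃ c ∈ s, ‖v - c‖ ≤ 2 * σ := by
  classical
  have hsym : (D.adjoint ∘ₗ D).IsSymmetric := fun x y => by
    simp [LinearMap.adjoint_inner_left, LinearMap.adjoint_inner_right]
  let b := hsym.eigenvectorBasis rfl
  let l := hsym.eigenvalues rfl
  have hl : ∀ i j, ⟪D (b i), D (b j)⟫_ℝ = if i = j then l i else 0 := by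
    intro i j
    rw [← LinearMap.adjoint_inner_left]
    have : D.adjoint (D (b i)) = l i • b i := hsym.apply_eigenvectorBasis rfl i
    rw [this, inner_smul_left, orthonormal_iff_ite.1 b.orthonormal i j]
    simp
  -- In the eigenbasis of `D^* D`, only coordinates with eigenvalue at most `t²` can be large on a
  -- vector that `D` nearly kills. A net is needed for these alone.
  let S : Finset (Fin (Module.finrank ℝ E)) := {i | l i ≤ t ^ 2}
  have hD : ∀ v, ‖D v‖ ^ 2 = ∑ i, l i * (b.repr v i) ^ 2 := by
    intro v
    conv_lhs => rw [← b.sum_repr v]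
    rw [← real_inner_self_eq_norm_sq]
    simp only [map_sum, map_smul, sum_inner, inner_sum, inner_smul_left, inner_smul_right, hl]
    simp
    exact Finset.sum_congr rfl fun i _ => by ring
  have hb2 : ∀ v, ‖v‖ ^ 2 = ∑ i, (b.repr v i) ^ 2 := fun v => by
    rw [← b.repr.norm_map v, EuclideanSpace.norm_sq_eq]
    simp
  refine ⟨b, S, fun i hi => ?_, fun r σ hr hσ => ?_⟩
  · have h1 : ‖D (b i)‖ ^ 2 = l i := by rw [← real_inner_self_eq_norm_sq, hl]; simp
    have h2 : l i ≤ t ^ 2 := by simpa [S] using hi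
    exact abs_le_of_sq_le_sq' (h1 ▸ h2) ht.le |>.2
  · obtain ⟨s, hs, hcov⟩ := exists_finset_cover (E := EuclideanSpace ℝ S) hr hσ
    let g : EuclideanSpace ℝ S → E := fun c => ∑ i : S, c i • b i
    refine ⟨s.image g, ?_, fun v hv hDv => ?_⟩
    · refine (Nat.cast_le.2 Finset.card_image_le).trans (hs.trans_eq ?_)
      simp
    · let w : EuclideanSpace ℝ S := WithLp.toLp 2 fun i => b.repr v i
      have hw : ‖w‖ ≤ r := by
        refine le_trans ?_ hv
        refine abs_le_of_sq_le_sq' ?_ (norm_nonneg _) |>.2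
        rw [hb2, EuclideanSpace.norm_sq_eq]
        simp only [w, Real.norm_eq_abs, sq_abs]
        rw [Finset.sum_coe_sort S fun i => (b.repr v i) ^ 2]
        exact Finset.sum_le_sum_of_subset_of_nonneg (Finset.subset_univ _)
          fun i _ _ => sq_nonneg _
      obtain ⟨c, hc, hwc⟩ := hcov w hw
      refine ⟨g c, Finset.mem_image_of_mem _ hc, ?_⟩
      have hgn : ∀ c : EuclideanSpace ℝ S, ‖g c‖ = ‖c‖ := by
        intro c
        have h1 : ‖g c‖ ^ 2 = ‖c‖ ^ 2 := by
          rw [← real_inner_self_eq_norm_sq, EuclideanSpace.norm_sq_eq]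
          simp only [g, sum_inner, inner_sum, inner_smul_left, inner_smul_right,
            orthonormal_iff_ite.1 b.orthonormal]
          simp [sq]
        exact (sq_eq_sq₀ (norm_nonneg _) (norm_nonneg _)).1 h1
      have hgs : g w - g c = g (w - c) := by
        simp [g, sub_smul, Finset.sum_sub_distrib]
      have hvw : ‖v - g w‖ ≤ σ := by
        have hgw : g w = ∑ i ∈ S, b.repr v i • b i := by
          simp only [g, w]
          exact Finset.sum_coe_sort S fun i => b.repr v i • b i
        have hrep : ∀ i, b.repr (v - g w) i = if i ∈ S then 0 else b.repr v i := by
          intro i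
          rw [hgw, map_sub, map_sum]
          simp only [map_smul, b.repr_self]
          by_cases hi : i ∈ S <;> simp [hi, Pi.single_apply]
        -- Coordinates outside `S` have eigenvalue above `t²`, so `t²` times their square sum is at
        -- most `‖D v‖²`.
        have h3 : t ^ 2 * ‖v - g w‖ ^ 2 ≤ t ^ 2 * σ ^ 2 := by
          calc t ^ 2 * ‖v - g w‖ ^ 2 ≤ ‖D v‖ ^ 2 := by
                rw [hb2, hD, Finset.mul_sum]
                refine Finset.sum_le_sum fun i _ => ?_
                rw [hrep]
                have hln : 0 ≤ l i := by
                  have := hl i i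
                  simp only [if_true] at this
                  rw [← this]
                  exact real_inner_self_nonneg
                split_ifs with hi
                · simpa using mul_nonneg hln (sq_nonneg _)
                · have : t ^ 2 < l i := by simpa [S] using hi
                  gcongr
            _ ≤ (t * σ) ^ 2 := by gcongr
            _ = _ := by ring
        have h4 := le_of_mul_le_mul_left h3 (by positivity)
        exact abs_le_of_sq_le_sq' h4 hσ.le |>.2
      calc ‖v - g c‖ = ‖(v - g w) + (g w - g c)‖ := by abel_nf
        _ ≤ ‖v - g w‖ + ‖g w - g c‖ := norm_add_le _ _
        _ ≤ σ + σ := by rw [hgs, hgn]; exact add_le_add hvw hwc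
        _ = 2 * σ := by ring

end Covering

/-! ### Powers of the contraction `1 - T^* T / C²` -/

section Contraction

variable {H H' : Type*} [NormedAddCommGroup H] [InnerProductSpace ℂ H] [CompleteSpace H]
  [NormedAddCommGroup H'] [InnerProductSpace ℂ H'] [CompleteSpace H']

/-- The operator `1 - T^* T / C²`. -/
def defectOp (T : H →L[ℂ] H') (C : ℝ) : H →L[ℂ] H :=
  1 - ((C : ℂ) ^ 2)⁻¹ • (T.adjoint ∘L T)

lemma defectOp_apply (T : H →L[ℂ] H') (C : ℝ) (x : H) :
    defectOp T C x = x - ((C : ℂ) ^ 2)⁻¹ • T.adjoint (T x) := by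
  simp [defectOp]

lemma defectOp_isSelfAdjoint (T : H →L[ℂ] H') (C : ℝ) : (defectOp T C).adjoint = defectOp T C := by
  refine ((ContinuousLinearMap.eq_adjoint_iff _ _).2 fun x y => ?_).symm
  simp [defectOp_apply, inner_sub_left, inner_sub_right, inner_smul_left, inner_smul_right,
    ContinuousLinearMap.adjoint_inner_left, ContinuousLinearMap.adjoint_inner_right]

lemma inner_smul_adjoint_self (T : H →L[ℂ] H') (C : ℝ) (x : H) :
    ⟪x, ((C : ℂ) ^ 2)⁻¹ • T.adjoint (T x)⟫_ℂ = (((C ^ 2)⁻¹ * ‖T x‖ ^ 2 : ℝ) : ℂ) := by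
  rw [inner_smul_right, ContinuousLinearMap.adjoint_inner_right, inner_self_eq_norm_sq_to_K]
  simp

lemma re_inner_defectOp (T : H →L[ℂ] H') (C : ℝ) (x : H) :
    (⟪x, defectOp T C x⟫_ℂ).re = ‖x‖ ^ 2 - (C ^ 2)⁻¹ * ‖T x‖ ^ 2 := by
  rw [defectOp_apply, inner_sub_right, inner_smul_adjoint_self, Complex.sub_re, Complex.ofReal_re]
  congr 1
  exact inner_self_eq_norm_sq (𝕜 := ℂ) x

/-- Expanding the square of the norm, the cross term contributes `-2‖Tx‖²/C²`, while the last term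
`‖T^*Tx‖²/C⁴` is at most `‖Tx‖²/C²`. -/
lemma norm_defectOp_le {T : H →L[ℂ] H'} {C : ℝ} (hC : 0 < C) (hT : ‖T‖ ≤ C) :
    ‖defectOp T C‖ ≤ 1 := by
  refine ContinuousLinearMap.opNorm_le_bound _ zero_le_one fun x => ?_
  rw [one_mul]
  refine abs_le_of_sq_le_sq' ?_ (norm_nonneg _) |>.2
  have h1 : ‖defectOp T C x‖ ^ 2
      = ‖x‖ ^ 2 - 2 * ((C ^ 2)⁻¹ * ‖T x‖ ^ 2) + ((C ^ 2)⁻¹ * ‖T.adjoint (T x)‖) ^ 2 := by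
    have h3 := norm_sub_sq (𝕜 := ℂ) x (((C : ℂ) ^ 2)⁻¹ • T.adjoint (T x))
    rw [inner_smul_adjoint_self, RCLike.re_to_complex, Complex.ofReal_re] at h3
    rw [defectOp_apply, h3]
    simp [norm_smul]
  have h4 : ‖T.adjoint (T x)‖ ≤ C * ‖T x‖ := by
    refine (T.adjoint.le_opNorm _).trans ?_
    rw [LinearIsometryEquiv.norm_map]
    gcongr
  have h5 : ((C ^ 2)⁻¹ * ‖T.adjoint (T x)‖) ^ 2 ≤ (C ^ 2)⁻¹ * ‖T x‖ ^ 2 := by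
    calc ((C ^ 2)⁻¹ * ‖T.adjoint (T x)‖) ^ 2 ≤ ((C ^ 2)⁻¹ * (C * ‖T x‖)) ^ 2 := by gcongr
      _ = _ := by field_simp
  have h6 : 0 ≤ (C ^ 2)⁻¹ * ‖T x‖ ^ 2 := by positivity
  rw [h1]
  linarith

/-- Moving one factor of the self-adjoint operator `B` across the inner product reduces `B^(l+2)` at
`x` to `B^l` at `B x`, so only the exponents 0 and 1 need an argument. -/
lemma re_inner_defectOp_pow_nonneg {T : H →L[ℂ] H'} {C : ℝ} (hC : 0 < C) (hT : ‖T‖ ≤ C) (l : ℕ) :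
    ∀ x, 0 ≤ (⟪x, (defectOp T C ^ l) x⟫_ℂ).re := by
  induction l using Nat.twoStepInduction with
  | zero =>
    intro x
    simpa using inner_self_nonneg (𝕜 := ℂ) (x := x)
  | one =>
    intro x
    rw [pow_one, re_inner_defectOp, sub_nonneg]
    have : ‖T x‖ ≤ C * ‖x‖ := (T.le_opNorm x).trans (by gcongr)
    calc (C ^ 2)⁻¹ * ‖T x‖ ^ 2 ≤ (C ^ 2)⁻¹ * (C * ‖x‖) ^ 2 := by gcongr
      _ = ‖x‖ ^ 2 := by field_simp
  | more l ih _ =>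
    intro x
    have : defectOp T C ^ (l + 2) = defectOp T C * (defectOp T C ^ l * defectOp T C) := by
      rw [← pow_succ, ← pow_succ']
    rw [this, mul_apply_eq_comp, ← ContinuousLinearMap.adjoint_inner_left,
      defectOp_isSelfAdjoint]
    exact ih _

/-- One application moves `u` by at most `t/C`. Since the operator is a contraction, `l`
applications move it by at most `l t/C`. -/
lemma le_re_inner_defectOp_pow {T : H →L[ℂ] H'} {C : ℝ} (hC : 0 < C) (hT : ‖T‖ ≤ C) {t : ℝ}
    {u : H} (hu : ‖u‖ = 1) (hTu : ‖T u‖ ≤ t) (l : ℕ) :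
    1 - l * (t / C) ≤ (⟪u, (defectOp T C ^ l) u⟫_ℂ).re := by
  have h1 : ‖defectOp T C u - u‖ ≤ t / C := by
    have : defectOp T C u - u = -(((C : ℂ) ^ 2)⁻¹ • T.adjoint (T u)) := by simp [defectOp_apply]
    rw [this, norm_neg, norm_smul]
    have h2 : ‖T.adjoint (T u)‖ ≤ C * t := by
      refine (T.adjoint.le_opNorm _).trans ?_
      rw [LinearIsometryEquiv.norm_map]
      gcongr
    simp only [norm_inv, norm_pow, Complex.norm_real, Real.norm_eq_abs, abs_of_pos hC]
    calc (C ^ 2)⁻¹ * ‖T.adjoint (T u)‖ ≤ (C ^ 2)⁻¹ * (C * t) := by gcongr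
      _ = t / C := by field_simp
  have h2 : ∀ l : ℕ, ‖(defectOp T C ^ l) u - u‖ ≤ l * (t / C) := by
    intro l
    induction l with
    | zero => simp
    | succ l ih =>
      have : (defectOp T C ^ (l + 1)) u - u
          = defectOp T C ((defectOp T C ^ l) u - u) + (defectOp T C u - u) := by
        rw [pow_succ', mul_apply_eq_comp, map_sub]; abel
      have h3 := (defectOp T C).le_of_opNorm_le (norm_defectOp_le hC hT) ((defectOp T C ^ l) u - u)
      rw [this, Nat.cast_succ]
      exact (norm_add_le _ _).trans
        ((add_le_add (h3.trans ((one_mul _).le.trans ih)) h1).trans_eq (by ring))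
  have h3 : (⟪u, (defectOp T C ^ l) u⟫_ℂ).re
      = 1 + (⟪u, (defectOp T C ^ l) u - u⟫_ℂ).re := by
    rw [inner_sub_right, inner_self_eq_norm_sq_to_K, hu]
    simp
  have h4 : |(⟪u, (defectOp T C ^ l) u - u⟫_ℂ).re| ≤ l * (t / C) := by
    refine (Complex.abs_re_le_norm _).trans ((norm_inner_le_norm _ _).trans ?_)
    rw [hu, one_mul]
    exact h2 l
  rw [h3]
  linarith [(abs_le.1 h4).1]

/-- Mean ergodic theorem for `1 - T^* T / C²`, whose fixed vectors are the kernel of `T^* T`. -/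
lemma tendsto_defectOp_average {T : H →L[ℂ] H'} {C : ℝ} (hC : 0 < C) (hT : ‖T‖ ≤ C) (x : H) :
    Tendsto (fun N : ℕ => (N : ℂ)⁻¹ • ∑ l ∈ Finset.range N, (defectOp T C ^ l) x) atTop
      (𝓝 ((T.adjoint ∘L T).ker.starProjection x)) := by
  have h := ContinuousLinearMap.tendsto_birkhoffAverage_orthogonalProjection (defectOp T C)
    (norm_defectOp_le hC hT) x
  have hker : (defectOp T C).eqLocus (1 : H →L[ℂ] H) = (T.adjoint ∘L T).ker := by
    ext y
    have : C ≠ 0 := hC.ne'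
    simp [LinearMap.mem_eqLocus, defectOp_apply, this]
  refine (h.congr fun N => ?_).trans_eq ?_
  · simp [birkhoffAverage, birkhoffSum]
  · congr 1
    rw [Submodule.starProjection_apply]
    congr!

end Contraction

/-! ### The Hilbert–Schmidt norm of tuples of matrices -/

section Matrices

open scoped Matrix Matrix.Norms.L2Operator

/-- A tuple of matrices as a vector with the (unnormalized) Hilbert–Schmidt norm. -/
def vec (ι : Type*) (k : ℕ) : (ι → Mat k) ≃ₗ[ℂ] EuclideanSpace ℂ (ι × Fin k × Fin k) where
  toFun ξ := WithLp.toLp 2 fun p => ξ p.1 p.2.1 p.2.2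
  invFun v := fun i a b => v (i, a, b)
  map_add' _ _ := rfl
  map_smul' _ _ := rfl
  left_inv _ := rfl
  right_inv _ := rfl

lemma vec_apply {ι : Type*} {k : ℕ} (ξ : ι → Mat k) (p : ι × Fin k × Fin k) :
    vec ι k ξ p = ξ p.1 p.2.1 p.2.2 := rfl

lemma inner_vec {ι : Type*} [Fintype ι] {k : ℕ} (u v : ι → Mat k) :
    ⟪vec ι k u, vec ι k v⟫_ℂ = ∑ i, (star (u i) * v i).trace := by
  simp only [PiLp.inner_apply, Fintype.sum_prod_type, Matrix.trace, Matrix.diag, Matrix.mul_apply,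
    Matrix.star_apply]
  refine Finset.sum_congr rfl fun i _ => ?_
  rw [Finset.sum_comm]
  refine Finset.sum_congr rfl fun a _ => Finset.sum_congr rfl fun b _ => ?_
  simp [vec_apply, mul_comm]

/-- The Hilbert–Schmidt norm of a matrix. -/
def frob {k : ℕ} (a : Mat k) : ℝ := ‖vec Unit k fun _ => a‖

lemma frob_nonneg {k : ℕ} (a : Mat k) : 0 ≤ frob a := norm_nonneg _

lemma frob_sq_eq_trace {k : ℕ} (a : Mat k) : frob a ^ 2 = (star a * a).trace.re := by
  rw [frob, ← inner_self_eq_norm_sq (𝕜 := ℂ), inner_vec]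
  simp

lemma frob_sq_eq_sum {k : ℕ} (a : Mat k) : frob a ^ 2 = ∑ i, ∑ j, ‖a i j‖ ^ 2 := by
  rw [frob, EuclideanSpace.norm_sq_eq]
  simp [Fintype.sum_prod_type, vec_apply]

lemma norm_vec_sq {ι : Type*} [Fintype ι] {k : ℕ} (u : ι → Mat k) :
    ‖vec ι k u‖ ^ 2 = ∑ i, frob (u i) ^ 2 := by
  rw [← inner_self_eq_norm_sq (𝕜 := ℂ), inner_vec]
  simp [frob_sq_eq_trace]

lemma frob_le_norm_vec {ι : Type*} [Fintype ι] {k : ℕ} (u : ι → Mat k) (i : ι) :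
    frob (u i) ≤ ‖vec ι k u‖ := by
  refine abs_le_of_sq_le_sq' ?_ (norm_nonneg _) |>.2
  rw [norm_vec_sq]
  exact Finset.single_le_sum (f := fun i => frob (u i) ^ 2) (fun i _ => sq_nonneg _)
    (Finset.mem_univ i)

lemma norm_vec_le_sum {ι : Type*} [Fintype ι] {k : ℕ} (u : ι → Mat k) :
    ‖vec ι k u‖ ≤ ∑ i, frob (u i) := by
  refine abs_le_of_sq_le_sq' ?_ (Finset.sum_nonneg fun _ _ => frob_nonneg _) |>.2
  rw [norm_vec_sq]
  exact Finset.sum_sq_le_sq_sum_of_nonneg fun i _ => frob_nonneg _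

lemma frob_add_le {k : ℕ} (a b : Mat k) : frob (a + b) ≤ frob a + frob b := by
  have : vec Unit k (fun _ => a + b) = vec Unit k (fun _ => a) + vec Unit k (fun _ => b) := rfl
  rw [frob, this]
  exact norm_add_le _ _

lemma frob_smul {k : ℕ} (c : ℂ) (a : Mat k) : frob (c • a) = ‖c‖ * frob a := by
  have : vec Unit k (fun _ => c • a) = c • vec Unit k (fun _ => a) := rfl
  rw [frob, this, norm_smul, frob]

lemma frob_zero {k : ℕ} : frob (0 : Mat k) = 0 := by
  simpa using frob_smul 0 (0 : Mat k)

lemma frob_sum_le {k : ℕ} {α : Type*} (s : Finset α) (f : α → Mat k) :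
    frob (∑ i ∈ s, f i) ≤ ∑ i ∈ s, frob (f i) :=
  Finset.le_sum_of_subadditive _ frob_zero.le frob_add_le _ _

lemma frob_star {k : ℕ} (a : Mat k) : frob (star a) = frob a := by
  refine (sq_eq_sq₀ (frob_nonneg _) (frob_nonneg _)).1 ?_
  rw [frob_sq_eq_sum, frob_sq_eq_sum, Finset.sum_comm]
  simp [Matrix.star_apply]

/-- Columnwise: each column of `a * b` is `a` applied to a column of `b`. -/
lemma frob_mul_le {k : ℕ} (a b : Mat k) : frob (a * b) ≤ ‖a‖ * frob b := by
  refine abs_le_of_sq_le_sq' ?_ (mul_nonneg (norm_nonneg _) (frob_nonneg _)) |>.2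
  rw [mul_pow, frob_sq_eq_sum, frob_sq_eq_sum, Finset.sum_comm,
    Finset.sum_comm (f := fun i j => ‖b i j‖ ^ 2), Finset.mul_sum]
  refine Finset.sum_le_sum fun j _ => ?_
  have h := Matrix.l2_opNorm_mulVec a (WithLp.toLp 2 fun i => b i j)
  have h2 := pow_le_pow_left₀ (norm_nonneg _) h 2
  rw [mul_pow, EuclideanSpace.norm_sq_eq, EuclideanSpace.norm_sq_eq] at h2
  simpa [Matrix.mul_apply, Matrix.mulVec, dotProduct] using h2

lemma frob_mul_le' {k : ℕ} (a b : Mat k) : frob (a * b) ≤ frob a * ‖b‖ := by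
  rw [← frob_star, star_mul, ← frob_star a, ← norm_star b, mul_comm]
  exact frob_mul_le _ _

lemma norm_trace_mul_le {k : ℕ} (a b : Mat k) : ‖(a * b).trace‖ ≤ frob a * frob b := by
  have h := norm_inner_le_norm (𝕜 := ℂ) (vec Unit k fun _ => star a) (vec Unit k fun _ => b)
  rw [inner_vec] at h
  rw [← frob_star a]
  simpa [frob] using h

/-- Dictionary between the normalized 2-norm of microstates and the unnormalized norm of `vec`; it
is the source of every factor `√k` below. -/
lemma dist2_eq {ι : Type*} [Fintype ι] {k : ℕ} (ξ η : ι → Mat k) :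
    dist2 ξ η = ‖vec ι k (ξ - η)‖ / √k := by
  rw [dist2, ← Real.sqrt_sq (norm_nonneg (vec ι k (ξ - η))), ← Real.sqrt_div (sq_nonneg _),
    norm_vec_sq, Finset.sum_div]
  congr 1
  refine Finset.sum_congr rfl fun i _ => ?_
  rw [frob_sq_eq_trace, ntr]
  simp

lemma norm_of_star_mul_self_eq_one {k : ℕ} {a : Mat k} (h : star a * a = 1) : ‖a‖ ≤ 1 := by
  have h1 := CStarRing.norm_star_mul_self (x := a)
  rw [h] at h1
  rcases Nat.eq_zero_or_pos k with rfl | hk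
  · have : a = 0 := Subsingleton.elim _ _
    simp [this]
  · have : Nonempty (Fin k) := ⟨⟨0, hk⟩⟩
    rw [norm_one] at h1
    nlinarith [norm_nonneg a]

/-! ### Spectral truncation -/

/-- Diagonalization of `a^* a`. -/
lemma exists_diagonalization {k : ℕ} (a : Mat k) :
    ∃ (U : Mat k) (l : Fin k → ℝ), star U * U = 1 ∧ U * star U = 1 ∧ (∀ i, 0 ≤ l i) ∧
      star a * a = U * Matrix.diagonal (fun i => (l i : ℂ)) * star U := by
  have hp : (star a * a).PosSemidef := Matrix.posSemidef_conjTranspose_mul_self a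
  have hU := hp.1.eigenvectorUnitary.2
  refine ⟨hp.1.eigenvectorUnitary, hp.1.eigenvalues, (Unitary.mem_iff.1 hU).1,
    (Unitary.mem_iff.1 hU).2, hp.eigenvalues_nonneg, ?_⟩
  conv_lhs => rw [hp.1.spectral_theorem]
  rfl

lemma trace_conj {k : ℕ} {U : Mat k} (hU : star U * U = 1) (b : Mat k) :
    (U * b * star U).trace = b.trace := by
  rw [Matrix.trace_mul_comm, ← mul_assoc, hU, one_mul]

lemma norm_conj_le {k : ℕ} {U : Mat k} (hU : star U * U = 1) (b : Mat k) :
    ‖U * b * star U‖ ≤ ‖b‖ := by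
  have h1 := norm_of_star_mul_self_eq_one hU
  have h2 : ‖star U‖ ≤ 1 := (norm_star U).trans_le h1
  calc ‖U * b * star U‖ ≤ ‖U‖ * ‖b‖ * ‖star U‖ :=
        (norm_mul_le _ _).trans (by gcongr; exact norm_mul_le _ _)
    _ ≤ 1 * ‖b‖ * 1 := by gcongr
    _ = ‖b‖ := by ring

/-- The spectral projection of `a^* a` for `[0, s²]`: on its range `a` is bounded by `s`, and its
complement factors through a space of dimension the number of larger eigenvalues. -/
lemma exists_spectral_truncation {k : ℕ} (a : Mat k) {s : ℝ} (hs : 0 ≤ s) :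
    ∃ (P : Mat k) (l : Fin k → ℝ) (S : Finset (Fin k)), (∀ i, 0 ≤ l i) ∧ (∀ i ∈ S, s ^ 2 < l i) ∧
      ‖a * P‖ ≤ s ∧ frob (a - a * P) ^ 2 = ∑ i ∈ S, l i ∧
      (∀ q : ℕ, ((star a * a) ^ q).trace.re = ∑ i, l i ^ q) ∧
      ∃ V : Matrix S (Fin k) ℂ, Vᴴ * V = 1 - P ∧ V * Vᴴ = 1 := by
  classical
  obtain ⟨U, l, hU, hU', hl, ha⟩ := exists_diagonalization a
  let S : Finset (Fin k) := {i | s ^ 2 < l i}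
  let d : Fin k → ℂ := fun i => if i ∈ S then 0 else 1
  let P : Mat k := U * Matrix.diagonal d * star U
  have hconj : ∀ f g : Fin k → ℂ, (U * Matrix.diagonal f * star U) * (U * Matrix.diagonal g * star U)
      = U * Matrix.diagonal (fun i => f i * g i) * star U := fun f g => by
    calc _ = U * Matrix.diagonal f * (star U * U) * Matrix.diagonal g * star U := by
          simp only [mul_assoc]
      _ = U * (Matrix.diagonal f * Matrix.diagonal g) * star U := by
          rw [hU]; simp only [mul_assoc, mul_one]
      _ = _ := by rw [Matrix.diagonal_mul_diagonal]
  have hone : (1 : Mat k) = U * Matrix.diagonal (fun _ => (1 : ℂ)) * star U := by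
    rw [Matrix.diagonal_one, mul_one, hU']
  have hsubP : 1 - P = U * Matrix.diagonal (fun i => if i ∈ S then (1 : ℂ) else 0) * star U := by
    conv_lhs => rw [hone]
    simp only [P]
    rw [← sub_mul, ← mul_sub, Matrix.diagonal_sub]
    congr 3
    ext i
    simp only [d]
    split_ifs <;> simp
  have hstar : ∀ f : Fin k → ℂ, (∀ i, star (f i) = f i) → star (U * Matrix.diagonal f * star U)
      = U * Matrix.diagonal f * star U := fun f hf => by
    rw [star_mul, star_mul, star_star, Matrix.star_eq_conjTranspose (Matrix.diagonal f),
      Matrix.diagonal_conjTranspose]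
    have : star f = f := funext hf
    rw [this, mul_assoc]
  have hPs : star P = P := hstar d fun i => by simp only [d]; split_ifs <;> simp
  have hQs : star (1 - P) = 1 - P := by rw [star_sub, star_one, hPs]
  refine ⟨P, l, S, hl, fun i hi => by simpa [S] using hi, ?_, ?_, ?_, ?_⟩
  · have h1 : star (a * P) * (a * P)
        = U * Matrix.diagonal (fun i => if i ∈ S then 0 else (l i : ℂ)) * star U := by
      calc star (a * P) * (a * P) = P * (star a * a) * P := by
            rw [star_mul, hPs]; simp only [mul_assoc]
        _ = _ := by
            rw [ha]; simp only [P]; rw [hconj, hconj]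
            congr 3
            ext i
            simp only [d]
            split_ifs <;> simp
    have h2 : ‖a * P‖ * ‖a * P‖ ≤ s ^ 2 := by
      rw [← CStarRing.norm_star_mul_self, h1]
      refine (norm_conj_le hU _).trans ?_
      rw [Matrix.l2_opNorm_diagonal]
      refine (pi_norm_le_iff_of_nonneg (sq_nonneg s)).2 fun i => ?_
      by_cases hi : i ∈ S
      · simp [hi, sq_nonneg]
      · have : l i ≤ s ^ 2 := by simpa [S] using hi
        simpa [hi, abs_of_nonneg (hl i)] using this
    exact abs_le_of_sq_le_sq' (by rw [sq]; exact h2) hs |>.2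
  · have h1 : star (a - a * P) * (a - a * P)
        = U * Matrix.diagonal (fun i => if i ∈ S then (l i : ℂ) else 0) * star U := by
      calc star (a - a * P) * (a - a * P) = star (a * (1 - P)) * (a * (1 - P)) := by
            rw [mul_sub a, mul_one]
        _ = (1 - P) * (star a * a) * (1 - P) := by
            rw [star_mul, hQs]; simp only [mul_assoc]
        _ = _ := by
            rw [ha, hsubP, hconj, hconj]
            congr 3
            ext i
            split_ifs <;> simp
    rw [frob_sq_eq_trace, h1, trace_conj hU, Matrix.trace_diagonal]
    simp
  · intro q
    have h1 : (star a * a) ^ q = U * Matrix.diagonal (fun i => (l i : ℂ) ^ q) * star U := by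
      induction q with
      | zero => simpa using hone
      | succ q ih => 
        rw [pow_succ, ih, ha, hconj]
        simp only [pow_succ]
    rw [h1, trace_conj hU, Matrix.trace_diagonal, Complex.re_sum]
    refine Finset.sum_congr rfl fun i _ => ?_
    norm_cast
  -- `V` consists of the rows of `U^*` indexed by `S`: a coisometry onto the spectral subspace of
  -- the large eigenvalues.
  · refine ⟨(star U).submatrix Subtype.val id, ?_, ?_⟩
    · rw [hsubP]
      ext i j
      simp only [Matrix.mul_apply, Matrix.conjTranspose_apply, Matrix.submatrix_apply, id,
        Matrix.star_apply, star_star, Matrix.diagonal_apply, mul_ite, mul_zero]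
      rw [Finset.sum_coe_sort S fun x => U i x * star (U j x)]
      simp
    · ext i j
      have h : ((star U).submatrix Subtype.val id * ((star U).submatrix Subtype.val id)ᴴ :
          Matrix S S ℂ) i j = (star U * U) i.1 j.1 := by
        simp only [Matrix.mul_apply, Matrix.conjTranspose_apply, Matrix.submatrix_apply, id,
          Matrix.star_apply, star_star]
      rw [h, hU, Matrix.one_apply, Matrix.one_apply]
      simp only [Subtype.ext_iff]

/-- Spectral cutoff at `R`: the error in the Hilbert–Schmidt norm is controlled by high moments. -/
lemma exists_cutoff {k : ℕ} (a : Mat k) {R : ℝ} (hR : 0 < R) (q : ℕ) :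
    ∃ b : Mat k, ‖b‖ ≤ R ∧
      frob (a - b) ^ 2 ≤ ((star a * a) ^ (q + 1)).trace.re / R ^ (2 * q) := by
  obtain ⟨P, l, S, hl, hS, hP, hf, hq, -⟩ := exists_spectral_truncation a hR.le
  refine ⟨a * P, hP, ?_⟩
  rw [hf, hq, le_div_iff₀ (by positivity), Finset.sum_mul]
  refine (Finset.sum_le_sum fun i hi => ?_).trans
    (Finset.sum_le_sum_of_subset_of_nonneg (Finset.subset_univ S)
      fun i _ _ => pow_nonneg (hl i) (q + 1))
  -- On `S` the eigenvalue exceeds `R²`, hence `l · R^(2q) ≤ l^(q+1)`.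
  rw [pow_succ', pow_mul]
  have := hl i
  gcongr
  exact (hS i hi).le

/-- Matrices that are small in the Hilbert–Schmidt norm are covered by few small balls of the
operator norm. -/
lemma exists_opNorm_cover (k : ℕ) {R s κ : ℝ} (hs : 0 < s) (hR : 0 ≤ R) (hκ : 0 ≤ κ) :
    ∃ N : Finset (Mat k), (N.card : ℝ) ≤ Real.exp (4 * κ * Real.log (3 + 2 * R / s) * k ^ 2) ∧
      ∀ a : Mat k, ‖a‖ ≤ R → frob a ^ 2 ≤ κ * k * s ^ 2 → ∃ c ∈ N, ‖a - c‖ ≤ 3 * s := by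
  classical
  -- By the bound on `frob a`, `a^* a` has at most `κ k` eigenvalues above `s²`; this is the rank
  -- left after removing a part of operator norm at most `s`.
  let m := ⌊κ * k⌋₊
  have hm : (m : ℝ) ≤ κ * k := Nat.floor_le (by positivity)
  -- The low-rank part is a product of a `k × m` and an `m × k` matrix, with norms at most `R` and
  -- 1. The real dimensions `2km` add up to the exponent `4km`. The second mesh `s/(R+s)` offsets
  -- the norm `R + s` of a centre for the first factor, and both nets have base at most `3 + 2R/s`.
  obtain ⟨N₁, hN₁, hc₁⟩ := exists_finset_cover (E := Matrix (Fin k) (Fin m) ℂ) hR hs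
  obtain ⟨N₂, hN₂, hc₂⟩ := exists_finset_cover (E := Matrix (Fin m) (Fin k) ℂ)
    zero_le_one (show 0 < s / (R + s) by positivity)
  let g : Matrix (Fin k) (Fin m) ℂ × Matrix (Fin m) (Fin k) ℂ → Mat k := fun p => p.1 * p.2
  refine ⟨(N₁ ×ˢ N₂).image g, ?_, fun a haR ha => ?_⟩
  · have h1 : Module.finrank ℝ (Matrix (Fin k) (Fin m) ℂ) = k * m * 2 := by
      rw [Module.finrank_matrix]; simp
    have h2 : Module.finrank ℝ (Matrix (Fin m) (Fin k) ℂ) = m * k * 2 := by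
      rw [Module.finrank_matrix]; simp
    have hb : 1 ≤ 3 + 2 * R / s := by
      have : 0 ≤ 2 * R / s := by positivity
      linarith
    calc (((N₁ ×ˢ N₂).image g).card : ℝ) ≤ (N₁.card : ℝ) * N₂.card := by
          rw [← Nat.cast_mul, ← Finset.card_product]
          exact_mod_cast Finset.card_image_le
      _ ≤ (3 + 2 * R / s) ^ (k * m * 2) * (3 + 2 * R / s) ^ (m * k * 2) := by
          refine mul_le_mul (hN₁.trans ?_) (hN₂.trans ?_) (by positivity) (by positivity)
          · rw [h1]
            gcongr
            norm_num
          · rw [h2]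
            refine pow_le_pow_left₀ (by positivity) (le_of_eq ?_) _
            field_simp
            try ring
      _ = Real.exp (Real.log (3 + 2 * R / s) * (4 * (m * k))) := by
          rw [← pow_add, ← Real.rpow_natCast, Real.rpow_def_of_pos (by positivity)]
          congr 2
          push_cast
          ring
      _ ≤ Real.exp (Real.log (3 + 2 * R / s) * (4 * ((κ * k) * k))) := by
          have := Real.log_nonneg hb
          gcongr
      _ = _ := by congr 1; ring
  · obtain ⟨P, l, S, hl, hS, hP, hf, hq, V, hV, hV'⟩ := exists_spectral_truncation a hs.le
    have hSm : S.card ≤ m := by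
      refine Nat.le_floor ?_
      have h1 : (S.card : ℝ) * s ^ 2 ≤ frob a ^ 2 := by
        calc (S.card : ℝ) * s ^ 2 = ∑ i ∈ S, s ^ 2 := by simp
          _ ≤ ∑ i ∈ S, l i := Finset.sum_le_sum fun i hi => (hS i hi).le
          _ ≤ ∑ i, l i := Finset.sum_le_sum_of_subset_of_nonneg (Finset.subset_univ S)
              fun i _ _ => hl i
          _ = frob a ^ 2 := by
              have := hq 1
              simp only [pow_one] at this
              rw [frob_sq_eq_trace, this]
      exact le_of_mul_le_mul_right (h1.trans ha) (by positivity)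
    obtain ⟨f⟩ : Nonempty (S ↪ Fin m) := by
      rw [Function.Embedding.nonempty_iff_card_le]
      simpa using hSm
    -- An isometric padding of `S` into `Fin m`, so that the nets do not depend on `a`.
    let J : Matrix (Fin m) S ℂ := Matrix.of fun j i => if f i = j then 1 else 0
    have hJ : Jᴴ * J = 1 := by
      ext i j
      simp [J, Matrix.mul_apply, Matrix.one_apply, apply_ite star, eq_comm]
    have hn : ∀ {x : Type} {y : Type} [Fintype x] [Fintype y] [DecidableEq x] [DecidableEq y]
        (A : Matrix x y ℂ), Aᴴ * A = 1 → ‖A‖ ≤ 1 := by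
      intro x y _ _ _ _ A hA
      have h := Matrix.l2_opNorm_conjTranspose_mul_self A
      rw [hA] at h
      have h1 : ‖(1 : Matrix y y ℂ)‖ ≤ 1 := by
        rw [← Matrix.diagonal_one, Matrix.l2_opNorm_diagonal]
        exact (pi_norm_le_iff_of_nonneg zero_le_one).2 fun i => by simp
      nlinarith [norm_nonneg A]
    have hJn := hn J hJ
    have hVn : ‖V‖ ≤ 1 := by
      rw [← Matrix.l2_opNorm_conjTranspose]
      refine hn Vᴴ ?_
      rw [Matrix.conjTranspose_conjTranspose, hV']
    have hJV : ‖J * V‖ ≤ 1 := (Matrix.l2_opNorm_mul _ _).trans (by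
      nlinarith [norm_nonneg J, norm_nonneg V])
    have hfac : (a * (J * V)ᴴ) * (J * V) = a - a * P := by
      rw [Matrix.conjTranspose_mul, Matrix.mul_assoc, Matrix.mul_assoc Vᴴ, ← Matrix.mul_assoc Jᴴ,
        hJ, Matrix.one_mul, hV, mul_sub, mul_one]
    have hW : ‖a * (J * V)ᴴ‖ ≤ R := by
      refine (Matrix.l2_opNorm_mul _ _).trans ?_
      rw [Matrix.l2_opNorm_conjTranspose]
      nlinarith [norm_nonneg a, norm_nonneg (J * V)]
    obtain ⟨c₁, hc₁m, hc₁d⟩ := hc₁ _ hW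
    obtain ⟨c₂, hc₂m, hc₂d⟩ := hc₂ _ hJV
    refine ⟨g (c₁, c₂), Finset.mem_image.2 ⟨(c₁, c₂), by simp [hc₁m, hc₂m], rfl⟩, ?_⟩
    have hc₁n : ‖c₁‖ ≤ R + s := by
      have := norm_sub_norm_le c₁ (a * (J * V)ᴴ)
      rw [norm_sub_rev] at this
      linarith
    have key : a - g (c₁, c₂) = a * P + ((a * (J * V)ᴴ - c₁) * (J * V) + c₁ * (J * V - c₂)) := by
      rw [Matrix.sub_mul, hfac, Matrix.mul_sub]
      simp only [g]
      abel
    rw [key]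
    have e1 : ‖(a * (J * V)ᴴ - c₁) * (J * V)‖ ≤ s := by
      refine (Matrix.l2_opNorm_mul _ _).trans ?_
      calc _ ≤ s * 1 := by gcongr
        _ = s := mul_one s
    have e2 : ‖c₁ * (J * V - c₂)‖ ≤ s := by
      refine (Matrix.l2_opNorm_mul _ _).trans ?_
      calc _ ≤ (R + s) * (s / (R + s)) := by gcongr
        _ = s := by field_simp
    calc _ ≤ ‖a * P‖ + (‖(a * (J * V)ᴴ - c₁) * (J * V)‖ + ‖c₁ * (J * V - c₂)‖) :=
          (norm_add_le _ _).trans (by gcongr; exact norm_add_le _ _)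
      _ ≤ s + (s + s) := by gcongr
      _ = 3 * s := by ring

end Matrices

/-! ### Evaluation of `*`-polynomials -/

section Evaluation

lemma StarPoly.induction {ι : Type*} {p : StarPoly ι → Prop} (f : StarPoly ι)
    (add : ∀ f g, p f → p g → p (f + g)) (mono : ∀ (c : ℂ) w, p (c • StarPoly.mono w)) : p f := by
  induction f using MonoidAlgebra.induction_linear with
  | zero => simpa using mono 0 []
  | add f g hf hg => exact add f g hf hg
  | single w c =>
    have := mono c (FreeMonoid.toList w)
    simpa [StarPoly.mono] using this

lemma StarPoly.eval_mono {ι A : Type*} [Ring A] [Algebra ℂ A] [Star A] (x : ι → A)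
    (w : List (Letter ι)) : StarPoly.eval x (StarPoly.mono w) = evalWord x w := by
  simp [StarPoly.eval, StarPoly.mono, evalWord, FreeMonoid.lift_apply]

lemma StarPoly.adj_add {ι : Type*} (f g : StarPoly ι) : (f + g).adj = f.adj + g.adj := by
  simp only [StarPoly.adj, MonoidAlgebra.coeff_add]
  exact Finsupp.sum_add_index' (by simp) (by simp [add_smul])

lemma StarPoly.adj_smul_mono {ι : Type*} (c : ℂ) (w : List (Letter ι)) :
    (c • StarPoly.mono w).adj = starRingEnd ℂ c • StarPoly.mono (adjWord w) := by
  rw [StarPoly.adj, StarPoly.mono, MonoidAlgebra.smul_single, MonoidAlgebra.coeff_single,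
    Finsupp.sum_single_index (by simp)]
  simp

lemma star_evalLetter {ι A : Type*} [InvolutiveStar A] (x : ι → A) (l : Letter ι) :
    star (evalLetter x l) = evalLetter x (l.1, !l.2) := by
  rcases l with ⟨i, _ | _⟩ <;> simp [evalLetter]

lemma evalWord_nil {ι A : Type*} [Monoid A] [Star A] (x : ι → A) : evalWord x [] = 1 := rfl

lemma evalWord_cons {ι A : Type*} [Monoid A] [Star A] (x : ι → A) (l : Letter ι)
    (w : List (Letter ι)) : evalWord x (l :: w) = evalLetter x l * evalWord x w := by
  simp [evalWord]

lemma evalWord_append {ι A : Type*} [Monoid A] [Star A] (x : ι → A) (u w : List (Letter ι)) :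
    evalWord x (u ++ w) = evalWord x u * evalWord x w := by
  simp [evalWord]

lemma evalWord_adjWord {ι A : Type*} [Monoid A] [StarMul A] (x : ι → A) (w : List (Letter ι)) :
    evalWord x (adjWord w) = star (evalWord x w) := by
  induction w with
  | nil => simp [adjWord, evalWord]
  | cons l w ih =>
    have : adjWord (l :: w) = adjWord w ++ [(l.1, !l.2)] := by simp [adjWord]
    rw [this, evalWord_append, ih, evalWord_cons _ l w, star_mul, star_evalLetter]
    simp [evalWord]

lemma StarPoly.eval_adj {ι A : Type*} [Ring A] [Algebra ℂ A] [StarRing A] [StarModule ℂ A]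
    (x : ι → A) (f : StarPoly ι) : StarPoly.eval x f.adj = star (StarPoly.eval x f) := by
  induction f using StarPoly.induction with
  | add f g hf hg => rw [adj_add, map_add, hf, hg, map_add, star_add]
  | mono c w =>
    rw [adj_smul_mono, map_smul, map_smul, eval_mono, eval_mono, star_smul, evalWord_adjWord]
    rfl

/-- `f ⊙ g` acts on `A` by `v ↦ f(x) v g(y)`. -/
def biAct {ι A : Type*} [Ring A] [Algebra ℂ A] [Star A] (x y : ι → A) :
    StarPoly ι ⊗[ℂ] (StarPoly ι)ᵐᵒᵖ →ₐ[ℂ] Module.End ℂ A :=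
  (AlgHom.mulLeftRight ℂ A).comp
    (Algebra.TensorProduct.map (StarPoly.eval x) (AlgHom.op (StarPoly.eval y)))

lemma biAct_tmul {ι A : Type*} [Ring A] [Algebra ℂ A] [Star A] (x y : ι → A) (f : StarPoly ι)
    (g : (StarPoly ι)ᵐᵒᵖ) (v : A) :
    biAct x y (f ⊗ₜ g) v = StarPoly.eval x f * v * StarPoly.eval y g.unop := by
  simp [biAct]

lemma freeDeriv_add {ι : Type*} (c : Letter ι → ℂ) (f g : StarPoly ι) :
    freeDeriv c (f + g) = freeDeriv c f + freeDeriv c g := by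
  simp only [freeDeriv, MonoidAlgebra.coeff_add]
  exact Finsupp.sum_add_index' (by simp) (by simp [add_smul])

lemma freeDeriv_smul_mono {ι : Type*} (c : Letter ι → ℂ) (a : ℂ) (w : List (Letter ι)) :
    freeDeriv c (a • StarPoly.mono w) = a • wordDeriv c w := by
  rw [freeDeriv, StarPoly.mono, MonoidAlgebra.smul_single, MonoidAlgebra.coeff_single,
    Finsupp.sum_single_index (by simp)]
  simp

/-- The noncommutative difference quotient: free derivations compute `f(x) - f(y)` exactly. -/
lemma eval_sub_eval_eq_sum {ι A S : Type*} [Ring A] [Algebra ℂ A] [Star A] [Fintype S] (x y : ι → A)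
    (c : S → Letter ι → ℂ) (v : S → A)
    (h : ∀ l, evalLetter x l - evalLetter y l = ∑ s, c s l • v s) (f : StarPoly ι) :
    StarPoly.eval x f - StarPoly.eval y f = ∑ s, biAct x y (freeDeriv (c s) f) (v s) := by
  induction f using StarPoly.induction with
  | add f g hf hg =>
    simp only [freeDeriv_add, map_add, LinearMap.add_apply, Finset.sum_add_distrib, ← hf, ← hg]
    abel
  | mono a w =>
    simp only [freeDeriv_smul_mono, map_smul, LinearMap.smul_apply, ← Finset.smul_sum, ← smul_sub]
    congr 1
    rw [StarPoly.eval_mono, StarPoly.eval_mono]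
    induction w with
    | nil => simp [wordDeriv, evalWord]
    | cons l w ih =>
      -- The Leibniz rule matches the telescoping `ab - a'b' = (a - a')b' + a(b - b')`: letters to
      -- the left of the differentiated one are taken at `x`, those to its right at `y`.
      have h1 : ∀ s, biAct x y (wordDeriv (c s) (l :: w)) (v s)
          = (c s l • v s) * evalWord y w
            + evalLetter x l * biAct x y (wordDeriv (c s) w) (v s) := by
        intro s
        rw [wordDeriv, map_add, map_mul, map_smul, LinearMap.add_apply, LinearMap.smul_apply,
          Module.End.mul_apply, biAct_tmul, biAct_tmul]
        simp [StarPoly.eval_mono, evalWord]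
      simp only [h1, Finset.sum_add_distrib, ← Finset.sum_mul, ← Finset.mul_sum, ← h, ← ih,
        evalWord_cons]
      noncomm_ring

end Evaluation

/-! ### The symbolic S-derivative -/

section SymbolicDerivative

/-- The action of a matrix over `𝔄 ⊙ 𝔄^op` on tuples. -/
def matAct {ι A κ κ' : Type*} [Ring A] [Algebra ℂ A] [Star A] [Fintype κ'] (x y : ι → A)
    (D : Matrix κ κ' (StarPoly ι ⊗[ℂ] (StarPoly ι)ᵐᵒᵖ)) : (κ' → A) →ₗ[ℂ] (κ → A) :=
  LinearMap.pi fun a => ∑ b, biAct x y (D a b) ∘ₗ LinearMap.proj b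

lemma matAct_apply {ι A κ κ' : Type*} [Ring A] [Algebra ℂ A] [Star A] [Fintype κ'] (x y : ι → A)
    (D : Matrix κ κ' (StarPoly ι ⊗[ℂ] (StarPoly ι)ᵐᵒᵖ)) (v : κ' → A) (a : κ) :
    matAct x y D v a = ∑ b, biAct x y (D a b) (v b) := by
  simp [matAct]

lemma matAct_mul {ι A κ κ' κ'' : Type*} [Ring A] [Algebra ℂ A] [Star A] [Fintype κ'] [Fintype κ'']
    (x y : ι → A) (D : Matrix κ κ' (StarPoly ι ⊗[ℂ] (StarPoly ι)ᵐᵒᵖ))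
    (D' : Matrix κ' κ'' (StarPoly ι ⊗[ℂ] (StarPoly ι)ᵐᵒᵖ)) :
    matAct x y (D * D') = matAct x y D ∘ₗ matAct x y D' := by
  refine LinearMap.ext fun v => funext fun a => ?_
  simp only [matAct_apply, LinearMap.comp_apply, Matrix.mul_apply, map_sum, map_mul,
    LinearMap.sum_apply, Module.End.mul_apply]
  exact Finset.sum_comm

lemma matAct_one {ι A κ : Type*} [Ring A] [Algebra ℂ A] [Star A] [Fintype κ] [DecidableEq κ]
    (x y : ι → A) :
    matAct x y (1 : Matrix κ κ (StarPoly ι ⊗[ℂ] (StarPoly ι)ᵐᵒᵖ)) = LinearMap.id := by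
  refine LinearMap.ext fun v => funext fun a => ?_
  rw [matAct_apply, Finset.sum_eq_single a]
  · simp
  · intro b _ hb
    simp [Matrix.one_apply_ne' hb]
  · simp

lemma matAct_sub {ι A κ κ' : Type*} [Ring A] [Algebra ℂ A] [Star A] [Fintype κ']
    (x y : ι → A) (D D' : Matrix κ κ' (StarPoly ι ⊗[ℂ] (StarPoly ι)ᵐᵒᵖ)) :
    matAct x y (D - D') = matAct x y D - matAct x y D' := by
  refine LinearMap.ext fun v => funext fun a => ?_
  simp [matAct_apply]

lemma matAct_smul {ι A κ κ' : Type*} [Ring A] [Algebra ℂ A] [Star A] [Fintype κ']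
    (x y : ι → A) (c : ℂ) (D : Matrix κ κ' (StarPoly ι ⊗[ℂ] (StarPoly ι)ᵐᵒᵖ)) :
    matAct x y (c • D) = c • matAct x y D := by
  refine LinearMap.ext fun v => funext fun a => ?_
  simp [matAct_apply, Finset.smul_sum]

/-- The S-derivative before evaluation. -/
def symDeriv {κ ι : Type*} [DecidableEq ι] (F : κ → StarPoly ι) :
    Matrix (κ × Fin 2) (ι × Fin 2) (StarPoly ι ⊗[ℂ] (StarPoly ι)ᵐᵒᵖ) :=
  Matrix.of fun a b => derivMatrix b.1 (F a.1) a.2 b.2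

/-- The self-adjoint and skew-adjoint parts of a tuple. -/
def saSk {ι A : Type*} [Ring A] [Algebra ℂ A] [Star A] (v : ι → A) : ι × Fin 2 → A :=
  fun b => if b.2 = 0 then (1 / 2 : ℂ) • (v b.1 + star (v b.1))
    else (1 / 2 : ℂ) • (v b.1 - star (v b.1))

/-- The S-derivative maps the difference of two tuples to the difference of the values of `F`. -/
lemma matAct_symDeriv {κ ι A : Type*} [Fintype ι] [DecidableEq ι] [Ring A] [Algebra ℂ A]
    [StarRing A] [StarModule ℂ A] (F : κ → StarPoly ι) (x y : ι → A) :
    matAct x y (symDeriv F) (saSk (x - y))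
      = saSk fun i => StarPoly.eval x (F i) - StarPoly.eval y (F i) := by
  have key : ∀ f : StarPoly ι, StarPoly.eval x f - StarPoly.eval y f
      = ∑ j, (biAct x y (derivSa j f) (saSk (x - y) (j, 0))
          + biAct x y (derivSk j f) (saSk (x - y) (j, 1))) := by
    intro f
    -- With `u` and `v` the self-adjoint and skew-adjoint parts of `x_j - y_j`, the letters `X_j`
    -- and `X_j^*` change by `u + v` and `u - v`. These signs are the coefficients of `∂_sa` and
    -- `∂_sk`.
    have := eval_sub_eval_eq_sum x y
      (fun (s : ι × Fin 2) l => if s.2 = 0 then (if l.1 = s.1 then (1 : ℂ) else 0)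
        else (if l.1 = s.1 then (if l.2 then -1 else 1) else 0)) (saSk (x - y)) ?_ f
    · rw [this, Fintype.sum_prod_type]
      simp [Fin.sum_univ_two, derivSa, derivSk]
    · rintro ⟨i, b⟩
      rw [Fintype.sum_prod_type, Finset.sum_eq_single i]
      · cases b
        all_goals
          simp only [Fin.sum_univ_two, saSk, evalLetter, Pi.sub_apply, star_sub]
          simp only [Fin.isValue, if_true, one_ne_zero, if_false, Bool.false_eq_true]
          module
      · intro j _ hj
        simp [hj.symm]
      · simp
  funext ⟨i, s⟩
  rw [matAct_apply, Fintype.sum_prod_type]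
  have h1 := key ((1 / 2 : ℂ) • (F i + (F i).adj))
  have h2 := key ((1 / 2 : ℂ) • (F i - (F i).adj))
  rw [map_smul, map_smul, ← smul_sub, map_add, map_add, StarPoly.eval_adj, StarPoly.eval_adj] at h1
  rw [map_smul, map_smul, ← smul_sub, map_sub, map_sub, StarPoly.eval_adj, StarPoly.eval_adj] at h2
  fin_cases s
  · simp only [Fin.sum_univ_two]
    refine h1.symm.trans ?_
    simp only [saSk, star_sub, Fin.isValue, Fin.zero_eta, if_true]
    module
  · simp only [Fin.sum_univ_two]
    refine h2.symm.trans ?_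
    simp only [saSk, star_sub, Fin.isValue, Fin.mk_one, one_ne_zero, if_false]
    module

open scoped Matrix in
/-- On tuples of matrices, the decomposition into self-adjoint and skew-adjoint parts preserves
the real inner product and takes real complex-valued inner products. -/
lemma inner_vec_saSk {ι : Type*} [Fintype ι] {k : ℕ} (u v : ι → Mat k) :
    ⟪vec (ι × Fin 2) k (saSk u), vec (ι × Fin 2) k (saSk v)⟫_ℂ
      = ((⟪vec ι k u, vec ι k v⟫_ℂ).re : ℂ) := by
  rw [inner_vec, inner_vec, Fintype.sum_prod_type, Complex.re_sum, Complex.ofReal_sum]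
  refine Finset.sum_congr rfl fun i _ => ?_
  have h1 : (v i * star (u i)).trace = (star (u i) * v i).trace := Matrix.trace_mul_comm _ _
  have h2 : (star (v i) * u i).trace = star (star (u i) * v i).trace := by
    rw [← Matrix.trace_conjTranspose, ← Matrix.star_eq_conjTranspose, star_mul, star_star]
  have h3 : (u i * star (v i)).trace = (star (v i) * u i).trace := Matrix.trace_mul_comm _ _
  have h4 : (((star (u i) * v i).trace.re : ℝ) : ℂ)
      = ((star (u i) * v i).trace + star (star (u i) * v i).trace) / 2 := by
    rw [Complex.star_def, Complex.re_eq_add_conj]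
  rw [Fin.sum_univ_two, h4, ← h2, ← h3]
  simp only [saSk, Fin.isValue, if_true, one_ne_zero, if_false, star_smul, star_add, star_sub,
    star_star, smul_mul_smul_comm, Matrix.trace_smul, add_mul, mul_add, sub_mul, mul_sub,
    Matrix.trace_add, Matrix.trace_sub, smul_eq_mul]
  simp only [Complex.star_def, map_div₀, map_one, map_ofNat]
  ring_nf

end SymbolicDerivative

/-! ### Operator norm bounds for the bimodule action -/

section Bounds

open scoped Matrix Matrix.Norms.L2Operator

lemma norm_one_mat_le (k : ℕ) : ‖(1 : Mat k)‖ ≤ 1 :=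
  norm_of_star_mul_self_eq_one (by simp)

lemma norm_evalLetter_le {ι : Type*} {k : ℕ} {x : ι → Mat k} {R : ℝ} (hx : ∀ i, ‖x i‖ ≤ R)
    (l : Letter ι) : ‖evalLetter x l‖ ≤ R := by
  rcases l with ⟨i, _ | _⟩ <;> simp [evalLetter, hx]

lemma norm_evalLetter_sub_le {ι : Type*} {k : ℕ} {x y : ι → Mat k} {δ : ℝ}
    (hx : ∀ i, ‖x i - y i‖ ≤ δ) (l : Letter ι) : ‖evalLetter x l - evalLetter y l‖ ≤ δ := by
  rcases l with ⟨i, _ | _⟩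
  · simpa [evalLetter] using hx i
  · simpa [evalLetter, ← star_sub] using hx i

lemma norm_evalWord_le {ι : Type*} {k : ℕ} {x : ι → Mat k} {R : ℝ} (hR : 0 ≤ R)
    (hx : ∀ i, ‖x i‖ ≤ R) (w : List (Letter ι)) : ‖evalWord x w‖ ≤ R ^ w.length := by
  induction w with
  | nil => simpa [evalWord] using norm_one_mat_le k
  | cons l w ih =>
    rw [evalWord_cons, List.length_cons, pow_succ']
    exact (norm_mul_le _ _).trans (mul_le_mul (norm_evalLetter_le hx l) ih (norm_nonneg _) hR)

lemma norm_evalWord_sub_le {ι : Type*} {k : ℕ} {x y : ι → Mat k} {R δ : ℝ} (hR : 1 ≤ R)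
    (hx : ∀ i, ‖x i‖ ≤ R) (hy : ∀ i, ‖y i‖ ≤ R) (hδ : 0 ≤ δ) (hxy : ∀ i, ‖x i - y i‖ ≤ δ)
    (w : List (Letter ι)) :
    ‖evalWord x w - evalWord y w‖ ≤ w.length * R ^ w.length * δ := by
  have hR0 : 0 ≤ R := by linarith
  induction w with
  | nil => simp [evalWord]
  | cons l w ih =>
    have : evalWord x (l :: w) - evalWord y (l :: w)
        = (evalLetter x l - evalLetter y l) * evalWord x w
          + evalLetter y l * (evalWord x w - evalWord y w) := by
      rw [evalWord_cons, evalWord_cons]; noncomm_ring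
    rw [this]
    have h1 : ‖(evalLetter x l - evalLetter y l) * evalWord x w‖ ≤ δ * R ^ w.length :=
      (norm_mul_le _ _).trans (mul_le_mul (norm_evalLetter_sub_le hxy l)
        (norm_evalWord_le hR0 hx w) (norm_nonneg _) hδ)
    have h2 : ‖evalLetter y l * (evalWord x w - evalWord y w)‖
        ≤ R * (w.length * R ^ w.length * δ) :=
      (norm_mul_le _ _).trans (mul_le_mul (norm_evalLetter_le hy l) ih (norm_nonneg _) hR0)
    have h3 : R ^ w.length ≤ R ^ (w.length + 1) := pow_le_pow_right₀ hR (Nat.le_succ _)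
    calc _ ≤ δ * R ^ w.length + R * (w.length * R ^ w.length * δ) :=
          (norm_add_le _ _).trans (add_le_add h1 h2)
      _ ≤ δ * R ^ (w.length + 1) + R * (w.length * R ^ w.length * δ) := by gcongr
      _ = _ := by rw [List.length_cons]; push_cast; ring

/-- Two tuples of matrices bounded by `R` in operator norm, at operator norm distance `δ`. -/
def BoundedPair {ι : Type*} {k : ℕ} (R δ : ℝ) (x y : ι → Mat k) : Prop :=
  0 ≤ δ ∧ (∀ i, ‖x i‖ ≤ R) ∧ (∀ i, ‖y i‖ ≤ R) ∧ ∀ i, ‖x i - y i‖ ≤ δ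

/-- The point is uniformity: the constant depends on `f` and `R` but not on the matrix size `k`. -/
lemma exists_eval_bound {ι : Type*} (f : StarPoly ι) {R : ℝ} (hR : 1 ≤ R) :
    ∃ C : ℝ, 0 ≤ C ∧ ∀ (k : ℕ) (δ : ℝ) (x y : ι → Mat k), BoundedPair R δ x y →
      ‖StarPoly.eval x f‖ ≤ C ∧ ‖StarPoly.eval y f‖ ≤ C ∧
      ‖StarPoly.eval x f - StarPoly.eval y f‖ ≤ C * δ := by
  induction f using StarPoly.induction with
  | add f g hf hg =>
    obtain ⟨C₁, h₁, hC₁⟩ := hf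
    obtain ⟨C₂, h₂, hC₂⟩ := hg
    refine ⟨C₁ + C₂, by positivity, fun k δ x y h => ?_⟩
    obtain ⟨a₁, b₁, c₁⟩ := hC₁ k δ x y h
    obtain ⟨a₂, b₂, c₂⟩ := hC₂ k δ x y h
    refine ⟨?_, ?_, ?_⟩
    · rw [map_add]; exact (norm_add_le _ _).trans (add_le_add a₁ a₂)
    · rw [map_add]; exact (norm_add_le _ _).trans (add_le_add b₁ b₂)
    · rw [map_add, map_add, add_sub_add_comm, add_mul]
      exact (norm_add_le _ _).trans (add_le_add c₁ c₂)
  | mono c w =>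
    have hR0 : 0 ≤ R := by linarith
    -- The summand `R ^ w.length` bounds the word itself and `w.length * R ^ w.length` is its
    -- Lipschitz constant.
    refine ⟨‖c‖ * ((w.length + 1) * R ^ w.length), by positivity, fun k δ x y ⟨hδ, hx, hy, h⟩ => ?_⟩
    have h1 : R ^ w.length ≤ (w.length + 1) * R ^ w.length :=
      le_mul_of_one_le_left (by positivity) (by simp)
    rw [map_smul, map_smul, StarPoly.eval_mono, StarPoly.eval_mono, ← smul_sub]
    refine ⟨?_, ?_, ?_⟩
    · rw [norm_smul]
      gcongr
      exact (norm_evalWord_le hR0 hx w).trans h1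
    · rw [norm_smul]
      gcongr
      exact (norm_evalWord_le hR0 hy w).trans h1
    · rw [norm_smul, mul_assoc]
      gcongr
      refine (norm_evalWord_sub_le hR hx hy hδ h w).trans ?_
      gcongr
      simp

/-- Only the left leg differs between `biAct x y` and `biAct y y`, so its operator norm Lipschitz
bound suffices. The perturbation has to be small in operator norm, because `v` is measured in the
Hilbert–Schmidt norm. -/
lemma exists_biAct_bound {ι : Type*} (d : StarPoly ι ⊗[ℂ] (StarPoly ι)ᵐᵒᵖ) {R : ℝ} (hR : 1 ≤ R) :
    ∃ C : ℝ, 0 ≤ C ∧ ∀ (k : ℕ) (δ : ℝ) (x y : ι → Mat k), BoundedPair R δ x y → ∀ v : Mat k,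
      frob (biAct x y d v) ≤ C * frob v ∧
      frob (biAct x y d v - biAct y y d v) ≤ C * δ * frob v := by
  induction d using TensorProduct.induction_on with
  | zero =>
    refine ⟨0, le_rfl, fun k δ x y _ v => ?_⟩
    simp [frob_zero]
  | add d e hd he =>
    obtain ⟨C₁, h₁, hC₁⟩ := hd
    obtain ⟨C₂, h₂, hC₂⟩ := he
    refine ⟨C₁ + C₂, by positivity, fun k δ x y h v => ?_⟩
    obtain ⟨a₁, c₁⟩ := hC₁ k δ x y h v
    obtain ⟨a₂, c₂⟩ := hC₂ k δ x y h v
    refine ⟨?_, ?_⟩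
    · rw [map_add, LinearMap.add_apply, add_mul]
      exact (frob_add_le _ _).trans (add_le_add a₁ a₂)
    · rw [map_add, map_add, LinearMap.add_apply, LinearMap.add_apply, add_sub_add_comm, add_mul,
        add_mul]
      exact (frob_add_le _ _).trans (add_le_add c₁ c₂)
  | tmul f g =>
    obtain ⟨C₁, h₁, hC₁⟩ := exists_eval_bound f hR
    obtain ⟨C₂, h₂, hC₂⟩ := exists_eval_bound g.unop hR
    refine ⟨C₁ * C₂, by positivity, fun k δ x y h v => ?_⟩
    obtain ⟨a₁, -, c₁⟩ := hC₁ k δ x y h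
    obtain ⟨-, b₂, -⟩ := hC₂ k δ x y h
    have hδ := h.1
    have hmul : ∀ a b : Mat k, frob (a * v * b) ≤ ‖a‖ * frob v * ‖b‖ := fun a b =>
      (frob_mul_le' _ _).trans (mul_le_mul_of_nonneg_right (frob_mul_le _ _) (norm_nonneg _))
    have hv := frob_nonneg v
    rw [biAct_tmul, biAct_tmul, ← sub_mul, ← sub_mul]
    refine ⟨(hmul _ _).trans ?_, (hmul _ _).trans ?_⟩
    · calc _ ≤ C₁ * frob v * C₂ := by gcongr
        _ = _ := by ring
    · calc _ ≤ C₁ * δ * frob v * C₂ := by gcongr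
        _ = _ := by ring

lemma exists_matAct_bound {ι κ κ' : Type*} [Fintype κ] [Fintype κ']
    (D : Matrix κ κ' (StarPoly ι ⊗[ℂ] (StarPoly ι)ᵐᵒᵖ)) {R : ℝ} (hR : 1 ≤ R) :
    ∃ C : ℝ, 0 ≤ C ∧ ∀ (k : ℕ) (δ : ℝ) (x y : ι → Mat k), BoundedPair R δ x y → ∀ v : κ' → Mat k,
      ‖vec κ k (matAct x y D v)‖ ≤ C * ‖vec κ' k v‖ ∧
      ‖vec κ k (matAct x y D v - matAct y y D v)‖ ≤ C * δ * ‖vec κ' k v‖ := by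
  choose C hC0 hC using fun (a : κ) (b : κ') => exists_biAct_bound (D a b) hR
  refine ⟨∑ a, ∑ b, C a b, Finset.sum_nonneg fun a _ => Finset.sum_nonneg fun b _ => hC0 a b,
    fun k δ x y h v => ⟨?_, ?_⟩⟩
  · refine (norm_vec_le_sum _).trans ?_
    rw [Finset.sum_mul]
    refine Finset.sum_le_sum fun a _ => ?_
    rw [matAct_apply, Finset.sum_mul]
    refine (frob_sum_le _ _).trans (Finset.sum_le_sum fun b _ => ?_)
    exact (hC a b k δ x y h (v b)).1.trans
      (mul_le_mul_of_nonneg_left (frob_le_norm_vec v b) (hC0 a b))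
  · refine (norm_vec_le_sum _).trans ?_
    rw [Finset.sum_mul, Finset.sum_mul]
    refine Finset.sum_le_sum fun a _ => ?_
    rw [Pi.sub_apply, matAct_apply, matAct_apply, ← Finset.sum_sub_distrib, Finset.sum_mul,
      Finset.sum_mul]
    refine (frob_sum_le _ _).trans (Finset.sum_le_sum fun b _ => ?_)
    exact (hC a b k δ x y h (v b)).2.trans
      (mul_le_mul_of_nonneg_left (frob_le_norm_vec v b) (mul_nonneg (hC0 a b) h.1))

end Bounds

/-! ### The filter of microstates -/

section MicroFilter

/-- The filter on tuples of matrices (of all sizes `k ≥ 1`) generated by the sets of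
microstates. -/
def microFilter {M ι : Type*} [Monoid M] [Star M] (φ : M → ℂ) (x : ι → M) :
    Filter ((k : ℕ) × (ι → Mat k)) :=
  ⨅ (p : ℕ × ℝ) (_ : 0 < p.2), 𝓟 {s | 0 < s.1 ∧ s.2 ∈ microstates φ x p.1 s.1 p.2}

lemma microstates_anti {M ι : Type*} [Monoid M] [Star M] (φ : M → ℂ) (x : ι → M)
    {m m' k : ℕ} {γ γ' : ℝ} (hm : m ≤ m') (hγ : γ' ≤ γ) :
    microstates φ x m' k γ' ⊆ microstates φ x m k γ :=
  fun _ hξ w h1 h2 => (hξ w h1 (h2.trans hm)).trans_le hγ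

lemma microFilter_hasBasis {M ι : Type*} [Monoid M] [Star M] (φ : M → ℂ) (x : ι → M) :
    (microFilter φ x).HasBasis (fun p : ℕ × ℝ => 0 < p.2)
      fun p => {s | 0 < s.1 ∧ s.2 ∈ microstates φ x p.1 s.1 p.2} := by
  refine hasBasis_biInf_principal' (fun p hp q hq => ?_) ⟨(0, 1), one_pos⟩
  exact ⟨(max p.1 q.1, min p.2 q.2), lt_min hp hq,
    fun s hs => ⟨hs.1, microstates_anti φ x (le_max_left _ _) (min_le_left _ _) hs.2⟩,
    fun s hs => ⟨hs.1, microstates_anti φ x (le_max_right _ _) (min_le_right _ _) hs.2⟩⟩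

lemma eventually_microFilter {M ι : Type*} [Monoid M] [Star M] {φ : M → ℂ} {x : ι → M}
    {p : ((k : ℕ) × (ι → Mat k)) → Prop} :
    (∀ᶠ s in microFilter φ x, p s) ↔ ∃ (m : ℕ) (γ : ℝ), 0 < γ ∧
      ∀ (k : ℕ) (ξ : ι → Mat k), 0 < k → ξ ∈ microstates φ x m k γ → p ⟨k, ξ⟩ := by
  rw [(microFilter_hasBasis φ x).eventually_iff]
  constructor
  · rintro ⟨⟨m, γ⟩, hγ, h⟩
    exact ⟨m, γ, hγ, fun k ξ hk hξ => h ⟨hk, hξ⟩⟩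
  · rintro ⟨m, γ, hγ, h⟩
    exact ⟨(m, γ), hγ, fun s hs => h s.1 s.2 hs.1 hs.2⟩

lemma eventually_pos_microFilter {M ι : Type*} [Monoid M] [Star M] (φ : M → ℂ) (x : ι → M) :
    ∀ᶠ s in microFilter φ x, 0 < s.1 :=
  eventually_microFilter.2 ⟨0, 1, one_pos, fun _ _ hk _ => hk⟩

lemma ntr_one {k : ℕ} (hk : 0 < k) : ntr (1 : Mat k) = 1 := by
  have : (k : ℂ) ≠ 0 := by exact_mod_cast hk.ne'
  simp [ntr, this]

lemma ntr_add {k : ℕ} (a b : Mat k) : ntr (a + b) = ntr a + ntr b := by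
  simp [ntr, add_div]

lemma ntr_smul {k : ℕ} (c : ℂ) (a : Mat k) : ntr (c • a) = c * ntr a := by
  simp [ntr, mul_div_assoc]

lemma tendsto_ntr_evalWord {M ι : Type*} [Monoid M] [Star M] {φ : M → ℂ} (h1 : φ 1 = 1)
    (x : ι → M) (w : List (Letter ι)) :
    Tendsto (fun s => ntr (evalWord s.2 w)) (microFilter φ x) (𝓝 (φ (evalWord x w))) := by
  rcases w with _ | ⟨l, w⟩
  -- Microstates impose nothing on the empty word; its trace is right because `φ 1 = 1` and `k > 0`.
  · rw [evalWord_nil, h1]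
    refine tendsto_const_nhds.congr' ?_
    filter_upwards [eventually_pos_microFilter φ x] with s hs
    rw [evalWord_nil, ntr_one hs]
  · refine Metric.tendsto_nhds.2 fun β hβ => eventually_microFilter.2
      ⟨(l :: w).length, β, hβ, fun k ξ hk hξ => ?_⟩
    rw [dist_comm, dist_eq_norm]
    exact hξ _ (by simp) le_rfl

lemma tendsto_ntr_eval {M ι : Type*} [Ring M] [Algebra ℂ M] [Star M] {φ : M →ₗ[ℂ] ℂ}
    (h1 : φ 1 = 1) (x : ι → M) (f : StarPoly ι) :
    Tendsto (fun s => ntr (StarPoly.eval s.2 f)) (microFilter φ x)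
      (𝓝 (φ (StarPoly.eval x f))) := by
  induction f using StarPoly.induction with
  | add f g hf hg =>
    simp only [map_add, ntr_add]
    exact hf.add hg
  | mono c w =>
    simp only [map_smul, ntr_smul, smul_eq_mul, StarPoly.eval_mono]
    exact (tendsto_ntr_evalWord h1 x w).const_mul c

end MicroFilter

/-! ### The representation on `L²(M) ⊗ L²(M^op)` -/

section Representation

variable {M : Type*} [CStarAlgebra M] [PartialOrder M] [StarOrderedRing M] (φ : TracialState M)

lemma completion_mapL_comp {E : Type*} [NormedAddCommGroup E] [InnerProductSpace ℂ E]
    (A B C D : E →L[ℂ] E) :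
    (TensorProduct.mapL (A ∘L C) (B ∘L D)).completion
      = (TensorProduct.mapL A B).completion ∘L (TensorProduct.mapL C D).completion := by
  rw [TensorProduct.mapL_comp]
  ext z
  induction z using Completion.induction_on with
  | hp => apply isClosed_eq <;> fun_prop
  | ih a => simp only [ContinuousLinearMap.comp_apply, ContinuousLinearMap.completion_apply_coe]

lemma tensorRep_tmul (a : M) (b : Mᵐᵒᵖ) :
    tensorRep φ (a ⊗ₜ b) = (TensorProduct.mapL (leftRep φ a) (rightRep φ b)).completion := rfl

lemma rightRep_mul (b c : Mᵐᵒᵖ) : rightRep φ (b * c) = rightRep φ b * rightRep φ c :=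
  coe_L2_ext φ fun x => by
    rw [mul_apply_eq_comp, rightRep_coe, rightRep_coe, rightRep_coe]
    simp [mul_assoc]

lemma rightRep_one : rightRep φ 1 = 1 :=
  coe_L2_ext φ fun x => by
    rw [rightRep_coe]
    simp

lemma leftRep_coe (a : M) (x : φ.toFun.PreGNS) :
    leftRep φ a (x : L2 φ)
      = ((φ.toFun.toPreGNS (a * φ.toFun.ofPreGNS x) : φ.toFun.PreGNS) : L2 φ) := by
  simp [leftRep]

lemma adjoint_leftRep (a : M) : (leftRep φ a).adjoint = leftRep φ (star a) := by
  rw [leftRep, leftRep, map_star, ContinuousLinearMap.star_eq_adjoint]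

lemma adjoint_rightRep (b : Mᵐᵒᵖ) : (rightRep φ b).adjoint = rightRep φ (star b) := by
  refine ((ContinuousLinearMap.eq_adjoint_iff _ _).2 fun x y => ?_).symm
  induction x, y using Completion.induction_on₂ with
  | hp => apply isClosed_eq <;> fun_prop
  | ih x y =>
    rw [rightRep_coe, rightRep_coe, Completion.inner_coe, Completion.inner_coe,
      PositiveLinearMap.preGNS_inner_def, PositiveLinearMap.preGNS_inner_def]
    simp only [PositiveLinearMap.ofPreGNS_toPreGNS, star_mul, MulOpposite.unop_star, star_star]
    rw [mul_assoc, φ.tracial, mul_assoc]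

lemma tensorRep_mul (s t : M ⊗[ℂ] Mᵐᵒᵖ) : tensorRep φ (s * t) = tensorRep φ s * tensorRep φ t := by
  induction s using TensorProduct.induction_on with
  | zero => simp
  | add s s' hs hs' => rw [add_mul, map_add, map_add, add_mul, hs, hs']
  | tmul a b =>
    induction t using TensorProduct.induction_on with
    | zero => simp
    | add t t' ht ht' => rw [mul_add, map_add, map_add, mul_add, ht, ht']
    | tmul c d =>
      rw [Algebra.TensorProduct.tmul_mul_tmul, tensorRep_tmul, tensorRep_tmul, tensorRep_tmul]
      have h : leftRep φ (a * c) = leftRep φ a ∘L leftRep φ c :=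
        map_mul φ.toFun.gnsStarAlgHom a c
      rw [h, rightRep_mul]
      exact completion_mapL_comp _ _ _ _

lemma tensorRep_one : tensorRep φ 1 = 1 := by
  rw [Algebra.TensorProduct.one_def, tensorRep_tmul]
  refine completion_mapL_ext φ fun z => ?_
  have h : leftRep φ 1 = 1 := by simp [leftRep]
  rw [rightRep_one, h]
  simp [ContinuousLinearMap.one_def]

lemma adjoint_tensorRep_tmul (a : M) (b : Mᵐᵒᵖ) :
    (tensorRep φ (a ⊗ₜ b)).adjoint = tensorRep φ (star a ⊗ₜ star b) := by
  refine ((ContinuousLinearMap.eq_adjoint_iff _ _).2 fun x y => ?_).symm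
  rw [tensorRep_tmul, tensorRep_tmul]
  induction x, y using Completion.induction_on₂ with
  | hp => apply isClosed_eq <;> fun_prop
  | ih x y =>
    simp only [ContinuousLinearMap.completion_apply_coe, Completion.inner_coe]
    induction x using TensorProduct.induction_on with
    | zero => simp
    | add x x' hx hx' => rw [map_add, inner_add_left, inner_add_left, hx, hx']
    | tmul x₁ x₂ =>
      induction y using TensorProduct.induction_on with
      | zero => simp
      | add y y' hy hy' => rw [map_add, inner_add_right, inner_add_right, hy, hy']
      | tmul y₁ y₂ =>
        rw [TensorProduct.mapL_tmul, TensorProduct.mapL_tmul, TensorProduct.inner_tmul,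
          TensorProduct.inner_tmul, ← adjoint_leftRep, ← adjoint_rightRep,
          ContinuousLinearMap.adjoint_inner_left, ContinuousLinearMap.adjoint_inner_left]

/-- The trace `φ ⊗ φ^op`. -/
lemma inner_unitVec_tensorRep (a : M) (b : Mᵐᵒᵖ) :
    ⟪unitVec φ, tensorRep φ (a ⊗ₜ b) (unitVec φ)⟫_ℂ = φ.toFun a * φ.toFun b.unop := by
  rw [tensorRep_tmul, unitVec, ContinuousLinearMap.completion_apply_coe, Completion.inner_coe,
    TensorProduct.mapL_tmul, TensorProduct.inner_tmul, leftRep_coe, rightRep_coe,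
    Completion.inner_coe, Completion.inner_coe, PositiveLinearMap.preGNS_inner_def,
    PositiveLinearMap.preGNS_inner_def]
  simp

lemma norm_unitVec : ‖unitVec φ‖ = 1 := by
  have h := inner_unitVec_tensorRep φ 1 1
  rw [← Algebra.TensorProduct.one_def, tensorRep_one, one_apply_eq_self,
    inner_self_eq_norm_sq_to_K, MulOpposite.unop_one, φ.map_one] at h
  have h2 : ‖unitVec φ‖ ^ 2 = 1 := by
    have h3 : ((‖unitVec φ‖ ^ 2 : ℝ) : ℂ) = ((1 : ℝ) : ℂ) := by simpa using h
    exact_mod_cast h3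
  exact (pow_eq_one_iff_of_nonneg (norm_nonneg _) two_ne_zero).1 h2

variable {ι : Type*} (X : ι → M)

/-- The operator of a matrix over `𝔄 ⊙ 𝔄^op` evaluated at `X`. -/
def hilbAct {κ κ' : Type*} [Fintype κ] [Fintype κ']
    (D : Matrix κ κ' (StarPoly ι ⊗[ℂ] (StarPoly ι)ᵐᵒᵖ)) :
    PiLp 2 (fun _ : κ' => L2Tensor φ) →L[ℂ] PiLp 2 (fun _ : κ => L2Tensor φ) :=
  matOp φ (D.map fun d => toVN φ (evalTensor X d))

lemma hilbAct_apply {κ κ' : Type*} [Fintype κ] [Fintype κ']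
    (D : Matrix κ κ' (StarPoly ι ⊗[ℂ] (StarPoly ι)ᵐᵒᵖ)) (v : PiLp 2 fun _ : κ' => L2Tensor φ)
    (a : κ) : hilbAct φ X D v a = ∑ b, tensorRep φ (evalTensor X (D a b)) (v b) := by
  simp [hilbAct, matOp, toVN]

lemma hilbAct_mul {κ κ' κ'' : Type*} [Fintype κ] [Fintype κ'] [Fintype κ'']
    (D : Matrix κ κ' (StarPoly ι ⊗[ℂ] (StarPoly ι)ᵐᵒᵖ))
    (D' : Matrix κ' κ'' (StarPoly ι ⊗[ℂ] (StarPoly ι)ᵐᵒᵖ)) :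
    hilbAct φ X (D * D') = hilbAct φ X D ∘L hilbAct φ X D' := by
  ext v a
  simp only [hilbAct_apply, ContinuousLinearMap.comp_apply, Matrix.mul_apply, map_sum, map_mul,
    tensorRep_mul, sum_apply, mul_apply_eq_comp]
  exact Finset.sum_comm

lemma hilbAct_one {κ : Type*} [Fintype κ] [DecidableEq κ] :
    hilbAct φ X (1 : Matrix κ κ (StarPoly ι ⊗[ℂ] (StarPoly ι)ᵐᵒᵖ)) = 1 := by
  ext v a
  rw [hilbAct_apply, Finset.sum_eq_single a]
  · have h : evalTensor X (1 : StarPoly ι ⊗[ℂ] (StarPoly ι)ᵐᵒᵖ) = 1 := by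
      rw [Algebra.TensorProduct.one_def, evalTensor, Algebra.TensorProduct.map_tmul]
      simp [Algebra.TensorProduct.one_def]
    rw [Matrix.one_apply_eq, h, tensorRep_one]
    rfl
  · intro b _ hb
    simp [Matrix.one_apply_ne' hb]
  · simp

lemma hilbAct_pow {κ : Type*} [Fintype κ] [DecidableEq κ]
    (D : Matrix κ κ (StarPoly ι ⊗[ℂ] (StarPoly ι)ᵐᵒᵖ)) (l : ℕ) :
    hilbAct φ X (D ^ l) = hilbAct φ X D ^ l := by
  induction l with
  | zero => rw [pow_zero, pow_zero, hilbAct_one]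
  | succ l ih => rw [pow_succ, pow_succ, hilbAct_mul, ih]; rfl

lemma hilbAct_sub {κ κ' : Type*} [Fintype κ] [Fintype κ']
    (D D' : Matrix κ κ' (StarPoly ι ⊗[ℂ] (StarPoly ι)ᵐᵒᵖ)) :
    hilbAct φ X (D - D') = hilbAct φ X D - hilbAct φ X D' := by
  ext v a
  simp [hilbAct_apply]

lemma hilbAct_smul {κ κ' : Type*} [Fintype κ] [Fintype κ'] (c : ℂ)
    (D : Matrix κ κ' (StarPoly ι ⊗[ℂ] (StarPoly ι)ᵐᵒᵖ)) :
    hilbAct φ X (c • D) = c • hilbAct φ X D := by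
  ext v a
  simp [hilbAct_apply, Finset.smul_sum]

lemma matTrace_hilbAct {κ : Type*} [Fintype κ] [DecidableEq κ]
    (D : Matrix κ κ (StarPoly ι ⊗[ℂ] (StarPoly ι)ᵐᵒᵖ)) :
    matTrace φ (hilbAct φ X D)
      = ∑ b, (⟪unitVec φ, tensorRep φ (evalTensor X (D b b)) (unitVec φ)⟫_ℂ).re := by
  refine Finset.sum_congr rfl fun b _ => ?_
  rw [hilbAct_apply, Finset.sum_eq_single b]
  · simp
  · intro c _ hc
    simp [hc]
  · simp

/-- Elements of `𝔄 ⊙ 𝔄^op` have an adjoint, compatible with all representations. -/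
lemma exists_adjoint (d : StarPoly ι ⊗[ℂ] (StarPoly ι)ᵐᵒᵖ) :
    ∃ d' : StarPoly ι ⊗[ℂ] (StarPoly ι)ᵐᵒᵖ,
      tensorRep φ (evalTensor X d') = (tensorRep φ (evalTensor X d)).adjoint ∧
      ∀ (k : ℕ) (x : ι → Mat k) (u v : Mat k),
        (star (biAct x x d' u) * v).trace = (star u * biAct x x d v).trace := by
  induction d using TensorProduct.induction_on with
  | zero => exact ⟨0, by simp, by simp⟩
  | add d e hd he =>
    obtain ⟨d', hd₁, hd₂⟩ := hd
    obtain ⟨e', he₁, he₂⟩ := he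
    refine ⟨d' + e', by simp only [map_add, hd₁, he₁], fun k x u v => ?_⟩
    rw [map_add, map_add, LinearMap.add_apply, LinearMap.add_apply, star_add, add_mul, mul_add,
      Matrix.trace_add, Matrix.trace_add, hd₂, he₂]
  | tmul f g =>
    refine ⟨f.adj ⊗ₜ MulOpposite.op g.unop.adj, ?_, fun k x u v => ?_⟩
    · have h : ∀ (f : StarPoly ι) (g : (StarPoly ι)ᵐᵒᵖ), evalTensor X (f ⊗ₜ g)
          = StarPoly.eval X f ⊗ₜ MulOpposite.op (StarPoly.eval X g.unop) := fun f g => by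
        simp [evalTensor]
      rw [h, h, adjoint_tensorRep_tmul, MulOpposite.unop_op, StarPoly.eval_adj, StarPoly.eval_adj,
        MulOpposite.op_star]
    · rw [biAct_tmul, biAct_tmul, MulOpposite.unop_op, StarPoly.eval_adj, StarPoly.eval_adj,
        star_mul, star_mul, star_star, star_star, mul_assoc, Matrix.trace_mul_comm]
      simp only [mul_assoc]

/-- A single symbolic matrix represents the adjoint on `L²` and at every matrix tuple. Hence `1 -
T^*T/C²` and its powers are symbolic too, and their traces can be compared by `tendsto_biTrace`. -/
lemma exists_matrix_adjoint {κ κ' : Type*} [Fintype κ] [Fintype κ']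
    (D : Matrix κ κ' (StarPoly ι ⊗[ℂ] (StarPoly ι)ᵐᵒᵖ)) :
    ∃ D' : Matrix κ' κ (StarPoly ι ⊗[ℂ] (StarPoly ι)ᵐᵒᵖ),
      hilbAct φ X D' = (hilbAct φ X D).adjoint ∧
      ∀ (k : ℕ) (x : ι → Mat k) (u : κ → Mat k) (v : κ' → Mat k),
        ⟪vec κ' k (matAct x x D' u), vec κ' k v⟫_ℂ
          = ⟪vec κ k u, vec κ k (matAct x x D v)⟫_ℂ := by
  choose d hd₁ hd₂ using fun (a : κ) (b : κ') => exists_adjoint φ X (D a b)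
  refine ⟨Matrix.of fun b a => d a b, ?_, fun k x u v => ?_⟩
  · refine (ContinuousLinearMap.eq_adjoint_iff _ _).2 fun u v => ?_
    simp only [PiLp.inner_apply, hilbAct_apply, sum_inner, inner_sum, Matrix.of_apply, hd₁,
      ContinuousLinearMap.adjoint_inner_left]
    exact Finset.sum_comm
  · rw [inner_vec, inner_vec]
    simp only [matAct_apply, Matrix.of_apply, star_sum, Finset.sum_mul, Finset.mul_sum,
      Matrix.trace_sum, hd₂]
    exact Finset.sum_comm

/-- The trace of the bimodule action on matrices. -/
def biTrace {k : ℕ} (x : ι → Mat k) (d : StarPoly ι ⊗[ℂ] (StarPoly ι)ᵐᵒᵖ) : ℂ :=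
  ∑ i, ∑ j, biAct x x d (Matrix.single i j 1) i j

lemma biTrace_tmul {k : ℕ} (x : ι → Mat k) (f : StarPoly ι) (g : (StarPoly ι)ᵐᵒᵖ) :
    biTrace x (f ⊗ₜ g) = (StarPoly.eval x f).trace * (StarPoly.eval x g.unop).trace := by
  simp only [biTrace, biAct_tmul, Matrix.trace, Matrix.diag, Finset.sum_mul_sum]
  refine Finset.sum_congr rfl fun i _ => Finset.sum_congr rfl fun j _ => ?_
  rw [mul_assoc, Matrix.mul_apply, Finset.sum_eq_single i]
  · rw [Matrix.single_mul_apply_same, one_mul]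
  · intro l _ hl
    rw [Matrix.single_mul_apply_of_ne _ _ _ _ _ hl, mul_zero]
  · simp

/-- The map `v ↦ a v b` on `k × k` matrices has trace `Tr a · Tr b`. Divided by `k²` this is `tr_k a
· tr_k b`, which along microstates tends to the product of the values of `φ`, that is, to `φ ⊗
φ^op`. -/
lemma tendsto_biTrace (d : StarPoly ι ⊗[ℂ] (StarPoly ι)ᵐᵒᵖ) :
    Tendsto (fun s => biTrace s.2 d / (s.1 : ℂ) ^ 2) (microFilter φ.toFun X)
      (𝓝 ⟪unitVec φ, tensorRep φ (evalTensor X d) (unitVec φ)⟫_ℂ) := by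
  induction d using TensorProduct.induction_on with
  | zero => simpa [biTrace] using tendsto_const_nhds
  | add d e hd he =>
    simp only [map_add, add_apply, inner_add_right]
    refine (hd.add he).congr fun s => ?_
    simp [biTrace, Finset.sum_add_distrib, add_div]
  | tmul f g =>
    have h : evalTensor X (f ⊗ₜ g)
        = StarPoly.eval X f ⊗ₜ MulOpposite.op (StarPoly.eval X g.unop) := by simp [evalTensor]
    rw [h, inner_unitVec_tensorRep, MulOpposite.unop_op]
    have h1 := tendsto_ntr_eval (φ := φ.toFun.toLinearMap) φ.map_one X f
    have h2 := tendsto_ntr_eval (φ := φ.toFun.toLinearMap) φ.map_one X g.unop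
    refine (h1.mul h2).congr fun s => ?_
    rw [biTrace_tmul, ntr, ntr]
    ring

end Representation

/-! ### Counting small singular values of the S-derivative at microstates -/

section Counting

/-- The action of a matrix over `𝔄 ⊙ 𝔄^op` on tuples of matrices, as a bounded operator. -/
def vecAct {ι κ κ' : Type*} [Fintype κ] [Fintype κ'] {k : ℕ} (x : ι → Mat k)
    (D : Matrix κ κ' (StarPoly ι ⊗[ℂ] (StarPoly ι)ᵐᵒᵖ)) :
    EuclideanSpace ℂ (κ' × Fin k × Fin k) →L[ℂ] EuclideanSpace ℂ (κ × Fin k × Fin k) :=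
  LinearMap.toContinuousLinearMap
    ((vec κ k).toLinearMap ∘ₗ matAct x x D ∘ₗ (vec κ' k).symm.toLinearMap)

lemma vecAct_vec {ι κ κ' : Type*} [Fintype κ] [Fintype κ'] {k : ℕ} (x : ι → Mat k)
    (D : Matrix κ κ' (StarPoly ι ⊗[ℂ] (StarPoly ι)ᵐᵒᵖ)) (v : κ' → Mat k) :
    vecAct x D (vec κ' k v) = vec κ k (matAct x x D v) := by
  simp [vecAct]

lemma vecAct_ext {κ κ' : Type*} [Fintype κ] [Fintype κ'] {k : ℕ}
    {S T : EuclideanSpace ℂ (κ' × Fin k × Fin k) →L[ℂ] EuclideanSpace ℂ (κ × Fin k × Fin k)}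
    (h : ∀ v, S (vec κ' k v) = T (vec κ' k v)) : S = T := by
  refine ContinuousLinearMap.ext fun v => ?_
  obtain ⟨v, rfl⟩ := (vec κ' k).surjective v
  exact h v

lemma vecAct_pow {ι κ : Type*} [Fintype κ] [DecidableEq κ] {k : ℕ} (x : ι → Mat k)
    (D : Matrix κ κ (StarPoly ι ⊗[ℂ] (StarPoly ι)ᵐᵒᵖ)) (l : ℕ) :
    vecAct x (D ^ l) = vecAct x D ^ l := by
  induction l with
  | zero =>
    refine vecAct_ext fun v => ?_
    rw [pow_zero, pow_zero, vecAct_vec, matAct_one]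
    rfl
  | succ l ih =>
    refine vecAct_ext fun v => ?_
    rw [pow_succ, pow_succ, vecAct_vec, matAct_mul, mul_apply_eq_comp, vecAct_vec, ← ih, vecAct_vec]
    rfl

lemma trace_vecAct {ι κ : Type*} [Fintype κ] {k : ℕ} (x : ι → Mat k)
    (D : Matrix κ κ (StarPoly ι ⊗[ℂ] (StarPoly ι)ᵐᵒᵖ)) :
    LinearMap.trace ℂ _ (vecAct x D).toLinearMap = ∑ b, biTrace x (D b b) := by
  classical
  rw [LinearMap.trace_eq_sum_inner _ (EuclideanSpace.basisFun _ ℂ), Fintype.sum_prod_type]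
  refine Finset.sum_congr rfl fun b _ => ?_
  rw [Fintype.sum_prod_type]
  refine Finset.sum_congr rfl fun i _ => Finset.sum_congr rfl fun j _ => ?_
  have h : EuclideanSpace.basisFun (κ × Fin k × Fin k) ℂ (b, i, j)
      = vec κ k (Pi.single b (Matrix.single i j 1)) := by
    ext ⟨b', i', j'⟩
    rw [vec_apply, EuclideanSpace.basisFun_apply]
    by_cases hb : b = b'
    · subst hb
      simp [Matrix.single_apply, eq_comm]
    · simp [Ne.symm hb]
  have h2 : ∀ v : EuclideanSpace ℂ (κ × Fin k × Fin k),
      ⟪EuclideanSpace.basisFun (κ × Fin k × Fin k) ℂ (b, i, j), v⟫_ℂ = v (b, i, j) := fun v => by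
    rw [EuclideanSpace.basisFun_apply, EuclideanSpace.inner_single_left]
    simp
  rw [h2, h, ContinuousLinearMap.coe_coe, vecAct_vec, vec_apply, matAct_apply,
    Finset.sum_eq_single b]
  · simp
  · intro c _ hc
    simp [hc]
  · simp

lemma finrank_vec_real (ι : Type*) [Fintype ι] (k : ℕ) :
    Module.finrank ℝ (EuclideanSpace ℂ (ι × Fin k × Fin k)) = 2 * Fintype.card ι * k ^ 2 := by
  rw [finrank_real_of_complex, finrank_euclideanSpace]
  simp
  ring

lemma real_inner_euclidean {J : Type*} [Fintype J] (u v : EuclideanSpace ℂ J) :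
    ⟪u, v⟫_ℝ = (⟪u, v⟫_ℂ).re := by
  rw [PiLp.inner_apply, PiLp.inner_apply, Complex.re_sum]
  rfl

variable {M : Type*} [CStarAlgebra M] [PartialOrder M] [StarOrderedRing M] (φ : TracialState M)

/-- The trace is a finite sum of vector functionals, so the strong convergence in the mean ergodic
theorem is enough. -/
lemma tendsto_matTrace_average {κ κ' : Type*} [Fintype κ] [Fintype κ'] [DecidableEq κ']
    (T : Matrix κ κ' (vnTensor φ)) {C : ℝ} (hC : 0 < C) (hT : ‖matOp φ T‖ ≤ C) :
    Tendsto (fun N : ℕ => (N : ℝ)⁻¹ * ∑ l ∈ Finset.range N, matTrace φ (defectOp (matOp φ T) C ^ l))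
      atTop (𝓝 (nullity φ T)) := by
  have h : ∀ N : ℕ, (N : ℝ)⁻¹ * ∑ l ∈ Finset.range N, matTrace φ (defectOp (matOp φ T) C ^ l)
      = ∑ i, (⟪unitVec φ, ((N : ℂ)⁻¹ • ∑ l ∈ Finset.range N,
          (defectOp (matOp φ T) C ^ l) (PiLp.single 2 i (unitVec φ))) i⟫_ℂ).re := by
    intro N
    simp only [matTrace]
    rw [Finset.sum_comm, Finset.mul_sum]
    refine Finset.sum_congr rfl fun i _ => ?_
    rw [PiLp.smul_apply, inner_smul_right, WithLp.ofLp_sum, Finset.sum_apply, inner_sum]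
    have : ((N : ℂ)⁻¹) = (((N : ℝ)⁻¹ : ℝ) : ℂ) := by push_cast; rfl
    rw [this, Complex.re_ofReal_mul, Complex.re_sum]
  refine Tendsto.congr (fun N => (h N).symm) ?_
  rw [nullity, matTrace]
  refine tendsto_finsetSum _ fun i _ => ?_
  have h2 := tendsto_defectOp_average hC hT (PiLp.single 2 i (unitVec φ))
  have hc : Continuous fun v : PiLp 2 (fun _ : κ' => L2Tensor φ) =>
      (⟪unitVec φ, v i⟫_ℂ).re :=
    Complex.continuous_re.comp (continuous_const.inner (PiLp.continuous_apply 2 _ i))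
  exact (hc.tendsto _).comp h2

open scoped Matrix.Norms.L2Operator in
/-- At bounded microstates of `X`, at most `(Nullity + β) k²` singular values of the S-derivative
are smaller than some fixed `t`. -/
lemma exists_eventually_card_le {ι κ : Type*} [Fintype ι] [DecidableEq ι] [Fintype κ]
    (X : ι → M) (F : κ → StarPoly ι) {R : ℝ} (hR : 1 ≤ R) {β : ℝ} (hβ : 0 < β) :
    ∃ t : ℝ, 0 < t ∧ ∀ᶠ s in microFilter φ.toFun X, (∀ i, ‖s.2 i‖ ≤ R) →
      ∀ (b : OrthonormalBasis
          (Fin (Module.finrank ℝ (EuclideanSpace ℂ (ι × Fin s.1 × Fin s.1)))) ℝ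
          (EuclideanSpace ℂ (ι × Fin s.1 × Fin s.1))) (S : Finset _),
        (∀ i ∈ S, ‖vec _ _ (matAct s.2 s.2 (symDeriv F) (saSk ((vec ι s.1).symm (b i))))‖ ≤ t) →
        (S.card : ℝ) ≤ (nullity φ (sDeriv φ F X) + β) * s.1 ^ 2 := by
  obtain ⟨C₀, hC₀, hbd⟩ := exists_matAct_bound (symDeriv F) hR
  -- One `C` bounds the derivative both on `L²` and at all bounded matrix tuples, so the same
  -- symbolic `B` gives a contraction in each place.
  let C := max C₀ ‖matOp φ (sDeriv φ F X)‖ + 1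
  have hC : 0 < C := by positivity
  have hCC₀ : C₀ ≤ C := by have := le_max_left C₀ ‖matOp φ (sDeriv φ F X)‖; simp only [C]; linarith
  have hCT : ‖matOp φ (sDeriv φ F X)‖ ≤ C := by
    have := le_max_right C₀ ‖matOp φ (sDeriv φ F X)‖; simp only [C]; linarith
  obtain ⟨D', hD'₁, hD'₂⟩ := exists_matrix_adjoint φ X (symDeriv F)
  let B := 1 - ((C : ℂ) ^ 2)⁻¹ • (D' * symDeriv F)
  have hB : hilbAct φ X B = defectOp (matOp φ (sDeriv φ F X)) C := by
    simp only [B, hilbAct_sub, hilbAct_one, hilbAct_smul, hilbAct_mul, hD'₁]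
    rfl
  have hBv : ∀ (k : ℕ) (x : ι → Mat k), vecAct x B = defectOp (vecAct x (symDeriv F)) C := by
    intro k x
    have hadj : vecAct x D' = (vecAct x (symDeriv F)).adjoint := by
      refine (ContinuousLinearMap.eq_adjoint_iff _ _).2 fun u v => ?_
      obtain ⟨u, rfl⟩ := (vec _ k).surjective u
      obtain ⟨v, rfl⟩ := (vec _ k).surjective v
      rw [vecAct_vec, vecAct_vec, hD'₂]
    refine vecAct_ext fun v => ?_
    rw [defectOp_apply, ← hadj, vecAct_vec, vecAct_vec, vecAct_vec, matAct_sub, matAct_one,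
      matAct_smul, matAct_mul]
    simp
  have havg := tendsto_matTrace_average φ (sDeriv φ F X) hC hCT
  -- A fixed finite average already has trace below `Nullity + β/2`; only finitely many symbolic
  -- traces then have to converge.
  obtain ⟨N, hN, hN1⟩ := (((tendsto_order.1 havg).2 _
    (show nullity φ (sDeriv φ F X) < nullity φ (sDeriv φ F X) + β / 2 by linarith)).and
      (eventually_ge_atTop 1)).exists
  have hN0 : (0 : ℝ) < N := by exact_mod_cast hN1
  -- Chosen so that the drift `N t/C = β/(4(#ι + 1))`, summed over at most `2 #ι k²` vectors, costs
  -- at most `(β/2) k²`.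
  let t : ℝ := C * β / (4 * (Fintype.card ι + 1) * N)
  have ht : 0 < t := by positivity
  have hlim : Tendsto (fun s : (k : ℕ) × (ι → Mat k) => (N : ℝ)⁻¹ * ∑ l ∈ Finset.range N,
      ∑ b, (biTrace s.2 ((B ^ l) b b) / (s.1 : ℂ) ^ 2).re) (microFilter φ.toFun X)
      (𝓝 ((N : ℝ)⁻¹ * ∑ l ∈ Finset.range N,
        matTrace φ (defectOp (matOp φ (sDeriv φ F X)) C ^ l))) := by
    refine Tendsto.const_mul _ (tendsto_finsetSum _ fun l _ => ?_)
    rw [← hB, ← hilbAct_pow, matTrace_hilbAct]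
    exact tendsto_finsetSum _ fun b _ =>
      (Complex.continuous_re.tendsto _).comp (tendsto_biTrace φ X _)
  refine ⟨t, ht, ?_⟩
  filter_upwards [(tendsto_order.1 hlim).2 _ hN, eventually_pos_microFilter φ.toFun X]
    with ⟨k, x⟩ hs hk hx b S hS
  have hk' : (0 : ℝ) < k := by exact_mod_cast hk
  have hTx : ‖vecAct x (symDeriv F)‖ ≤ C := by
    refine ContinuousLinearMap.opNorm_le_bound _ hC.le fun v => ?_
    obtain ⟨v, rfl⟩ := (vec _ k).surjective v
    rw [vecAct_vec]
    refine (hbd k 0 x x ⟨le_rfl, hx, hx, fun i => by simp⟩ v).1.trans ?_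
    gcongr
  -- The self-adjoint/skew-adjoint splitting turns a real orthonormal basis of `ι`-tuples into a
  -- complex orthonormal basis of `ι × Fin 2`-tuples: the dimensions are both `2 #ι k²`. Complex
  -- traces therefore count real singular directions.
  let c : Fin (Module.finrank ℝ (EuclideanSpace ℂ (ι × Fin k × Fin k))) →
      EuclideanSpace ℂ ((ι × Fin 2) × Fin k × Fin k) :=
    fun i => vec _ k (saSk ((vec ι k).symm (b i)))
  have hc : Orthonormal ℂ c := by
    rw [orthonormal_iff_ite]
    intro i j
    simp only [c]
    rw [inner_vec_saSk, LinearEquiv.apply_symm_apply, LinearEquiv.apply_symm_apply]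
    have h1 := orthonormal_iff_ite.1 b.orthonormal i j
    have h2 : ⟪b i, b j⟫_ℝ = (⟪b i, b j⟫_ℂ).re := real_inner_euclidean _ _
    rw [← h2, h1]
    split_ifs <;> simp
  have hcard : Module.finrank ℂ (EuclideanSpace ℂ ((ι × Fin 2) × Fin k × Fin k))
      = Fintype.card (Fin (Module.finrank ℝ (EuclideanSpace ℂ (ι × Fin k × Fin k)))) := by
    rw [Fintype.card_fin, finrank_vec_real, finrank_euclideanSpace]
    simp
    ring
  obtain ⟨e, he⟩ := Orthonormal.exists_orthonormalBasis_extension_of_card_eq (𝕜 := ℂ)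
    (v := c) (s := Set.univ) hcard (hc.comp _ Subtype.val_injective)
  have hec : ∀ i, e i = c i := fun i => he i (Set.mem_univ i)
  have hsum : ∀ l : ℕ, (S.card : ℝ) * (1 - N * (t / C)) ≤ ∑ b, (biTrace x ((B ^ l) b b)).re ∨
      N ≤ l := by
    intro l
    rcases le_or_gt N l with h | h
    · exact Or.inr h
    refine Or.inl ?_
    rw [← Complex.re_sum, ← trace_vecAct, vecAct_pow, hBv, LinearMap.trace_eq_sum_inner _ e,
      Complex.re_sum]
    -- Each basis vector in `S` contributes nearly 1 to the trace of each power, and the others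
    -- contribute nonnegatively.
    calc (S.card : ℝ) * (1 - N * (t / C)) = ∑ i ∈ S, (1 - N * (t / C)) := by
          rw [Finset.sum_const, nsmul_eq_mul]
      _ ≤ ∑ i ∈ S, (⟪e i, (defectOp (vecAct x (symDeriv F)) C ^ l) (e i)⟫_ℂ).re := by
          refine Finset.sum_le_sum fun i hi => ?_
          refine le_trans ?_ (le_re_inner_defectOp_pow hC hTx (t := t) (e.orthonormal.1 i) ?_ l)
          · have : (l : ℝ) ≤ N := by exact_mod_cast h.le
            gcongr
          · rw [hec, vecAct_vec]
            exact hS i hi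
      _ ≤ _ := Finset.sum_le_sum_of_subset_of_nonneg (Finset.subset_univ S)
          fun i _ _ => re_inner_defectOp_pow_nonneg hC hTx l (e i)
  have hlow : (S.card : ℝ) * (1 - N * (t / C)) / k ^ 2
      ≤ (N : ℝ)⁻¹ * ∑ l ∈ Finset.range N, ∑ b, (biTrace x ((B ^ l) b b) / (k : ℂ) ^ 2).re := by
    have h1 : ∀ l, ∑ b, (biTrace x ((B ^ l) b b) / (k : ℂ) ^ 2).re
        = (∑ b, (biTrace x ((B ^ l) b b)).re) / k ^ 2 := by
      intro l
      rw [Finset.sum_div]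
      refine Finset.sum_congr rfl fun b _ => ?_
      have : ((k : ℂ) ^ 2) = ((k ^ 2 : ℝ) : ℂ) := by push_cast; rfl
      rw [this, Complex.div_ofReal_re]
    have h2 : ∑ l ∈ Finset.range N, ((S.card : ℝ) * (1 - N * (t / C)) / k ^ 2)
        ≤ ∑ l ∈ Finset.range N, ∑ b, (biTrace x ((B ^ l) b b) / (k : ℂ) ^ 2).re := by
      refine Finset.sum_le_sum fun l hl => ?_
      rw [h1]
      have := (hsum l).resolve_right (by simpa using hl)
      gcongr
    rw [Finset.sum_const, Finset.card_range, nsmul_eq_mul] at h2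
    rw [le_inv_mul_iff₀ hN0]
    exact h2
  have hfin := hlow.trans hs.le
  rw [div_le_iff₀ (by positivity)] at hfin
  have hScard : (S.card : ℝ) ≤ 2 * Fintype.card ι * k ^ 2 := by
    exact_mod_cast (Finset.card_le_univ S).trans_eq
      ((Fintype.card_fin _).trans (finrank_vec_real ι k))
  have ht2 : (S.card : ℝ) * (N * (t / C)) ≤ β / 2 * k ^ 2 := by
    have h3 : N * (t / C) = β / (4 * (Fintype.card ι + 1)) := by
      simp only [t]
      field_simp
    rw [h3]
    calc (S.card : ℝ) * (β / (4 * (Fintype.card ι + 1)))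
        ≤ (2 * (Fintype.card ι + 1) * k ^ 2) * (β / (4 * (Fintype.card ι + 1))) := by
          gcongr
          refine hScard.trans ?_
          gcongr
          simp
      _ = β / 2 * k ^ 2 := by field_simp; ring
  nlinarith

end Counting

/-! ### Covers of sets of tuples of matrices -/

section Covers

/-- `A` is covered by at most `N` closed balls of radius `r`. -/
def HasCover {ι : Type*} [Fintype ι] {k : ℕ} (A : Set (ι → Mat k)) (r N : ℝ) : Prop :=
  ∃ s : Finset (ι → Mat k), (s.card : ℝ) ≤ N ∧ ∀ ξ ∈ A, ∃ c ∈ s, dist2 ξ c ≤ r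

lemma HasCover.of_subset_iUnion {ι α : Type*} [Fintype ι] {k : ℕ} {A : Set (ι → Mat k)} {r N : ℝ}
    (s : Finset α) (P : α → Set (ι → Mat k)) (hA : ∀ ξ ∈ A, ∃ a ∈ s, ξ ∈ P a)
    (hP : ∀ a ∈ s, HasCover (P a) r N) : HasCover A r (s.card * N) := by
  classical
  choose! f hf hf' using hP
  refine ⟨s.biUnion f, ?_, fun ξ hξ => ?_⟩
  · calc ((s.biUnion f).card : ℝ) ≤ ∑ a ∈ s, ((f a).card : ℝ) := by
          exact_mod_cast Finset.card_biUnion_le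
      _ ≤ ∑ a ∈ s, N := Finset.sum_le_sum hf
      _ = s.card * N := by simp
  · obtain ⟨a, ha, h⟩ := hA ξ hξ
    obtain ⟨c, hc, h'⟩ := hf' a ha ξ h
    exact ⟨c, Finset.mem_biUnion.2 ⟨a, ha, hc⟩, h'⟩

lemma HasCover.mono {ι : Type*} [Fintype ι] {k : ℕ} {A : Set (ι → Mat k)} {r r' N N' : ℝ}
    (h : HasCover A r N) (hr : r ≤ r') (hN : N ≤ N') : HasCover A r' N' := by
  obtain ⟨s, hs, h⟩ := h
  exact ⟨s, hs.trans hN, fun ξ hξ => (h ξ hξ).imp fun c hc => ⟨hc.1, hc.2.trans hr⟩⟩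

lemma HasCover.refine {ι : Type*} [Fintype ι] {k : ℕ} {A : Set (ι → Mat k)} {r r' N N' : ℝ}
    (h : HasCover A r N) (hN' : 0 ≤ N') (h' : ∀ c, HasCover (A ∩ {ξ | dist2 ξ c ≤ r}) r' N') :
    HasCover A r' (N * N') := by
  obtain ⟨s, hs, hA⟩ := h
  refine (HasCover.of_subset_iUnion s (fun c => A ∩ {ξ | dist2 ξ c ≤ r}) (fun ξ hξ => ?_)
    fun c _ => h' c).mono le_rfl (mul_le_mul_of_nonneg_right hs hN')
  obtain ⟨c, hc, h⟩ := hA ξ hξ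
  exact ⟨c, hc, hξ, h⟩

lemma dist2_comm {ι : Type*} [Fintype ι] {k : ℕ} (ξ η : ι → Mat k) : dist2 ξ η = dist2 η ξ := by
  rw [dist2_eq, dist2_eq, ← neg_sub η ξ, map_neg, norm_neg]

lemma dist2_triangle {ι : Type*} [Fintype ι] {k : ℕ} (ξ η ζ : ι → Mat k) :
    dist2 ξ ζ ≤ dist2 ξ η + dist2 η ζ := by
  rw [dist2_eq, dist2_eq, dist2_eq, ← sub_add_sub_cancel ξ η ζ, map_add, ← add_div]
  gcongr
  exact norm_add_le _ _

lemma norm_vec_sub_le_iff {ι : Type*} [Fintype ι] {k : ℕ} (hk : 0 < k) (ξ η : ι → Mat k) (r : ℝ) :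
    ‖vec ι k (ξ - η)‖ ≤ r * √k ↔ dist2 ξ η ≤ r := by
  have : (0 : ℝ) < √k := Real.sqrt_pos.2 (by exact_mod_cast hk)
  rw [dist2_eq, div_le_iff₀ this]

lemma coveringNumber_le_of_hasCover {ι : Type*} [Fintype ι] {k : ℕ} {A : Set (ι → Mat k)}
    {r ε N : ℝ} (h : HasCover A r N) (hr : r < ε) :
    (coveringNumber ε A : ENNReal) ≤ ENNReal.ofReal N := by
  obtain ⟨s, hs, hA⟩ := h
  have h1 : coveringNumber ε A ≤ (s.card : ℕ∞) := by
    rw [← Set.encard_coe_eq_coe_finsetCard]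
    refine iInf₂_le (s : Set (ι → Mat k)) fun ξ hξ => ?_
    obtain ⟨c, hc, h⟩ := hA ξ hξ
    exact Set.mem_biUnion (Finset.mem_coe.2 hc) (h.trans_lt hr)
  refine (ENat.toENNReal_le.2 h1).trans ?_
  rw [ENat.toENNReal_coe, ← ENNReal.ofReal_natCast]
  exact ENNReal.ofReal_le_ofReal hs

lemma norm_vec_saSk {ι : Type*} [Fintype ι] {k : ℕ} (v : ι → Mat k) :
    ‖vec (ι × Fin 2) k (saSk v)‖ = ‖vec ι k v‖ := by
  refine (sq_eq_sq₀ (norm_nonneg _) (norm_nonneg _)).1 ?_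
  rw [← inner_self_eq_norm_sq (𝕜 := ℂ), ← inner_self_eq_norm_sq (𝕜 := ℂ), inner_vec_saSk]
  simp

lemma saSk_add {ι : Type*} {k : ℕ} (u v : ι → Mat k) : saSk (u + v) = saSk u + saSk v := by
  funext b
  simp only [saSk, Pi.add_apply, star_add]
  split_ifs <;> module

lemma saSk_smul {ι : Type*} {k : ℕ} (r : ℝ) (u : ι → Mat k) :
    saSk ((r : ℂ) • u) = (r : ℂ) • saSk u := by
  funext b
  simp only [saSk, Pi.smul_apply, star_smul, Complex.star_def, Complex.conj_ofReal]
  split_ifs <;> module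

/-- The S-derivative at `η` as a real linear map. -/
def realDeriv {ι κ : Type*} [Fintype ι] [DecidableEq ι] [Fintype κ] (F : κ → StarPoly ι) {k : ℕ}
    (η : ι → Mat k) :
    EuclideanSpace ℂ (ι × Fin k × Fin k) →ₗ[ℝ] EuclideanSpace ℂ ((κ × Fin 2) × Fin k × Fin k) where
  toFun v := vec _ k (matAct η η (symDeriv F) (saSk ((vec ι k).symm v)))
  map_add' u v := by simp only [map_add, saSk_add]
  map_smul' r v := by
    have h : ∀ {J : Type _} [Fintype J] (u : EuclideanSpace ℂ J), r • u = (r : ℂ) • u :=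
      fun u => by ext; simp
    rw [h, map_smul, saSk_smul, map_smul, map_smul, RingHom.id_apply]
    ext
    simp

open scoped Matrix.Norms.L2Operator

/-- The count of small singular values of the S-derivative at `η`. -/
def SmallCount {ι κ : Type*} [Fintype ι] [DecidableEq ι] [Fintype κ] (F : κ → StarPoly ι)
    (t d : ℝ) {k : ℕ} (η : ι → Mat k) : Prop :=
  ∀ (b : OrthonormalBasis (Fin (Module.finrank ℝ (EuclideanSpace ℂ (ι × Fin k × Fin k)))) ℝ
      (EuclideanSpace ℂ (ι × Fin k × Fin k))) (S : Finset _),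
    (∀ i ∈ S, ‖vec _ _ (matAct η η (symDeriv F) (saSk ((vec ι k).symm (b i))))‖ ≤ t) →
    (S.card : ℝ) ≤ d * k ^ 2

/-- Operator norm bounds for the S-derivative of `F` on the ball of radius `R`. -/
def DerivBound {ι κ : Type*} [Fintype ι] [DecidableEq ι] [Fintype κ] (F : κ → StarPoly ι)
    (R C : ℝ) : Prop :=
  0 ≤ C ∧ ∀ (k : ℕ) (δ : ℝ) (x y : ι → Mat k), BoundedPair R δ x y → ∀ v : ι × Fin 2 → Mat k,
    ‖vec (κ × Fin 2) k (matAct x y (symDeriv F) v)‖ ≤ C * ‖vec (ι × Fin 2) k v‖ ∧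
    ‖vec (κ × Fin 2) k (matAct x y (symDeriv F) v - matAct y y (symDeriv F) v)‖
      ≤ C * δ * ‖vec (ι × Fin 2) k v‖

/-- The values of `F` at a tuple. -/
abbrev evalTuple {ι κ : Type*} (F : κ → StarPoly ι) {k : ℕ} (ξ : ι → Mat k) : κ → Mat k :=
  fun i => StarPoly.eval ξ (F i)

/-- Covers of a set of small operator norm diameter on which `F` is almost constant. -/
lemma hasCover_of_opNorm_diam {ι κ : Type*} [Fintype ι] [DecidableEq ι] [Fintype κ]
    {F : κ → StarPoly ι} {R C t d δ r ρ ε : ℝ} (hC : DerivBound F R C) (ht : 0 < t) (hr : 0 < r)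
    (hρ : 0 < ρ) (hδ : 2 * ε + C * δ * (2 * r) ≤ t * (ρ * r / 2)) {k : ℕ} (hk : 0 < k)
    {P : Set (ι → Mat k)} (hP : ∀ ξ ∈ P, ∀ η ∈ P, BoundedPair R δ ξ η)
    (hPr : ∀ ξ ∈ P, ∀ η ∈ P, dist2 ξ η ≤ 2 * r)
    (hPF : ∀ ξ ∈ P, ∀ η ∈ P, dist2 (evalTuple F ξ) (evalTuple F η) ≤ 2 * ε)
    (hcount : ∀ ξ ∈ P, SmallCount F t d ξ) :
    HasCover P (ρ * r) (Real.exp (d * Real.log (1 + 8 / ρ) * k ^ 2)) := by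
  classical
  rcases P.eq_empty_or_nonempty with rfl | ⟨η, hη⟩
  · exact ⟨∅, by simp [Real.exp_nonneg], by simp⟩
  have hk' : (0 : ℝ) < √k := Real.sqrt_pos.2 (by exact_mod_cast hk)
  obtain ⟨b, S, hbS, hcov⟩ := exists_spectral_cover (realDeriv F η) ht
  have hS := hcount η hη b S hbS
  obtain ⟨s, hs, hsc⟩ := hcov (2 * r * √k) (ρ * r / 2 * √k) (by positivity) (by positivity)
  refine ⟨s.image fun c => η + (vec ι k).symm c, ?_, fun ξ hξ => ?_⟩
  · refine (Nat.cast_le.2 Finset.card_image_le).trans (hs.trans ?_)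
    -- Radius `2r` against mesh `ρ r/2`; the factor 2 lost in the spectral cover brings the final
    -- radius to `ρ r`.
    have h1 : 1 + 2 * (2 * r * √k) / (ρ * r / 2 * √k) = 1 + 8 / ρ := by field_simp; norm_num
    have h2 : (0 : ℝ) < 1 + 8 / ρ := by positivity
    have h3 : 0 ≤ Real.log (1 + 8 / ρ) := Real.log_nonneg (by
      have : 0 ≤ 8 / ρ := by positivity
      linarith)
    rw [h1, ← Real.rpow_natCast, Real.rpow_def_of_pos h2]
    exact Real.exp_le_exp.2 ((mul_le_mul_of_nonneg_left hS h3).trans_eq (by ring))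
  · have hv : ‖vec ι k (ξ - η)‖ ≤ 2 * r * √k := (norm_vec_sub_le_iff hk ξ η _).2 (hPr ξ hξ η hη)
    have hD : ‖realDeriv F η (vec ι k (ξ - η))‖ ≤ t * (ρ * r / 2 * √k) := by
      have h1 := (hC.2 k δ ξ η (hP ξ hξ η hη) (saSk (ξ - η))).2
      rw [norm_vec_saSk] at h1
      have h2 : ‖vec (κ × Fin 2) k (matAct ξ η (symDeriv F) (saSk (ξ - η)))‖ ≤ 2 * ε * √k := by
        rw [matAct_symDeriv, norm_vec_saSk]
        exact (norm_vec_sub_le_iff hk (evalTuple F ξ) (evalTuple F η) _).2 (hPF ξ hξ η hη)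
      -- The derivative at `η` applied to `ξ - η` is `F(ξ) - F(η)`, of size `2ε`, minus the effect
      -- of replacing `ξ` by `η` in the left legs, of size `C δ · 2r`.
      have h3 : realDeriv F η (vec ι k (ξ - η))
          = vec (κ × Fin 2) k (matAct ξ η (symDeriv F) (saSk (ξ - η)))
            - vec (κ × Fin 2) k (matAct ξ η (symDeriv F) (saSk (ξ - η))
              - matAct η η (symDeriv F) (saSk (ξ - η))) := by
        rw [← map_sub, sub_sub_cancel]
        simp [realDeriv]
      have hδ0 := (hP ξ hξ η hη).1
      have hC0 := hC.1
      calc _ ≤ 2 * ε * √k + C * δ * ‖vec ι k (ξ - η)‖ := by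
            rw [h3]; exact (norm_sub_le _ _).trans (add_le_add h2 h1)
        _ ≤ 2 * ε * √k + C * δ * (2 * r * √k) := by gcongr
        _ = (2 * ε + C * δ * (2 * r)) * √k := by ring
        _ ≤ t * (ρ * r / 2) * √k := by gcongr
        _ = _ := by ring
    obtain ⟨c, hc, hcd⟩ := hsc _ hv hD
    refine ⟨_, Finset.mem_image_of_mem _ hc, (norm_vec_sub_le_iff hk _ _ _).1 ?_⟩
    rw [← sub_sub, map_sub, LinearEquiv.apply_symm_apply]
    refine hcd.trans_eq (by ring)

/-- One step of the iteration: a ball of radius `r` is covered by balls of radius `ρ r`. -/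
lemma hasCover_step {ι κ : Type*} [Fintype ι] [DecidableEq ι] [Fintype κ]
    {F : κ → StarPoly ι} {R C t d s r ρ ε τ : ℝ} (hR : 0 ≤ R) (hC : DerivBound F R C) (ht : 0 < t)
    (hr : 0 < r) (hρ : 0 < ρ) (hs : 0 < s) (hτ : 0 ≤ τ)
    (hsr : 2 * ε + C * (6 * s) * (2 * r) ≤ t * (ρ * r / 2)) (hrs : 4 * r ^ 2 ≤ τ * s ^ 2)
    {k : ℕ} (hk : 0 < k) {E : Set (ι → Mat k)} (hE : ∀ ξ ∈ E, ∀ i, ‖ξ i‖ ≤ R)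
    (hEF : ∀ ξ ∈ E, ∀ η ∈ E, dist2 (evalTuple F ξ) (evalTuple F η) ≤ 2 * ε)
    (hcount : ∀ ξ ∈ E, SmallCount F t d ξ) (c : ι → Mat k) :
    HasCover (E ∩ {ξ | dist2 ξ c ≤ r}) (ρ * r)
      (Real.exp ((4 * Fintype.card ι * τ * Real.log (3 + 4 * R / s)
        + d * Real.log (1 + 8 / ρ)) * k ^ 2)) := by
  classical
  rcases (E ∩ {ξ | dist2 ξ c ≤ r}).eq_empty_or_nonempty with h | ⟨η, hη⟩
  · rw [h]
    exact ⟨∅, by simp [Real.exp_nonneg], by simp⟩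
  have hdiam : ∀ ξ ∈ E ∩ {ξ | dist2 ξ c ≤ r}, ∀ ζ ∈ E ∩ {ξ | dist2 ξ c ≤ r},
      dist2 ξ ζ ≤ 2 * r := fun ξ hξ ζ hζ => by
    have h1 : dist2 ξ c ≤ r := hξ.2
    have h2 : dist2 ζ c ≤ r := hζ.2
    have := dist2_triangle ξ c ζ
    rw [dist2_comm c ζ] at this
    linarith
  -- The net is for differences `ξ i - η i` from a fixed `η`, hence the bound `2R`. Its balls of
  -- radius `3s` cut the set into pieces of operator norm diameter at most `6s`.
  obtain ⟨N, hN, hNc⟩ := exists_opNorm_cover k hs (show 0 ≤ 2 * R by linarith) hτ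
  let P : (ι → Mat k) → Set (ι → Mat k) := fun g =>
    (E ∩ {ξ | dist2 ξ c ≤ r}) ∩ {ξ | ∀ i, ‖ξ i - η i - g i‖ ≤ 3 * s}
  have hcov := HasCover.of_subset_iUnion (A := E ∩ {ξ | dist2 ξ c ≤ r}) (r := ρ * r)
    (N := Real.exp (d * Real.log (1 + 8 / ρ) * k ^ 2)) (Fintype.piFinset fun _ : ι => N) P ?_ ?_
  · refine hcov.mono le_rfl ?_
    rw [Fintype.card_piFinset, Finset.prod_const, Nat.cast_pow]
    calc (N.card : ℝ) ^ (Finset.univ : Finset ι).card * Real.exp (d * Real.log (1 + 8 / ρ) * k ^ 2)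
        ≤ (Real.exp (4 * τ * Real.log (3 + 2 * (2 * R) / s) * k ^ 2)) ^ Fintype.card ι
          * Real.exp (d * Real.log (1 + 8 / ρ) * k ^ 2) := by
          rw [Finset.card_univ]
          gcongr
      _ = _ := by
          rw [← Real.exp_nat_mul, ← Real.exp_add]
          congr 1
          have : 2 * (2 * R) / s = 4 * R / s := by ring
          rw [this]
          ring
  · intro ξ hξ
    have h : ∀ i, ∃ g ∈ N, ‖ξ i - η i - g‖ ≤ 3 * s := by
      intro i
      refine hNc _ ?_ ?_
      · refine (norm_sub_le _ _).trans ?_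
        linarith [hE ξ hξ.1 i, hE η hη.1 i]
      · have h1 : frob (ξ i - η i) ≤ 2 * r * √k :=
          (frob_le_norm_vec (ξ - η) i).trans ((norm_vec_sub_le_iff hk ξ η _).2 (hdiam ξ hξ η hη))
        calc frob (ξ i - η i) ^ 2 ≤ (2 * r * √k) ^ 2 := by
              have := frob_nonneg (ξ i - η i)
              gcongr
          _ = 4 * r ^ 2 * k := by rw [mul_pow, Real.sq_sqrt (Nat.cast_nonneg k)]; ring
          _ ≤ τ * s ^ 2 * k := by gcongr
          _ = _ := by ring
    choose g hg hg' using h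
    exact ⟨g, Fintype.mem_piFinset.2 hg, hξ, hg'⟩
  · intro g _
    refine hasCover_of_opNorm_diam hC ht hr hρ hsr hk (fun ξ hξ ζ hζ => ?_)
      (fun ξ hξ ζ hζ => hdiam ξ hξ.1 ζ hζ.1) (fun ξ hξ ζ hζ => hEF ξ hξ.1.1 ζ hζ.1.1)
      fun ξ hξ => hcount ξ hξ.1.1
    refine ⟨by positivity, hE ξ hξ.1.1, hE ζ hζ.1.1, fun i => ?_⟩
    have h1 := hξ.2 i
    have h2 := hζ.2 i
    have h3 : ξ i - ζ i = (ξ i - η i - g i) - (ζ i - η i - g i) := by abel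
    rw [h3]
    refine (norm_sub_le _ _).trans ?_
    linarith

/-- Bounded tuples are covered by `exp (B k²)` balls of a fixed radius. -/
lemma hasCover_bounded {ι : Type*} [Fintype ι] {R r : ℝ} (hR : 0 ≤ R) (hr : 0 < r) :
    ∃ B : ℝ, ∀ (k : ℕ), 0 < k → ∀ E : Set (ι → Mat k), (∀ ξ ∈ E, ∀ i, ‖ξ i‖ ≤ R) →
      HasCover E r (Real.exp (B * k ^ 2)) := by
  classical
  refine ⟨2 * Fintype.card ι * Real.log (1 + 2 * (Fintype.card ι * R) / r), fun k hk E hE => ?_⟩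
  have hk' : (0 : ℝ) < √k := Real.sqrt_pos.2 (by exact_mod_cast hk)
  obtain ⟨s, hs, hcov⟩ := exists_finset_cover (E := EuclideanSpace ℂ (ι × Fin k × Fin k))
    (r := Fintype.card ι * R * √k) (σ := r * √k) (by positivity) (by positivity)
  refine ⟨s.image (vec ι k).symm, ?_, fun ξ hξ => ?_⟩
  · refine (Nat.cast_le.2 Finset.card_image_le).trans (hs.trans_eq ?_)
    have h1 : 1 + 2 * (Fintype.card ι * R * √k) / (r * √k)
        = 1 + 2 * (Fintype.card ι * R) / r := by field_simp
    have h2 : (0 : ℝ) < 1 + 2 * (Fintype.card ι * R) / r := by positivity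
    rw [h1, finrank_vec_real, ← Real.rpow_natCast, Real.rpow_def_of_pos h2]
    congr 1
    push_cast
    ring
  · have hone : frob (1 : Mat k) = √k := by
      rw [← Real.sqrt_sq (frob_nonneg (1 : Mat k)), frob_sq_eq_trace]
      simp
    have h1 : ‖vec ι k ξ‖ ≤ Fintype.card ι * R * √k := by
      refine (norm_vec_le_sum ξ).trans ?_
      calc ∑ i, frob (ξ i) ≤ ∑ i : ι, R * √k := by
            refine Finset.sum_le_sum fun i _ => ?_
            have := frob_mul_le (ξ i) 1
            rw [mul_one, hone] at this
            exact this.trans (by have := hE ξ hξ i; gcongr)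
        _ = _ := by simp; ring
    obtain ⟨c, hc, hcd⟩ := hcov _ h1
    refine ⟨_, Finset.mem_image_of_mem _ hc, (norm_vec_sub_le_iff hk _ _ _).1 ?_⟩
    rwa [map_sub, LinearEquiv.apply_symm_apply]

/-- Iteration of a refinement step down to scale `ε`. -/
lemma hasCover_iterate {ι : Type*} [Fintype ι] {k : ℕ} {E : Set (ι → Mat k)} {r₀ ρ N q a ε : ℝ}
    (hr₀ : 0 < r₀) (hρ : 0 < ρ) (hρ1 : ρ < 1) (h₀ : HasCover E r₀ N)
    (hstep : ∀ r, 0 < r → r ≤ r₀ → a * ε ≤ ρ * r → ∀ c,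
      HasCover (E ∩ {ξ | dist2 ξ c ≤ r}) (ρ * r) (Real.exp q)) (j : ℕ)
    (hj : a * ε ≤ r₀ * ρ ^ j) : HasCover E (r₀ * ρ ^ j) (N * Real.exp q ^ j) := by
  induction j with
  | zero => simpa using h₀
  | succ j ih =>
    have h1 : r₀ * ρ ^ (j + 1) ≤ r₀ * ρ ^ j := by
      gcongr ?_ * ?_
      exact pow_le_pow_of_le_one hρ.le hρ1.le (Nat.le_succ j)
    have h2 : r₀ * ρ ^ (j + 1) = ρ * (r₀ * ρ ^ j) := by ring
    rw [h2, pow_succ (Real.exp q), ← mul_assoc N]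
    refine (ih (hj.trans h1)).refine (Real.exp_nonneg _) fun c => hstep _ (by positivity) ?_ ?_ c
    · exact mul_le_of_le_one_right hr₀.le (pow_le_one₀ hρ.le hρ1.le)
    · rwa [← h2]

end Covers

/-! ### Covers of bounded microstates down to scale `ε` -/

section BoundedMicrostates

variable {M : Type*} [CStarAlgebra M] [PartialOrder M] [StarOrderedRing M] (φ : TracialState M)

/-- Each summand is the quadratic form of an orthogonal projection at the vector `unitVec φ` placed
in one coordinate. -/
lemma nullity_nonneg {κ ι : Type*} [Fintype κ] [Fintype ι] [DecidableEq ι]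
    (T : Matrix κ ι (vnTensor φ)) : 0 ≤ nullity φ T := by
  refine Finset.sum_nonneg fun i _ => ?_
  let e : PiLp 2 (fun _ : ι => L2Tensor φ) := PiLp.single 2 i (unitVec φ)
  have h : ∀ v : PiLp 2 (fun _ : ι => L2Tensor φ), ⟪unitVec φ, v i⟫_ℂ = ⟪e, v⟫_ℂ := by
    intro v
    rw [PiLp.inner_apply, Finset.sum_eq_single i]
    · simp [e]
    · intro j _ hj
      simp [e, hj]
    · simp
  rw [h, ← Submodule.inner_starProjection_left_eq_right]
  exact (absSq φ T).ker.re_inner_starProjection_nonneg (𝕜 := ℂ) e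

open scoped Matrix.Norms.L2Operator

/-- Sets of bounded microstates of `X` on which `F` is almost constant have covering numbers
governed by the nullity of the S-derivative. -/
lemma exists_cover_bounded {ι κ : Type*} [Fintype ι] [DecidableEq ι] [Fintype κ] (X : ι → M)
    (F : κ → StarPoly ι) {R : ℝ} (hR : 1 ≤ R) {β : ℝ} (hβ : 0 < β) :
    ∃ A B ε₀ : ℝ, 0 < A ∧ 0 < ε₀ ∧ ∃ (m : ℕ) (γ : ℝ), 0 < γ ∧ ∀ ε : ℝ, 0 < ε → ε < ε₀ →
      ∀ k : ℕ, 0 < k → ∀ E : Set (ι → Mat k),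
        (∀ ξ ∈ E, ξ ∈ microstates φ.toFun X m k γ ∧ ∀ i, ‖ξ i‖ ≤ R) →
        (∀ ξ ∈ E, ∀ η ∈ E, dist2 (evalTuple F ξ) (evalTuple F η) ≤ 2 * ε) →
        HasCover E (A * ε)
          (Real.exp ((B + (nullity φ (sDeriv φ F X) + β) * |Real.log ε|) * k ^ 2)) := by
  have hR0 : 0 ≤ R := by linarith
  obtain ⟨C, hC0, hC⟩ := exists_matAct_bound (symDeriv F) hR
  have hDB : DerivBound F R C := ⟨hC0, hC⟩
  obtain ⟨t, ht, hev⟩ := exists_eventually_card_le φ X F hR (show 0 < β / 4 by positivity)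
  obtain ⟨m, γ, hγ, hmicro⟩ := eventually_microFilter.1 hev
  have hnull := nullity_nonneg φ (sDeriv φ F X)
  set ν := nullity φ (sDeriv φ F X) with hν
  let n : ℝ := Fintype.card ι
  have hn : 0 ≤ n := Nat.cast_nonneg _
  let d := ν + β / 4
  have hd : 0 < d := by positivity
  -- Small enough that the operator norm nets, whose exponent carries the factor `4nτ`, use at most
  -- `β/4` of the budget per unit of logarithm.
  let τ := β / (16 * (n + 1))
  have hτ : 0 < τ := by positivity
  let a := 3 + 192 * R * (C + 1) / t
  have ha : 0 < a := by positivity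
  -- `K` collects the part of the cost of a step that does not grow with `L = log(1/ρ)`. Taking `L ≥
  -- 2K/β` absorbs it into `(β/2) L`.
  let K := β / 4 * Real.log a + d * Real.log 9
  let L := max 1 (2 * K / β)
  have hL : 0 < L := lt_max_of_lt_left one_pos
  have hKL : K ≤ β / 2 * L := by
    have : 2 * K / β ≤ L := le_max_right _ _
    rw [div_le_iff₀ hβ] at this
    linarith
  let ρ := Real.exp (-L)
  have hρ : 0 < ρ := Real.exp_pos _
  have hρ1 : ρ < 1 := Real.exp_lt_one_iff.2 (by linarith)
  have hlogρ : Real.log ρ = -L := Real.log_exp _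
  -- Makes `C · 6s · 2r ≤ tρr/4`, half of the allowed error. As `s` is proportional to `ρ`, the
  -- operator norm nets cost only `log a + L` per unit of exponent.
  let s := t * ρ / (48 * (C + 1))
  have hs : 0 < s := by positivity
  let r₀ := s * √τ / 2
  have hsτ : 0 < √τ := Real.sqrt_pos.2 hτ
  have hr₀ : 0 < r₀ := by positivity
  have hr₀s : 4 * r₀ ^ 2 = τ * s ^ 2 := by
    simp only [r₀, div_pow, mul_pow, Real.sq_sqrt hτ.le]
    ring
  obtain ⟨B₀, hB₀⟩ := hasCover_bounded (ι := ι) hR0 hr₀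
  have hq : 4 * n * τ * Real.log (3 + 4 * R / s) + d * Real.log (1 + 8 / ρ) ≤ (ν + β) * L := by
    have h1 : 3 + 4 * R / s ≤ a / ρ := by
      have : a / ρ = 3 / ρ + 4 * R / s := by
        simp only [a, s]
        field_simp
        ring
      rw [this]
      have : 3 ≤ 3 / ρ := by rw [le_div_iff₀ hρ]; linarith
      linarith
    have h2 : 1 + 8 / ρ ≤ 9 / ρ := by
      have : 1 ≤ 1 / ρ := by rw [le_div_iff₀ hρ]; linarith
      have h9 : 9 / ρ = 1 / ρ + 8 / ρ := by ring
      linarith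
    have h3 : Real.log (3 + 4 * R / s) ≤ Real.log a + L := by
      refine (Real.log_le_log (by positivity) h1).trans_eq ?_
      rw [Real.log_div ha.ne' hρ.ne', hlogρ, sub_neg_eq_add]
    have h4 : Real.log (1 + 8 / ρ) ≤ Real.log 9 + L := by
      refine (Real.log_le_log (by positivity) h2).trans_eq ?_
      rw [Real.log_div (by norm_num) hρ.ne', hlogρ, sub_neg_eq_add]
    have h5 : 4 * n * τ ≤ β / 4 := by
      have : 4 * n * τ = β / 4 * (n / (n + 1)) := by simp only [τ]; field_simp; ring
      rw [this]
      refine mul_le_of_le_one_right (by positivity) ?_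
      rw [div_le_one (by positivity)]
      linarith
    have h6 : 0 ≤ Real.log (3 + 4 * R / s) := Real.log_nonneg (by
      have : 0 ≤ 4 * R / s := by positivity
      linarith)
    calc _ ≤ β / 4 * Real.log (3 + 4 * R / s) + d * Real.log (1 + 8 / ρ) := by gcongr
      _ ≤ β / 4 * (Real.log a + L) + d * (Real.log 9 + L) := by gcongr
      _ = K + (β / 4 + d) * L := by simp only [K]; ring
      _ ≤ β / 2 * L + (β / 4 + d) * L := by gcongr
      _ = (ν + β) * L := by simp only [d]; ring
  refine ⟨8 / t / ρ, B₀ + (ν + β) * |Real.log (r₀ * t / 8)|, r₀ * t / 8, by positivity,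
    by positivity, m, γ, hγ, fun ε hε hε₀ k hk E hE hEF => ?_⟩
  have hcount : ∀ ξ ∈ E, SmallCount F t d ξ := fun ξ hξ =>
    hmicro k ξ hk (hE ξ hξ).1 (hE ξ hξ).2
  have hstep : ∀ r, 0 < r → r ≤ r₀ → 8 / t * ε ≤ ρ * r → ∀ c,
      HasCover (E ∩ {ξ | dist2 ξ c ≤ r}) (ρ * r) (Real.exp ((ν + β) * L * k ^ 2)) := by
    intro r hr hrr hεr c
    refine (hasCover_step hR0 hDB ht hr hρ hs hτ.le ?_ ?_ hk (fun ξ hξ => (hE ξ hξ).2) hEF hcount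
      c).mono le_rfl ?_
    · have h1 : 8 * ε ≤ t * (ρ * r) := by
        rw [div_mul_eq_mul_div, div_le_iff₀ ht] at hεr
        linarith
      have h2 : C * (6 * s) * (2 * r) = t * ρ * r / 4 * (C / (C + 1)) := by
        have h : ∀ x : ℝ, C * (6 * x) * (2 * r) = 48 * (C + 1) * x * r / 4 * (C / (C + 1)) :=
          fun x => by field_simp; ring
        rw [h, show 48 * (C + 1) * s = t * ρ from mul_div_cancel₀ _ (by positivity)]
      have h3 : C / (C + 1) ≤ 1 := by
        rw [div_le_one (by positivity)]
        linarith
      have h4 : t * ρ * r / 4 * (C / (C + 1)) ≤ t * ρ * r / 4 :=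
        mul_le_of_le_one_right (by positivity) h3
      rw [h2]
      linarith
    · rw [← hr₀s]
      gcongr
    · gcongr
  have hx : 0 ≤ Real.log (r₀ * t / 8 / ε) := Real.log_nonneg (by
    rw [le_div_iff₀ hε]; linarith)
  -- The iteration stops at the last scale `r₀ ρ^j` that is at least `8ε/t`. Down to there `2ε ≤
  -- tρr/4`, the other half of the allowed error, and the final radius is at most `8ε/(tρ)`.
  let j := ⌊Real.log (r₀ * t / 8 / ε) / L⌋₊
  have hj1 : j * L ≤ Real.log (r₀ * t / 8 / ε) :=
    (le_div_iff₀ hL).1 (Nat.floor_le (by positivity))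
  have hj2 : Real.log (r₀ * t / 8 / ε) < (j + 1) * L :=
    (div_lt_iff₀ hL).1 (Nat.lt_floor_add_one _)
  have hρj : ∀ i : ℕ, ρ ^ i = Real.exp (-(i * L)) := fun i => by
    rw [← Real.exp_nat_mul]; congr 1; ring
  have hexp : Real.exp (-Real.log (r₀ * t / 8 / ε)) = 8 / t * ε / r₀ := by
    rw [Real.exp_neg, Real.exp_log (by positivity)]
    field_simp
  have hj : 8 / t * ε ≤ r₀ * ρ ^ j := by
    have : 8 / t * ε / r₀ ≤ ρ ^ j := by
      rw [hρj, ← hexp]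
      gcongr
    rwa [div_le_iff₀' hr₀] at this
  have hj' : r₀ * ρ ^ j ≤ 8 / t / ρ * ε := by
    have : ρ ^ (j + 1) ≤ 8 / t * ε / r₀ := by
      rw [hρj, ← hexp]
      push_cast
      gcongr
    rw [le_div_iff₀' hr₀, pow_succ] at this
    rw [show 8 / t / ρ * ε = (8 / t * ε) / ρ by ring, le_div_iff₀ hρ]
    linarith
  refine (hasCover_iterate hr₀ hρ hρ1 (hB₀ k hk E fun ξ hξ => (hE ξ hξ).2) hstep j hj).mono
    hj' ?_
  rw [← Real.exp_nat_mul, ← Real.exp_add]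
  refine Real.exp_le_exp.2 ?_
  have h1 : Real.log (r₀ * t / 8 / ε) ≤ |Real.log (r₀ * t / 8)| + |Real.log ε| := by
    rw [Real.log_div (by positivity) hε.ne']
    linarith [le_abs_self (Real.log (r₀ * t / 8)), neg_abs_le (Real.log ε)]
  calc B₀ * k ^ 2 + j * ((ν + β) * L * k ^ 2) = (B₀ + (ν + β) * (j * L)) * k ^ 2 := by ring
    _ ≤ (B₀ + (ν + β) * (|Real.log (r₀ * t / 8)| + |Real.log ε|)) * k ^ 2 := by
        gcongr
        exact hj1.trans h1
    _ = _ := by ring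

end BoundedMicrostates

/-! ### Cutoff of microstates -/

section Cutoff

open scoped Matrix.Norms.L2Operator

lemma norm_toFun_le {M : Type*} [CStarAlgebra M] [PartialOrder M] [StarOrderedRing M]
    (φ : TracialState M) (a : M) : ‖φ.toFun a‖ ≤ ‖a‖ := by
  let e : L2 φ := ((φ.toFun.toPreGNS 1 : φ.toFun.PreGNS) : L2 φ)
  have h1 : φ.toFun a = ⟪e, leftRep φ a e⟫_ℂ := by
    simp only [e]
    rw [leftRep_coe, Completion.inner_coe, PositiveLinearMap.preGNS_inner_def]
    simp
  have h2 : ‖e‖ = 1 := by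
    simp only [e]
    rw [Completion.norm_coe, PositiveLinearMap.preGNS_norm_def]
    simp [φ.map_one]
  have h3 : ‖leftRep φ a‖ ≤ ‖a‖ := NonUnitalStarAlgHom.norm_apply_le φ.toFun.gnsStarAlgHom a
  rw [h1]
  refine (norm_inner_le_norm _ _).trans ?_
  rw [h2, one_mul]
  refine ((leftRep φ a).le_opNorm e).trans ?_
  rwa [h2, mul_one]

lemma frob_evalLetter_sub_le {ι : Type*} {k : ℕ} {x y : ι → Mat k} {δ : ℝ}
    (hx : ∀ i, frob (x i - y i) ≤ δ) (l : Letter ι) :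
    frob (evalLetter x l - evalLetter y l) ≤ δ := by
  rcases l with ⟨i, _ | _⟩
  · simpa [evalLetter] using hx i
  · simpa [evalLetter, ← star_sub, frob_star] using hx i

/-- Changing the tuple in a word whose prefixes are bounded in the Hilbert–Schmidt norm. -/
lemma norm_ntr_evalWord_sub_le {ι : Type*} {k : ℕ} (hk : 0 < k) {x y : ι → Mat k} {K θ R : ℝ}
    (hK : 0 ≤ K) (hθ : 0 ≤ θ) (hR : 1 ≤ R) (hy : ∀ i, ‖y i‖ ≤ R)
    (hxy : ∀ i, frob (x i - y i) ≤ θ * √k) {m : ℕ}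
    (hx : ∀ u : List (Letter ι), u.length ≤ m → frob (evalWord x u) ≤ K * √k)
    (u w : List (Letter ι)) (huw : u.length + w.length ≤ m) :
    ‖ntr (evalWord x u * evalWord x w) - ntr (evalWord x u * evalWord y w)‖
      ≤ w.length * (K * θ * R ^ m) := by
  have hR0 : 0 ≤ R := by linarith
  have hk' : (0 : ℝ) < k := by exact_mod_cast hk
  induction w generalizing u with
  | nil => simp [evalWord]
  | cons l w ih =>
    rw [List.length_cons] at huw
    have h1 := ih (u ++ [l]) (by simp; omega)
    have h2 : evalWord x (u ++ [l]) = evalWord x u * evalLetter x l := by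
      simp [evalWord]
    rw [h2, mul_assoc, mul_assoc] at h1
    rw [evalWord_cons, evalWord_cons]
    -- Letters are exchanged one at a time: the prefix stays in `x` and is bounded in
    -- Hilbert–Schmidt norm, the suffix is already in `y` and bounded in operator norm.
    -- Cauchy–Schwarz for the trace then applies.
    have h3 : ‖ntr (evalWord x u * (evalLetter x l * evalWord y w))
        - ntr (evalWord x u * (evalLetter y l * evalWord y w))‖ ≤ K * θ * R ^ m := by
      rw [ntr, ntr, ← sub_div, ← Matrix.trace_sub, ← mul_sub, ← sub_mul, norm_div,
        Complex.norm_natCast, div_le_iff₀ hk']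
      refine (norm_trace_mul_le _ _).trans ?_
      have h4 : frob ((evalLetter x l - evalLetter y l) * evalWord y w) ≤ θ * √k * R ^ m := by
        refine (frob_mul_le' _ _).trans ?_
        refine mul_le_mul (frob_evalLetter_sub_le hxy l) ?_ (norm_nonneg _) (by positivity)
        exact (norm_evalWord_le hR0 hy w).trans (pow_le_pow_right₀ hR (by omega))
      calc _ ≤ (K * √k) * (θ * √k * R ^ m) :=
            mul_le_mul (hx u (by omega)) h4 (frob_nonneg _) (by positivity)
        _ = K * θ * R ^ m * (√k * √k) := by ring
        _ = _ := by rw [Real.mul_self_sqrt hk'.le]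
    calc _ ≤ ‖ntr (evalWord x u * (evalLetter x l * evalWord x w))
            - ntr (evalWord x u * (evalLetter x l * evalWord y w))‖
          + ‖ntr (evalWord x u * (evalLetter x l * evalWord y w))
            - ntr (evalWord x u * (evalLetter y l * evalWord y w))‖ := norm_sub_le_norm_sub_add_norm_sub _ _ _
      _ ≤ w.length * (K * θ * R ^ m) + K * θ * R ^ m := add_le_add h1 h3
      _ = _ := by rw [List.length_cons]; push_cast; ring

lemma finite_words (ι : Type*) [Finite ι] (m : ℕ) : {w : List (Letter ι) | w.length ≤ m}.Finite :=
  List.finite_length_le _ m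

variable {M : Type*} [CStarAlgebra M] [PartialOrder M] [StarOrderedRing M] (φ : TracialState M)

/-- Microstates carry no operator norm bound, but the squared Hilbert–Schmidt norm of a word is `k`
times the moment of `w^* w`, which converges. Finitely many words allow a common constant. -/
lemma exists_eventually_frob_evalWord_le {ι : Type*} [Finite ι] (X : ι → M) (m : ℕ) :
    ∃ K : ℝ, 0 ≤ K ∧ ∀ᶠ s in microFilter φ.toFun X, ∀ u : List (Letter ι), u.length ≤ m →
      frob (evalWord s.2 u) ≤ K * √s.1 := by
  have hlim : ∀ u : List (Letter ι), ∃ K : ℝ, ∀ᶠ s in microFilter φ.toFun X,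
      frob (evalWord s.2 u) ≤ K * √s.1 := by
    intro u
    let c := (φ.toFun (evalWord X (adjWord u ++ u))).re
    refine ⟨√(|c| + 1), ?_⟩
    have h1 := (Complex.continuous_re.tendsto _).comp
      (tendsto_ntr_evalWord (φ := φ.toFun) φ.map_one X (adjWord u ++ u))
    filter_upwards [(tendsto_order.1 h1).2 (|c| + 1) (by simp only [c]; linarith [le_abs_self c]),
      eventually_pos_microFilter φ.toFun X] with s hs hk
    have hk' : (0 : ℝ) < s.1 := by exact_mod_cast hk
    rw [← Real.sqrt_mul (by positivity)]
    refine Real.le_sqrt_of_sq_le ?_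
    rw [frob_sq_eq_trace]
    simp only [Function.comp_apply, evalWord_append, evalWord_adjWord, ntr,
      Complex.div_natCast_re] at hs
    exact ((div_lt_iff₀ hk').1 hs).le
  choose K hK using hlim
  obtain ⟨K₀, hK₀⟩ := ((finite_words ι m).image K).bddAbove
  refine ⟨max K₀ 0, le_max_right _ _, ?_⟩
  have := (eventually_all_finite (finite_words ι m)).2 fun u _ => hK u
  filter_upwards [this] with s hs u hu
  refine (hs u hu).trans ?_
  gcongr
  exact (hK₀ (Set.mem_image_of_mem K hu)).trans (le_max_left _ _)

/-- Microstates are close to microstates bounded in operator norm. -/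
lemma eventually_exists_bounded {ι : Type*} [Fintype ι] (X : ι → M) {R : ℝ} (hR : 1 ≤ R)
    (hX : ∀ i, ‖X i‖ < R) (m : ℕ) {γ ε : ℝ} (hγ : 0 < γ) (hε : 0 < ε) :
    ∀ᶠ s in microFilter φ.toFun X, ∃ η : ι → Mat s.1, (∀ i, ‖η i‖ ≤ R) ∧
      η ∈ microstates φ.toFun X m s.1 γ ∧ dist2 s.2 η ≤ ε := by
  have hR0 : 0 < R := by linarith
  obtain ⟨K, hK, hKev⟩ := exists_eventually_frob_evalWord_le φ X m
  -- A cutoff error `θ` in each coordinate must stay within distance `ε` in total and within half of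
  -- the moment tolerance `γ`.
  obtain ⟨θ, hθ, hθ1, hθ2⟩ : ∃ θ : ℝ, 0 < θ ∧ Fintype.card ι * θ ≤ ε ∧
      m * (K * θ * R ^ m) ≤ γ / 2 := by
    refine ⟨min (ε / (Fintype.card ι + 1)) (γ / 2 / (m * (K * R ^ m) + 1)), by positivity, ?_, ?_⟩
    · calc (Fintype.card ι : ℝ) * min _ _ ≤ (Fintype.card ι + 1) * (ε / (Fintype.card ι + 1)) := by
            gcongr
            · linarith
            · exact min_le_left _ _
        _ = ε := by field_simp
    · calc (m : ℝ) * (K * min _ _ * R ^ m)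
          ≤ m * (K * (γ / 2 / (m * (K * R ^ m) + 1)) * R ^ m) := by
            gcongr
            exact min_le_right _ _
        _ = m * (K * R ^ m) * (γ / 2 / (m * (K * R ^ m) + 1)) := by ring
        _ ≤ (m * (K * R ^ m) + 1) * (γ / 2 / (m * (K * R ^ m) + 1)) := by
            gcongr
            linarith
        _ = γ / 2 := by field_simp
  have hmom : ∀ i, ∃ q : ℕ, ∀ᶠ s in microFilter φ.toFun X,
      ((star (s.2 i) * s.2 i) ^ (q + 1)).trace.re / R ^ (2 * q) ≤ θ ^ 2 * s.1 := by
    intro i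
    -- The cutoff error is governed by `φ((X_i^* X_i)^(q+1)) / R^(2q)`, which decays in `q` because
    -- `‖X_i‖ < R` strictly.
    have hq : Tendsto (fun q : ℕ => ‖X i‖ ^ 2 * ((‖X i‖ / R) ^ 2) ^ q) atTop (𝓝 (‖X i‖ ^ 2 * 0)) := by
      refine (tendsto_pow_atTop_nhds_zero_of_lt_one (by positivity) ?_).const_mul _
      refine pow_lt_one₀ (by positivity) ?_ two_ne_zero
      rw [div_lt_one hR0]
      exact hX i
    rw [mul_zero] at hq
    obtain ⟨q, hq⟩ := ((tendsto_order.1 hq).2 (θ ^ 2) (by positivity)).exists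
    refine ⟨q, ?_⟩
    let f : StarPoly ι := StarPoly.mono [(i, true), (i, false)] ^ (q + 1)
    have hf : ∀ {k : ℕ} (x : ι → Mat k), StarPoly.eval x f = (star (x i) * x i) ^ (q + 1) := by
      intro k x
      rw [map_pow, StarPoly.eval_mono]
      simp [evalWord, evalLetter]
    have hf' : StarPoly.eval X f = (star (X i) * X i) ^ (q + 1) := by
      simp [f, StarPoly.eval_mono, evalWord, evalLetter]
    have h1 := (Complex.continuous_re.tendsto _).comp
      (tendsto_ntr_eval (φ := φ.toFun.toLinearMap) φ.map_one X f)
    have h2 : (φ.toFun.toLinearMap (StarPoly.eval X f)).re < θ ^ 2 * R ^ (2 * q) := by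
      calc (φ.toFun.toLinearMap (StarPoly.eval X f)).re ≤ ‖φ.toFun (StarPoly.eval X f)‖ :=
            Complex.re_le_norm _
        _ ≤ ‖StarPoly.eval X f‖ := norm_toFun_le φ _
        _ ≤ ‖star (X i) * X i‖ ^ (q + 1) := by rw [hf']; exact norm_pow_le' _ (Nat.succ_pos q)
        _ = ‖X i‖ ^ 2 * ((‖X i‖ / R) ^ 2) ^ q * R ^ (2 * q) := by
            rw [CStarRing.norm_star_mul_self, div_pow, div_pow, ← pow_mul, ← pow_mul]
            field_simp
            ring
        _ < _ := by gcongr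
    filter_upwards [(tendsto_order.1 h1).2 _ h2, eventually_pos_microFilter φ.toFun X] with s hs hk
    have hk' : (0 : ℝ) < s.1 := by exact_mod_cast hk
    simp only [Function.comp_apply, hf, ntr, Complex.div_natCast_re] at hs
    rw [div_lt_iff₀ hk'] at hs
    rw [div_le_iff₀ (by positivity)]
    linarith
  choose q hq using hmom
  have hmicro : ∀ᶠ s in microFilter φ.toFun X, s.2 ∈ microstates φ.toFun X m s.1 (γ / 2) :=
    eventually_microFilter.2 ⟨m, γ / 2, by positivity, fun k ξ _ h => h⟩
  filter_upwards [eventually_all.2 hq, hmicro, hKev, eventually_pos_microFilter φ.toFun X]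
    with ⟨k, ξ⟩ hqs hms hKs hk
  have hk' : (0 : ℝ) < √k := Real.sqrt_pos.2 (by exact_mod_cast hk)
  choose η hη1 hη2 using fun i => exists_cutoff (ξ i) hR0 (q i)
  have hθη : ∀ i, frob (ξ i - η i) ≤ θ * √k := fun i => by
    refine abs_le_of_sq_le_sq' ?_ (by positivity) |>.2
    rw [mul_pow, Real.sq_sqrt (Nat.cast_nonneg k)]
    exact (hη2 i).trans (hqs i)
  refine ⟨η, hη1, fun w hw1 hw2 => ?_, ?_⟩
  · have h1 := hms w hw1 hw2
    have h2 := norm_ntr_evalWord_sub_le hk hK hθ.le hR hη1 hθη hKs [] w (by simpa using hw2)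
    rw [evalWord_nil, one_mul, one_mul] at h2
    have h3 : w.length * (K * θ * R ^ m) ≤ γ / 2 := by
      refine le_trans ?_ hθ2
      gcongr
    calc _ ≤ ‖φ.toFun (evalWord X w) - ntr (evalWord ξ w)‖
          + ‖ntr (evalWord ξ w) - ntr (evalWord η w)‖ := norm_sub_le_norm_sub_add_norm_sub _ _ _
      _ < γ / 2 + γ / 2 := add_lt_add_of_lt_of_le h1 (h2.trans h3)
      _ = γ := by ring
  · refine (norm_vec_sub_le_iff hk _ _ _).1 ((norm_vec_le_sum _).trans ?_)
    calc ∑ i, frob ((ξ - η) i) ≤ ∑ i : ι, θ * √k := Finset.sum_le_sum fun i _ => hθη i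
      _ = Fintype.card ι * θ * √k := by simp; ring
      _ ≤ ε * √k := by gcongr

/-- The polynomial obtained by substituting `F` and the generators into a letter. -/
def substLetter {ι κ : Type*} (F : κ → StarPoly ι) : Letter (κ ⊕ ι) → StarPoly ι
  | (Sum.inl i, false) => F i
  | (Sum.inl i, true) => (F i).adj
  | (Sum.inr j, b) => StarPoly.mono [(j, b)]

lemma eval_substLetter {ι κ A : Type*} [Ring A] [Algebra ℂ A] [StarRing A] [StarModule ℂ A]
    (F : κ → StarPoly ι) (x : ι → A) (w : List (Letter (κ ⊕ ι))) :
    StarPoly.eval x (w.map (substLetter F)).prod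
      = evalWord (Sum.elim (fun i => StarPoly.eval x (F i)) x) w := by
  rw [map_list_prod, List.map_map, evalWord]
  congr 2
  funext ⟨i, b⟩
  rcases i with i | i <;> cases b <;>
    simp [substLetter, evalLetter, StarPoly.eval_adj, StarPoly.eval_mono, evalWord]

/-- The values of `F` at microstates of `X` are microstates of `F(X)` in the presence of `X`. -/
lemma eventually_mem_relMicrostates {ι κ : Type*} [Finite ι] [Finite κ] (X : ι → M)
    (F : κ → StarPoly ι) (m : ℕ) {γ : ℝ} (hγ : 0 < γ) :
    ∀ᶠ s in microFilter φ.toFun X, evalTuple F s.2 ∈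
      relMicrostates φ.toFun (fun i => StarPoly.eval X (F i)) X m s.1 γ := by
  have h : ∀ w : List (Letter (κ ⊕ ι)), ∀ᶠ s in microFilter φ.toFun X,
      ‖φ.toFun (evalWord (Sum.elim (fun i => StarPoly.eval X (F i)) X) w)
        - ntr (evalWord (Sum.elim (evalTuple F s.2) s.2) w)‖ < γ := by
    intro w
    have h1 := tendsto_ntr_eval (φ := φ.toFun.toLinearMap) φ.map_one X
      (w.map (substLetter F)).prod
    simp only [eval_substLetter] at h1
    filter_upwards [(Metric.tendsto_nhds.1 h1) γ hγ] with s hs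
    rwa [dist_comm, dist_eq_norm] at hs
  filter_upwards [(eventually_all_finite (finite_words (κ ⊕ ι) m)).2 fun w _ => h w] with s hs
  -- The tuple itself witnesses the presence of `X`.
  exact ⟨s.2, fun w _ hw => hs w hw⟩

end Cutoff

/-! ### Comparison of entropy dimensions -/

section EntropyComparison

variable {ι κ : Type*} [Fintype ι] [Fintype κ] {Γ : ℕ → (k : ℕ) → ℝ → Set (ι → Mat k)}
  {Γ' : ℕ → (k : ℕ) → ℝ → Set (κ → Mat k)}

/-- A factor `exp(D k²)` becomes the summand `D` under `k⁻² log`. Comparison with a real `c` above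
the rate avoids arithmetic with infinite values. -/
lemma entropyRate_le {ε ε' D c : ℝ}
    (h : ∀ (m' : ℕ) (γ' : ℝ), 0 < γ' → ∃ (m : ℕ) (γ : ℝ), 0 < γ ∧ ∀ k : ℕ, 0 < k →
      (coveringNumber ε (Γ m k γ) : ENNReal) ≤
        coveringNumber ε' (Γ' m' k γ') * ENNReal.ofReal (Real.exp (D * k ^ 2)))
    (hc : entropyRate Γ' ε' < (c : EReal)) : entropyRate Γ ε ≤ ((c + D : ℝ) : EReal) := by
  simp only [entropyRate, iInf_lt_iff] at hc
  obtain ⟨m', γ', hγ', hlim⟩ := hc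
  obtain ⟨m, γ, hγ, h⟩ := h m' γ' hγ'
  refine (iInf_le_of_le m (iInf₂_le γ hγ)).trans (limsup_le_of_le (by isBoundedDefault) ?_)
  filter_upwards [eventually_lt_of_limsup_lt hlim, eventually_gt_atTop 0] with k hk hk0
  have hk2 : (0 : EReal) < (((k : ℝ) ^ 2 : ℝ) : EReal) := by
    rw [← EReal.coe_zero, EReal.coe_lt_coe_iff]
    positivity
  rw [EReal.div_lt_iff hk2 (EReal.coe_ne_top _), ← EReal.coe_mul] at hk
  rw [EReal.div_le_iff_le_mul hk2 (EReal.coe_ne_top _), ← EReal.coe_mul]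
  refine (ENNReal.log_monotone (h k hk0)).trans ?_
  rw [ENNReal.log_mul_add, ENNReal.log_ofReal_of_pos (Real.exp_pos _), Real.log_exp]
  refine (add_le_add_left hk.le _).trans_eq ?_
  rw [← EReal.coe_add]
  congr 1
  ring

/-- After division by `|log ε|`, the constant `B` and the rescaling of `ε` by `A` disappear in the
limit, and `β` is arbitrary. The constants may not depend on `m'` and `γ'`, while `m` and `γ` may
depend on `ε`. -/
lemma entropyDim_le {ν : ℝ}
    (h : ∀ β : ℝ, 0 < β → ∃ A B ε₀ : ℝ, 0 < A ∧ 0 < ε₀ ∧ ∀ ε : ℝ, 0 < ε → ε < ε₀ →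
      ∀ (m' : ℕ) (γ' : ℝ), 0 < γ' → ∃ (m : ℕ) (γ : ℝ), 0 < γ ∧ ∀ k : ℕ, 0 < k →
        (coveringNumber (A * ε) (Γ m k γ) : ENNReal) ≤ coveringNumber ε (Γ' m' k γ') *
          ENNReal.ofReal (Real.exp ((B + (ν + β) * |Real.log ε|) * k ^ 2))) :
    entropyDim Γ ≤ (ν : EReal) + entropyDim Γ' := by
  refine EReal.le_of_forall_lt_iff_le.1 fun z hz => ?_
  have hz' : entropyDim Γ' < ((z - ν : ℝ) : EReal) := by
    rw [EReal.coe_sub, EReal.lt_sub_iff_add_lt (by simp) (by simp), add_comm]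
    exact hz
  obtain ⟨c, hc1, hc2⟩ := EReal.lt_iff_exists_real_btwn.1 hz'
  rw [EReal.coe_lt_coe_iff] at hc2
  -- With this choice `z = c + ν + 2β`: one `β` is spent in `h`, the other absorbs `B` and `log A`
  -- once `|log ε|` is large.
  obtain ⟨A, B, ε₀, hA, hε₀, h⟩ := h ((z - ν - c) / 2) (by linarith)
  set β := (z - ν - c) / 2 with hβ
  have hβ0 : 0 < β := by rw [hβ]; linarith
  have hscale : Tendsto (fun ε : ℝ => ε / A) (𝓝[>] 0) (𝓝[>] 0) := by
    refine tendsto_nhdsWithin_iff.2 ⟨?_, ?_⟩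
    · have : Tendsto (fun ε : ℝ => ε / A) (𝓝 0) (𝓝 (0 / A)) := tendsto_id.div_const A
      rw [zero_div] at this
      exact this.mono_left nhdsWithin_le_nhds
    · filter_upwards [self_mem_nhdsWithin] with ε hε
      exact div_pos hε hA
  have hlog : Tendsto (fun ε : ℝ => -Real.log ε) (𝓝[>] 0) atTop :=
    tendsto_neg_atBot_atTop.comp Real.tendsto_log_nhdsGT_zero
  have hev := hscale.eventually (eventually_lt_of_limsup_lt hc1)
  have hsmall : ∀ᶠ ε : ℝ in 𝓝[>] 0, ε / A < ε₀ :=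
    (hscale.mono_right nhdsWithin_le_nhds).eventually (gt_mem_nhds hε₀)
  refine limsup_le_of_le (by isBoundedDefault) ?_
  filter_upwards [hev, hsmall, self_mem_nhdsWithin, hlog.eventually_gt_atTop 0,
    (hlog.comp hscale).eventually_gt_atTop 0,
    hlog.eventually_ge_atTop (((c + ν + β) * Real.log A + B) / β)] with ε h1 h2 hε h3 h4 h5
  replace hε : 0 < ε := hε
  simp only [Function.comp_apply] at h4
  have habs : |Real.log ε| = -Real.log ε := abs_of_neg (by linarith)
  have habs' : |Real.log (ε / A)| = -Real.log (ε / A) := abs_of_neg (by linarith)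
  have hlogA : Real.log (ε / A) = Real.log ε - Real.log A := Real.log_div hε.ne' hA.ne'
  have hpos : (0 : EReal) < ((|Real.log ε| : ℝ) : EReal) := by
    rw [← EReal.coe_zero, EReal.coe_lt_coe_iff, habs]; exact h3
  have hpos' : (0 : EReal) < ((|Real.log (ε / A)| : ℝ) : EReal) := by
    rw [← EReal.coe_zero, EReal.coe_lt_coe_iff, habs']; exact h4
  rw [EReal.div_lt_iff hpos' (EReal.coe_ne_top _), ← EReal.coe_mul] at h1
  have h6 := entropyRate_le (h (ε / A) (by positivity) h2) h1
  rw [mul_div_cancel₀ _ hA.ne'] at h6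
  rw [EReal.div_le_iff_le_mul hpos (EReal.coe_ne_top _), ← EReal.coe_mul]
  refine h6.trans (EReal.coe_le_coe_iff.2 ?_)
  rw [habs, habs', hlogA]
  rw [div_le_iff₀ hβ0] at h5
  have : z = c + ν + 2 * β := by rw [hβ]; ring
  rw [this]
  linarith

end EntropyComparison

/-! ### Comparison of microstates of `X` and of `F(X)`, and conclusion -/

section Main

variable {M : Type*} [CStarAlgebra M] [PartialOrder M] [StarOrderedRing M] (φ : TracialState M)

open scoped Matrix.Norms.L2Operator in
/-- Covering numbers of microstates of `X` in terms of those of microstates of `F(X)` in the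
presence of `X`. -/
lemma exists_coveringNumber_microstates_le {ι κ : Type*} [Fintype ι] [DecidableEq ι] [Fintype κ]
    (X : ι → M) (F : κ → StarPoly ι) {β : ℝ} (hβ : 0 < β) :
    ∃ A B ε₀ : ℝ, 0 < A ∧ 0 < ε₀ ∧ ∀ ε : ℝ, 0 < ε → ε < ε₀ →
      ∀ (m' : ℕ) (γ' : ℝ), 0 < γ' → ∃ (m : ℕ) (γ : ℝ), 0 < γ ∧ ∀ k : ℕ, 0 < k →
        (coveringNumber (A * ε) (microstates φ.toFun X m k γ) : ENNReal) ≤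
          coveringNumber ε
            (relMicrostates φ.toFun (fun i => StarPoly.eval X (F i)) X m' k γ') *
          ENNReal.ofReal
            (Real.exp ((B + (nullity φ (sDeriv φ F X) + β) * |Real.log ε|) * k ^ 2)) := by
  obtain ⟨R, hR, hX⟩ : ∃ R : ℝ, 1 ≤ R ∧ ∀ i, ‖X i‖ < R := by
    have h0 : ∀ i, 0 ≤ ‖X i‖ := fun i => norm_nonneg _
    have h1 : 0 ≤ ∑ i, ‖X i‖ := Finset.sum_nonneg fun i _ => h0 i
    refine ⟨∑ i, ‖X i‖ + 1, by linarith, fun i => ?_⟩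
    have h2 : ‖X i‖ ≤ ∑ i, ‖X i‖ :=
      Finset.single_le_sum (f := fun i => ‖X i‖) (fun i _ => h0 i) (Finset.mem_univ i)
    linarith
  obtain ⟨A, B, ε₀, hA, hε₀, m₀, γ₀, hγ₀, hcov⟩ := exists_cover_bounded φ X F hR hβ
  -- `A` comes from covering the bounded pieces, one further `ε` from moving a microstate to a
  -- bounded one, and one from passing from closed to open balls.
  refine ⟨A + 2, B, ε₀, by positivity, hε₀, fun ε hε hεε m' γ' hγ' => ?_⟩
  obtain ⟨m₁, γ₁, hγ₁, hrel⟩ :=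
    eventually_microFilter.1 (eventually_mem_relMicrostates φ X F m' hγ')
  obtain ⟨m, γ, hγ, hbdd⟩ := eventually_microFilter.1
    (eventually_exists_bounded φ X hR hX (max m₀ m₁) (lt_min hγ₀ hγ₁) hε)
  refine ⟨m, γ, hγ, fun k hk => ?_⟩
  set N := Real.exp ((B + (nullity φ (sDeriv φ F X) + β) * |Real.log ε|) * k ^ 2) with hN
  set A' := relMicrostates φ.toFun (fun i => StarPoly.eval X (F i)) X m' k γ' with hA'
  have hN0 : 0 < N := Real.exp_pos _
  by_cases htop : coveringNumber ε A' = ⊤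
  · rw [htop, ENat.toENNReal_top, ENNReal.top_mul (by simpa using hN0)]
    exact le_top
  obtain ⟨q, hq⟩ := ENat.ne_top_iff_exists.1 htop
  have hlt : coveringNumber ε A' < ((q + 1 : ℕ) : ℕ∞) := by
    rw [← hq]
    exact_mod_cast Nat.lt_succ_self q
  simp only [coveringNumber, iInf_lt_iff] at hlt
  obtain ⟨Λ, hΛ, hΛq⟩ := hlt
  have hfin : Λ.Finite := Set.encard_lt_top_iff.1 (hΛq.trans (ENat.natCast_lt_top _))
  have hcard : hfin.toFinset.card ≤ q := by
    rw [hfin.encard_eq_coe_toFinset_card] at hΛq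
    exact Nat.lt_succ_iff.1 (by exact_mod_cast hΛq)
  -- The bounded microstates whose value under `F` lies in one ball of the cover; any two values are
  -- at distance at most `2ε`.
  let E : (κ → Mat k) → Set (ι → Mat k) := fun c =>
    {ξ | (ξ ∈ microstates φ.toFun X (max m₀ m₁) k (min γ₀ γ₁) ∧ ∀ i, ‖ξ i‖ ≤ R) ∧
      dist2 (evalTuple F ξ) c < ε}
  have hE : ∀ c, HasCover (E c) (A * ε) N := by
    intro c
    refine hcov ε hε hεε k hk (E c) (fun ξ hξ => ⟨microstates_anti φ.toFun X (le_max_left _ _)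
      (min_le_left _ _) hξ.1.1, hξ.1.2⟩) fun ξ hξ η hη => ?_
    have h1 := hξ.2
    have h2 := hη.2
    rw [dist2_comm] at h2
    linarith [dist2_triangle (evalTuple F ξ) c (evalTuple F η)]
  let P : (κ → Mat k) → Set (ι → Mat k) := fun c => {ξ | ∃ η ∈ E c, dist2 ξ η ≤ ε}
  have hP : ∀ c, HasCover (P c) ((A + 1) * ε) N := by
    intro c
    obtain ⟨s, hs, hsc⟩ := hE c
    refine ⟨s, hs, fun ξ ⟨η, hη, hξη⟩ => ?_⟩
    obtain ⟨d, hd, hηd⟩ := hsc η hη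
    refine ⟨d, hd, (dist2_triangle ξ η d).trans ?_⟩
    linarith
  have hmain : HasCover (microstates φ.toFun X m k γ) ((A + 1) * ε) (hfin.toFinset.card * N) := by
    refine HasCover.of_subset_iUnion hfin.toFinset P (fun ξ hξ => ?_) fun c _ => hP c
    obtain ⟨η, hη1, hη2, hη3⟩ := hbdd k ξ hk hξ
    have h1 := hΛ (hrel k η hk
      (microstates_anti φ.toFun X (le_max_right _ _) (min_le_right _ _) hη2))
    obtain ⟨c, hc, hηc⟩ := Set.mem_iUnion₂.1 h1
    exact ⟨c, hfin.mem_toFinset.2 hc, η, ⟨⟨hη2, hη1⟩, hηc⟩, hη3⟩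
  refine (coveringNumber_le_of_hasCover hmain (by linarith)).trans ?_
  rw [← hq, ENat.toENNReal_coe, ENNReal.ofReal_mul (Nat.cast_nonneg _), ENNReal.ofReal_natCast]
  gcongr

lemma delta0_le {ι κ : Type*} [Fintype ι] [DecidableEq ι] [Fintype κ] (X : ι → M)
    (F : κ → StarPoly ι) :
    delta0 φ.toFun X ≤ ((nullity φ (sDeriv φ F X) : ℝ) : EReal)
      + relDelta0 φ.toFun (fun i => StarPoly.eval X (F i)) X :=
  entropyDim_le fun _ hβ => exists_coveringNumber_microstates_le φ X F hβ

/-- Since `T^*T` is self-adjoint, its kernel is the orthogonal complement of its closed range. The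
two projections sum to 1, whose unnormalized trace is the number of columns because `unitVec φ` has
norm 1. -/
lemma nullity_add_rank {κ ι : Type*} [Fintype κ] [Fintype ι] [DecidableEq ι]
    (T : Matrix κ ι (vnTensor φ)) : nullity φ T + rank φ T = Fintype.card ι := by
  have hker : (absSq φ T).range.topologicalClosureᗮ = (absSq φ T).ker := by
    rw [Submodule.orthogonal_closure]
    rw [ContinuousLinearMap.orthogonal_range]
    congr 1
    simp [absSq]
  have h : (absSq φ T).ker.starProjection
      = 1 - (absSq φ T).range.topologicalClosure.starProjection := by
    rw [← Submodule.starProjection_orthogonal']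
    congr 1
    exact hker.symm
  rw [nullity, rank, h, matTrace, matTrace, ← Finset.sum_add_distrib]
  simp [inner_sub_right, norm_unitVec]

end Main

end FreeEntropy

end

theorem corollary4p8 {M : Type*} [CStarAlgebra M] [PartialOrder M] [StarOrderedRing M]
    [WStarAlgebra M] (φ : FreeEntropy.TracialState M) {n p : ℕ} (X : Fin n → M)
    (F : Fin p → FreeEntropy.StarPoly (Fin n)) :
    FreeEntropy.delta0 φ.toFun X ≤
        ((FreeEntropy.nullity φ (FreeEntropy.sDeriv φ F X) : ℝ) : EReal)
          + FreeEntropy.relDelta0 φ.toFun (fun i => FreeEntropy.StarPoly.eval X (F i)) X ∧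
      ((FreeEntropy.nullity φ (FreeEntropy.sDeriv φ F X) : ℝ) : EReal)
          + FreeEntropy.relDelta0 φ.toFun (fun i => FreeEntropy.StarPoly.eval X (F i)) X =
        ((2 * (n : ℝ) - FreeEntropy.rank φ (FreeEntropy.sDeriv φ F X) : ℝ) : EReal)
          + FreeEntropy.relDelta0 φ.toFun (fun i => FreeEntropy.StarPoly.eval X (F i)) X ∧
      FreeEntropy.nullity φ (FreeEntropy.sDeriv φ F X) =
        2 * (n : ℝ) - FreeEntropy.rank φ (FreeEntropy.sDeriv φ F X) := by
  have h : FreeEntropy.nullity φ (FreeEntropy.sDeriv φ F X) =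
      2 * (n : ℝ) - FreeEntropy.rank φ (FreeEntropy.sDeriv φ F X) := by
    have := FreeEntropy.nullity_add_rank φ (FreeEntropy.sDeriv φ F X)
    simp only [Fintype.card_prod, Fintype.card_fin, Nat.cast_mul, Nat.cast_ofNat] at this
    linarith
  exact ⟨FreeEntropy.delta0_le φ X F, by rw [h], h⟩
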